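/- Let $\mathbb D=\{z\in\mathbb C:|z|<1\}$, let $n\ge1$, let $F=\{\sigma_1,\dots,\sigma_n\}$ consist of $n$ pairwise distinct points of $\partial\mathbb D$, and let $\Lambda=(\lambda_1,\dots,\lambda_n)\in(-\infty,0)^n$. A one-parameter semigroup $(\phi_t)_{t\ge0}$ is a family of holomorphic self-maps of $\mathbb D$ with $\phi_0=\mathrm{id}$, $\phi_{s+t}=\phi_s\circ\phi_t$ and $\phi_t(z)\to z$ as $t\to0^+$ for all $z\in\mathbb D$; its infinitesimal generator is the holomorphic function $G$ on $\mathbb D$ with $\frac{d}{dt}\phi_t(z)=G(\phi_t(z))$. A point $\sigma\in\partial\mathbb D$ is a boundary regular fixed point (BRFP) of a holomorphic $\varphi:\mathbb D\to\mathbb D$ if $\varphi$ has angular limit $\sigma$ at $\sigma$ and the angular derivative $\varphi'(\sigma)=\angle\lim_{z\to\sigma}\frac{\varphi(z)-\sigma}{z-\sigma}$ exists finitely. The Denjoy–Wolff point $\tau\in\overline{\mathbb D}$ of $\varphi\ne\mathrm{id}$ is its fixed point in $\mathbb D$ if there is one, and otherwise its unique BRFP with $\varphi'(\tau)\le1$;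 the Denjoy–Wolff point of a non-trivial semigroup is the common one of all $\phi_t\neq\mathrm{id}$. The spectral value of $(\phi_t)$ at $p$, where $p$ is its Denjoy–Wolff point or a BRFP of all $\phi_t$, is the number $\lambda$ with $\phi_t'(p)=e^{-\lambda t}$ for all $t\ge0$. For $\tau\in\overline{\mathbb D}\setminus F$ let $\mathrm{Gen}_\tau(F,\Lambda)$ be the class of all infinitesimal generators $G$ such that either $G\equiv0$ or the semigroup generated by $G$ has Denjoy–Wolff point $\tau$, and such that this semigroup has BRFPs at $\sigma_1,\dots,\sigma_n$ with spectral values $\lambda_k'$ satisfying $\lambda_k\le\lambda_k'\le0$, $k=1,\dots,n$. Let $\lambda(G)$ be the spectral value at $\tau$ of the semigroup generated by $G$ (so $\lambda(0)=0$). Put $$r:=\Big(\sum_{k=1}^n|\lambda_k|^{-1}\Big)^{-1},\qquad \alpha_k:=\frac{|\tau-\sigma_k|^2}{2|\lambda_k|},\qquad p_0(z):=\sum_{k=1}^n\alpha_k\frac{\sigma_k+z}{\sigma_k-z},$$ $$G_{\max}(z):=\frac{(\tau-z)(1-\overline\tau z)}{p_0(z)-i\sum_{k=1}^n|\lambda_k|^{-1}\operatorname{Im}(\overline{\sigma_k}\tau)},\qquad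 z\in\mathbb D.$$ Then $\lambda(G)$ is well defined on $\mathrm{Gen}_\tau(F,\Lambda)$, and the following holds. (A) If $\tau\in\mathbb D$, then the range of $G\mapsto\lambda(G)$ on $\mathrm{Gen}_\tau(F,\Lambda)$ is the closed disk $\Omega=\{\omega:|\omega-r|\le r\}$, and each boundary point of $\Omega$ is delivered by exactly one $G\in\mathrm{Gen}_\tau(F,\Lambda)$. If $\tau\ne0$, the family of all these extremal generators coincides with $\{G_\zeta:\zeta\in\partial Z\}$, where $$Z:=\Big\{\zeta\in\mathbb C:\Big|\Big(2\tau^{-1}\sum_{k=1}^n\alpha_k\Big)\zeta-1\Big|\le1\Big\},$$ $G_0\equiv0$ and $$G_\zeta(z):=\frac{(\tau-z)(1-\overline\tau z)}{i\operatorname{Im}\ell_\zeta+p_0(z)},\qquad \ell_\zeta:=\frac\tau\zeta-\sum_{k=1}^n\alpha_k,\qquad \zeta\in\partial Z\setminus\{0\}.$$ If $\tau=0$, the unique generator $G$ with $\lambda(G)=\omega$, for $\omega\in\partial\Omega\setminus\{0\}$, is $$\widehat G_\omega(z):=\frac{-z}{i\operatorname{Im}\big(\frac1\omega-\frac12\sum_{k=1}^n|\lambda_k|^{-1}\big)+p_0(z)},$$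 and for $\omega=0$ it is $\widehat G_0\equiv0$. (A$'$) In particular, if $\tau\in\mathbb D$, then $\operatorname{Re}\lambda(G)\le2r$ for all $G\in\mathrm{Gen}_\tau(F,\Lambda)$. The estimate is sharp: equality holds for $G=G_{\max}$, which belongs to the class and satisfies $\lambda(G_{\max})=2r$, and only for it. (B) If $\tau\in\partial\mathbb D\setminus F$, then $\lambda(G)$ is real and $\lambda(G)\le r$ for all $G\in\mathrm{Gen}_\tau(F,\Lambda)$. The estimate is sharp: equality holds for $G=G_{\max}$, which belongs to the class, and only for it. -/

import Mathlib

open Set Filter Topology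

namespace DiskSemigroup

/-- The open unit disk. Functions on the disk are represented by functions `ℂ → ℂ` of which only
the restriction to `disk` matters; equality of such functions is `Set.EqOn _ _ disk`. -/
abbrev disk : Set ℂ := Metric.ball (0 : ℂ) 1

/-- The Stolz region of aperture `M` with vertex `σ` (it is empty if `‖σ‖ = 1` and `M < 1`). -/
def stolz (σ : ℂ) (M : ℝ) : Set ℂ := {z | z ∈ disk ∧ ‖z - σ‖ ≤ M * (1 - ‖z‖)}

/-- The angular (non-tangential) limit of `f` at the boundary point `σ` exists and equals `L`. -/
def HasAngularLimit (f : ℂ → ℂ) (σ L : ℂ) : Prop :=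
  ∀ M : ℝ, Tendsto f (𝓝[stolz σ M] σ) (𝓝 L)

/-- `σ` is a boundary regular fixed point of `f`, with (finite) angular derivative `d`. -/
structure IsBRFPWith (f : ℂ → ℂ) (σ d : ℂ) : Prop where
  norm_eq_one : ‖σ‖ = 1
  fixed : HasAngularLimit f σ σ
  angular_deriv : HasAngularLimit (fun z => (f z - σ) / (z - σ)) σ d

/-- `τ` is the Denjoy-Wolff point of the holomorphic self-map `f ≠ id` of the disk: either `τ` is a
fixed point in the disk (necessarily unique, with `‖f' τ‖ ≤ 1`, by the Schwarz lemma), or `f` has no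
fixed point in the disk and `τ` is a boundary regular fixed point with `f' τ ≤ 1`. -/
def IsDWPoint (f : ℂ → ℂ) (τ : ℂ) : Prop :=
  ¬ EqOn f id disk ∧
    ((τ ∈ disk ∧ f τ = τ) ∨
      ((∀ z ∈ disk, f z ≠ z) ∧ ∃ d : ℝ, d ≤ 1 ∧ IsBRFPWith f τ (d : ℂ)))

/-- `(φ t)`, `t ≥ 0`, is a one-parameter semigroup of holomorphic self-maps of the disk.
The values of `φ t` for `t < 0` are irrelevant. -/
structure IsSemigroup (φ : ℝ → ℂ → ℂ) : Prop where
  holo : ∀ t : ℝ, 0 ≤ t → DifferentiableOn ℂ (φ t) disk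
  mapsTo : ∀ t : ℝ, 0 ≤ t → MapsTo (φ t) disk disk
  zero : ∀ z ∈ disk, φ 0 z = z
  add : ∀ s t : ℝ, 0 ≤ s → 0 ≤ t → ∀ z ∈ disk, φ (s + t) z = φ s (φ t z)
  cont : ∀ z ∈ disk, Tendsto (fun t => φ t z) (𝓝[>] 0) (𝓝 z)

/-- `(φ t)` is a one-parameter semigroup and `G` is its infinitesimal generator. -/
structure Generates (G : ℂ → ℂ) (φ : ℝ → ℂ → ℂ) : Prop where
  semigroup : IsSemigroup φ
  holo : DifferentiableOn ℂ G disk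
  flow : ∀ z ∈ disk, ∀ t : ℝ, 0 ≤ t →
    HasDerivWithinAt (fun s : ℝ => φ s z) (G (φ t z)) (Ici 0) t

/-- The semigroup `(φ t)` is non-trivial and `τ` is its Denjoy-Wolff point, i.e. the Denjoy-Wolff
point of each of its elements different from the identity. -/
def IsDWPointOf (φ : ℝ → ℂ → ℂ) (τ : ℂ) : Prop :=
  (∃ t : ℝ, 0 ≤ t ∧ ¬ EqOn (φ t) id disk) ∧
    ∀ t : ℝ, 0 ≤ t → ¬ EqOn (φ t) id disk → IsDWPoint (φ t) τ

/-- `p` is a fixed point of `f` with derivative `d` there: an ordinary fixed point and ordinary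
derivative if `p` is in the disk, a boundary regular fixed point and angular derivative if `p` is on
the unit circle. -/
def HasMultiplier (f : ℂ → ℂ) (p d : ℂ) : Prop :=
  (p ∈ disk ∧ f p = p ∧ HasDerivAt f d p) ∨ IsBRFPWith f p d

/-- `ω` is the spectral value of the semigroup `(φ t)` at its (interior or boundary regular) fixed
point `p`: `φ_t'(p) = exp (-ω t)` for all `t ≥ 0`. -/
def HasSpectralValue (φ : ℝ → ℂ → ℂ) (p ω : ℂ) : Prop :=
  ∀ t : ℝ, 0 ≤ t → HasMultiplier (φ t) p (Complex.exp (-ω * t))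

/-- The class of all infinitesimal generators `G` which vanish identically or whose semigroup has
Denjoy-Wolff point `τ`, and whose semigroup has boundary regular fixed points at the `σ k`, with
spectral values between `lam k` and `0`. -/
def Gen {n : ℕ} (τ : ℂ) (σ : Fin n → ℂ) (lam : Fin n → ℝ) : Set (ℂ → ℂ) :=
  {G | ∃ φ : ℝ → ℂ → ℂ, Generates G φ ∧ (EqOn G 0 disk ∨ IsDWPointOf φ τ) ∧
    ∀ k, ‖σ k‖ = 1 ∧ ∃ l : ℝ, lam k ≤ l ∧ l ≤ 0 ∧ HasSpectralValue φ (σ k) (l : ℂ)}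

/-- `ω = λ(G)`: the spectral value at `τ` of the semigroup generated by `G`. -/
def IsSpectralValue (G : ℂ → ℂ) (τ ω : ℂ) : Prop :=
  ∃ φ : ℝ → ℂ → ℂ, Generates G φ ∧ HasSpectralValue φ τ ω

/-- `r = (∑ 1 / |λ_k|)⁻¹`. -/
noncomputable def radius {n : ℕ} (lam : Fin n → ℝ) : ℝ := (∑ k, |lam k|⁻¹)⁻¹

/-- `α_k = |τ - σ_k|² / (2 |λ_k|)`. -/
noncomputable def alpha {n : ℕ} (τ : ℂ) (σ : Fin n → ℂ) (lam : Fin n → ℝ) (k : Fin n) : ℝ :=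
  ‖τ - σ k‖ ^ 2 / (2 * |lam k|)

/-- `p₀(z) = ∑ α_k (σ_k + z) / (σ_k - z)`. -/
noncomputable def pZero {n : ℕ} (τ : ℂ) (σ : Fin n → ℂ) (lam : Fin n → ℝ) (z : ℂ) : ℂ :=
  ∑ k, (alpha τ σ lam k : ℂ) * ((σ k + z) / (σ k - z))

/-- The function `z ↦ (τ - z) (1 - τ̄ z) / (i c + p₀(z))`. -/
noncomputable def genOf {n : ℕ} (τ : ℂ) (σ : Fin n → ℂ) (lam : Fin n → ℝ) (c : ℝ) (z : ℂ) : ℂ :=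
  (τ - z) * (1 - (starRingEnd ℂ) τ * z) / (Complex.I * c + pZero τ σ lam z)

/-- The disk `Z` of all `ζ` with `|(2 τ⁻¹ ∑ α_k) ζ - 1| ≤ 1` (for `τ ≠ 0`). -/
def Z {n : ℕ} (τ : ℂ) (σ : Fin n → ℂ) (lam : Fin n → ℝ) : Set ℂ :=
  {ζ | ‖(2 * τ⁻¹ * ∑ k, (alpha τ σ lam k : ℂ)) * ζ - 1‖ ≤ 1}

/-- `ℓ_ζ = τ / ζ - ∑ α_k` (for `ζ ≠ 0`). -/
noncomputable def ell {n : ℕ} (τ : ℂ) (σ : Fin n → ℂ) (lam : Fin n → ℝ) (ζ : ℂ) : ℂ :=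
  τ / ζ - ∑ k, (alpha τ σ lam k : ℂ)

open Classical in
/-- The extremal generators `G_ζ`, `ζ ∈ ∂Z`, for `τ ≠ 0`; here `G_0 ≡ 0`. -/
noncomputable def GZeta {n : ℕ} (τ : ℂ) (σ : Fin n → ℂ) (lam : Fin n → ℝ) (ζ : ℂ) : ℂ → ℂ :=
  if ζ = 0 then 0 else genOf τ σ lam (ell τ σ lam ζ).im

open Classical in
/-- The extremal generators `z ↦ -z / (i Im (1 / ω - ½ ∑ 1 / |λ_k|) + p₀(z))` for `τ = 0`, which are
indexed by the boundary points `ω` of the disk `|ω - r| ≤ r`; for `ω = 0` it is `0`. -/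
noncomputable def GHat {n : ℕ} (σ : Fin n → ℂ) (lam : Fin n → ℝ) (ω : ℂ) : ℂ → ℂ :=
  if ω = 0 then 0
  else fun z => -z /
    (Complex.I * ((1 / ω - (1 / 2 : ℂ) * ∑ k, ((|lam k|⁻¹ : ℝ) : ℂ)).im : ℝ) + pZero 0 σ lam z)

/-- The extremal generator
`z ↦ (τ - z) (1 - τ̄ z) / (p₀(z) - i ∑ |λ_k|⁻¹ Im (σ̄_k τ))`. -/
noncomputable def GMax {n : ℕ} (τ : ℂ) (σ : Fin n → ℂ) (lam : Fin n → ℝ) (z : ℂ) : ℂ :=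
  (τ - z) * (1 - (starRingEnd ℂ) τ * z) /
    (pZero τ σ lam z
      - Complex.I * ((∑ k, |lam k|⁻¹ * ((starRingEnd ℂ) (σ k) * τ).im : ℝ) : ℂ))

end DiskSemigroup

/-!
Let `f` be a self-map of the disk with Denjoy–Wolff point `τ`. Then
`((z - τ) (1 - τ̄ f) + (f - τ) (1 - τ̄ z)) / (z - f)` has nonnegative real part, and at a boundary
regular fixed point `σ` it carries a point mass `|σ - τ|² / (f'(σ) - 1)`. Splitting off these masses
by Julia's lemma, and letting `t → 0` in `f = φ_t`, one finds that `G ≢ 0` belongs to `Gen τ σ lam`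
only if `(τ - z) (1 - τ̄ z) / G = h + p₀` with `Re h ≥ 0`.

For `τ` in the disk, `λ(G) = (1 - |τ|²) / (h(τ) + p₀(τ))`, and `Re p₀(τ) = (1 - |τ|²) / (2 r)`;
hence `λ(G)` runs through the disk `|ω - r| ≤ r`. It is a boundary point exactly if `Re h(τ) = 0`,
in which case `h` is an imaginary constant. For `τ` on the circle, Julia's lemma at `τ` gives
`λ(G) Re ((τ + z) / (τ - z)) |h + p₀| ≤ 2`. Since `Re ((τ + z) / (τ - z)) Re p₀ → 2 / r` along the
radius ending at `τ`, this yields `λ(G) ≤ r`, and in the case of equality Harnack's inequality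
forces `h` to be the constant `-p₀(τ)`.

Conversely each constant `a` with `Re a ≥ 0` gives a generator `(τ - z) (1 - τ̄ z) / (a + p₀)` whose
spectral value at `σ_k` is `λ_k`, because of the pole of `p₀` there.
-/

namespace DiskSemigroup

open Complex ComplexConjugate

variable {z w σ τ : ℂ} {f h : ℂ → ℂ}

section Disk

lemma mem_disk : z ∈ disk ↔ ‖z‖ < 1 := mem_ball_zero_iff

lemma isOpen_disk : IsOpen disk := Metric.isOpen_ball

lemma disk_mem_nhds (hz : z ∈ disk) : disk ∈ 𝓝 z := isOpen_disk.mem_nhds hz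

lemma zero_mem_disk : (0 : ℂ) ∈ disk := Metric.mem_ball_self one_pos

lemma neg_mem_disk (hz : z ∈ disk) : -z ∈ disk := by
  rwa [mem_disk, norm_neg, ← mem_disk]

lemma one_sub_norm_sq_pos (hz : z ∈ disk) : 0 < 1 - ‖z‖ ^ 2 :=
  sub_pos.2 (pow_lt_one₀ (norm_nonneg z) (mem_disk.1 hz) two_ne_zero)

lemma norm_one_sub_conj_mul_sq (w z : ℂ) :
    ‖1 - conj w * z‖ ^ 2 = ‖z - w‖ ^ 2 + (1 - ‖z‖ ^ 2) * (1 - ‖w‖ ^ 2) := by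
  simp only [Complex.sq_norm, normSq_apply, sub_re, sub_im, mul_re, mul_im, conj_re, conj_im,
    one_re, one_im]
  ring

lemma one_sub_conj_mul_ne_zero (hw : ‖w‖ ≤ 1) (hz : z ∈ disk) : 1 - conj w * z ≠ 0 := by
  refine sub_ne_zero.2 fun heq ↦ ?_
  have hlt : ‖conj w * z‖ < 1 := by
    rw [norm_mul, RCLike.norm_conj]
    exact mul_lt_one_of_nonneg_of_lt_one_right hw (norm_nonneg z) (mem_disk.1 hz)
  rw [← heq, norm_one] at hlt
  exact lt_irrefl 1 hlt

end Disk

section SchwarzPick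

/-- The automorphism `z ↦ (z - w) / (1 - w̄ z)` of the disk, which takes the point `w` of the disk
to `0`. -/
noncomputable def blaschke (w z : ℂ) : ℂ := (z - w) / (1 - conj w * z)

lemma differentiableOn_blaschke (hw : w ∈ disk) : DifferentiableOn ℂ (blaschke w) disk :=
  DifferentiableOn.div (by fun_prop) (by fun_prop) fun _ hz ↦
    one_sub_conj_mul_ne_zero (mem_disk.1 hw).le hz

lemma mapsTo_blaschke (hw : w ∈ disk) : MapsTo (blaschke w) disk disk := by
  intro z hz
  have hden := norm_pos_iff.2 (one_sub_conj_mul_ne_zero (mem_disk.1 hw).le hz)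
  rw [mem_disk, blaschke, norm_div, div_lt_one hden, ← sq_lt_sq₀ (norm_nonneg _) hden.le,
    norm_one_sub_conj_mul_sq]
  linarith [mul_pos (one_sub_norm_sq_pos hz) (one_sub_norm_sq_pos hw)]

lemma blaschke_neg_blaschke (hw : w ∈ disk) (hz : z ∈ disk) :
    blaschke (-w) (blaschke w z) = z := by
  have hden := one_sub_conj_mul_ne_zero (mem_disk.1 (neg_mem_disk hw)).le (mapsTo_blaschke hw hz)
  have hmul : blaschke w z * (1 - conj w * z) = z - w :=
    div_mul_cancel₀ _ (one_sub_conj_mul_ne_zero (mem_disk.1 hw).le hz)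
  rw [blaschke, div_eq_iff hden, map_neg]
  linear_combination hmul

lemma norm_blaschke_mul (hw : w ∈ disk) (hz : z ∈ disk) :
    ‖blaschke w z‖ * ‖1 - conj w * z‖ = ‖z - w‖ := by
  rw [← norm_mul, blaschke, div_mul_cancel₀ _ (one_sub_conj_mul_ne_zero (mem_disk.1 hw).le hz)]

lemma norm_le_norm_blaschke (hf : DifferentiableOn ℂ f disk)
    (hmaps : MapsTo f disk (Metric.closedBall 0 1)) (hw : w ∈ disk) (hfw : f w = 0)
    (hz : z ∈ disk) : ‖f z‖ ≤ ‖blaschke w z‖ := by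
  have hneg := mapsTo_blaschke (neg_mem_disk hw)
  simpa [blaschke_neg_blaschke hw hz] using Complex.norm_le_norm_of_mapsTo_ball
    (hf.comp (differentiableOn_blaschke (neg_mem_disk hw)) hneg) (hmaps.comp hneg)
    (by simp [blaschke, hfw]) (mem_disk.1 (mapsTo_blaschke hw hz))

lemma norm_blaschke_comp_le (hf : DifferentiableOn ℂ f disk) (hmaps : MapsTo f disk disk)
    (hw : w ∈ disk) (hz : z ∈ disk) : ‖blaschke (f w) (f z)‖ ≤ ‖blaschke w z‖ :=
  norm_le_norm_blaschke (f := blaschke (f w) ∘ f)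
    ((differentiableOn_blaschke (hmaps hw)).comp hf hmaps)
    (((mapsTo_blaschke (hmaps hw)).comp hmaps).mono_right Metric.ball_subset_closedBall) hw
    (by simp [blaschke]) hz

end SchwarzPick

section Caratheodory

/-- The Carathéodory class of holomorphic functions on the disk with nonnegative real part. Zeros
of the real part are allowed, so imaginary constants belong to the class. -/
structure IsCaratheodory (h : ℂ → ℂ) : Prop where
  holo : DifferentiableOn ℂ h disk
  re_nonneg : ∀ z ∈ disk, 0 ≤ (h z).re

lemma norm_add_conj_sq (a b : ℂ) : ‖a + conj b‖ ^ 2 = ‖a - b‖ ^ 2 + 4 * a.re * b.re := by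
  simp only [Complex.sq_norm, normSq_apply, sub_re, sub_im, add_re, add_im, conj_re, conj_im]
  ring

lemma norm_sub_le_norm_add_conj {a b : ℂ} (ha : 0 ≤ a.re) (hb : 0 ≤ b.re) :
    ‖a - b‖ ≤ ‖a + conj b‖ := by
  rw [← sq_le_sq₀ (norm_nonneg _) (norm_nonneg _), norm_add_conj_sq]
  linarith [mul_nonneg ha hb]

lemma IsCaratheodory.norm_sub_le_of_re_pos (hh : IsCaratheodory h) (hz : z ∈ disk)
    (hw : w ∈ disk) (hpos : 0 < (h w).re) :
    ‖h z - h w‖ ≤ ‖blaschke w z‖ * ‖h z + conj (h w)‖ := by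
  have hne : ∀ x ∈ disk, h x + conj (h w) ≠ 0 := fun x hx heq ↦ by
    have hre := congrArg re heq
    rw [add_re, conj_re, zero_re] at hre
    linarith [hh.re_nonneg x hx]
  rw [← div_le_iff₀ (norm_pos_iff.2 (hne z hz)), ← norm_div]
  refine norm_le_norm_blaschke (f := fun x ↦ (h x - h w) / (h x + conj (h w)))
    ((hh.holo.sub_const _).div (hh.holo.add_const _) hne) (fun x hx ↦ ?_) hw (by simp) hz
  rw [mem_closedBall_zero_iff, norm_div]
  exact div_le_one_of_le₀ (norm_sub_le_norm_add_conj (hh.re_nonneg x hx) hpos.le) (norm_nonneg _)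

lemma IsCaratheodory.norm_sub_le (hh : IsCaratheodory h) (hz : z ∈ disk) (hw : w ∈ disk) :
    ‖h z - h w‖ ≤ ‖blaschke w z‖ * ‖h z + conj (h w)‖ := by
  have hpert : ∀ ε : ℝ, 0 < ε →
      ‖h z - h w‖ ≤ ‖blaschke w z‖ * ‖h z + ε + conj (h w + ε)‖ := fun ε hε ↦ by
    have hpos : ∀ x ∈ disk, 0 < (h x + ε).re := fun x hx ↦ by
      rw [add_re, ofReal_re]
      linarith [hh.re_nonneg x hx]
    have hε' : IsCaratheodory fun x ↦ h x + ε := ⟨hh.holo.add_const _, fun x hx ↦ (hpos x hx).le⟩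
    simpa only [add_sub_add_right_eq_sub] using hε'.norm_sub_le_of_re_pos hz hw (hpos w hw)
  have hlim : Tendsto (fun ε : ℝ ↦ ‖blaschke w z‖ * ‖h z + ε + conj (h w + ε)‖) (𝓝[>] 0)
      (𝓝 (‖blaschke w z‖ * ‖h z + (0 : ℝ) + conj (h w + (0 : ℝ))‖)) :=
    tendsto_nhdsWithin_of_tendsto_nhds (Continuous.tendsto (by fun_prop) _)
  simpa only [ofReal_zero, add_zero] using
    ge_of_tendsto hlim (eventually_nhdsWithin_of_forall hpert)

lemma IsCaratheodory.norm_add_conj_sq_le (hh : IsCaratheodory h) (hz : z ∈ disk) (hw : w ∈ disk) :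
    (1 - ‖z‖ ^ 2) * (1 - ‖w‖ ^ 2) * ‖h z + conj (h w)‖ ^ 2 ≤
      4 * ‖1 - conj w * z‖ ^ 2 * (h z).re * (h w).re := by
  have hpick : ‖1 - conj w * z‖ ^ 2 * ‖h z - h w‖ ^ 2 ≤ ‖z - w‖ ^ 2 * ‖h z + conj (h w)‖ ^ 2 := by
    rw [← norm_blaschke_mul hw hz, ← mul_pow, ← mul_pow]
    gcongr 1
    calc ‖1 - conj w * z‖ * ‖h z - h w‖
        ≤ ‖1 - conj w * z‖ * (‖blaschke w z‖ * ‖h z + conj (h w)‖) := by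
          gcongr
          exact hh.norm_sub_le hz hw
      _ = ‖blaschke w z‖ * ‖1 - conj w * z‖ * ‖h z + conj (h w)‖ := by ring
  rw [show ‖z - w‖ ^ 2 = ‖1 - conj w * z‖ ^ 2 - (1 - ‖z‖ ^ 2) * (1 - ‖w‖ ^ 2) by
    rw [norm_one_sub_conj_mul_sq]; ring] at hpick
  linear_combination hpick + ‖1 - conj w * z‖ ^ 2 * norm_add_conj_sq (h z) (h w)

lemma IsCaratheodory.harnack (hh : IsCaratheodory h) (hz : z ∈ disk) (hw : w ∈ disk) :
    (1 - ‖z‖ ^ 2) * (1 - ‖w‖ ^ 2) * (h w).re ≤ 4 * ‖1 - conj w * z‖ ^ 2 * (h z).re := by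
  have hzre := hh.re_nonneg z hz
  have hE := mul_pos (one_sub_norm_sq_pos hz) (one_sub_norm_sq_pos hw)
  rcases (hh.re_nonneg w hw).eq_or_lt with hw0 | hwpos
  · rw [← hw0, mul_zero]
    positivity
  · have hsq : (h w).re ^ 2 ≤ ‖h z + conj (h w)‖ ^ 2 := by
      have hle := (h z + conj (h w)).re_le_norm
      rw [add_re, conj_re] at hle
      gcongr
      linarith
    refine le_of_mul_le_mul_right ?_ hwpos
    linarith [hh.norm_add_conj_sq_le hz hw, mul_le_mul_of_nonneg_left hsq hE.le]

lemma IsCaratheodory.one_sub_norm_mul_norm_le (hh : IsCaratheodory h) (hz : z ∈ disk) :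
    (1 - ‖z‖) * ‖h z‖ ≤ 2 * ‖h 0‖ := by
  have hpick := hh.norm_sub_le hz zero_mem_disk
  have hsub : ‖h z‖ - ‖h 0‖ ≤ ‖h z - h 0‖ := norm_sub_norm_le _ _
  have hadd : ‖h z + conj (h 0)‖ ≤ ‖h z‖ + ‖h 0‖ := by
    simpa using norm_add_le (h z) (conj (h 0))
  simp only [blaschke, map_zero, zero_mul, sub_zero, div_one] at hpick
  nlinarith [mul_le_mul_of_nonneg_left hadd (norm_nonneg z), mem_disk.1 hz, norm_nonneg (h 0)]

lemma IsCaratheodory.eqOn_const_of_re_eq_zero (hh : IsCaratheodory h) (hw : w ∈ disk)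
    (hw0 : (h w).re = 0) : EqOn h (fun _ ↦ h w) disk := by
  intro z hz
  have hE := mul_pos (one_sub_norm_sq_pos hz) (one_sub_norm_sq_pos hw)
  have hle := hh.norm_add_conj_sq_le hz hw
  rw [hw0, mul_zero] at hle
  have hadd : h z + conj (h w) = 0 := by
    rw [← norm_eq_zero, ← sq_eq_zero_iff]
    exact le_antisymm (nonpos_of_mul_nonpos_right hle hE) (sq_nonneg _)
  have hconj : conj (h w) = -h w := Complex.ext (by simp [hw0]) (by simp)
  rwa [hconj, add_neg_eq_zero] at hadd

end Caratheodory

section PointMass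

/-- The half-plane map `z ↦ (σ + z) / (σ - z)`, which is Mathlib's `herglotzRieszKernel 0 z σ` as a
function of the point `z` of the disk. -/
noncomputable def cayley (σ z : ℂ) : ℂ := (σ + z) / (σ - z)

lemma sub_ne_zero_of_norm_eq_one (hσ : ‖σ‖ = 1) (hz : z ∈ disk) : σ - z ≠ 0 := by
  rintro heq
  rw [sub_eq_zero.1 heq] at hσ
  exact (mem_disk.1 hz).ne hσ

lemma differentiableOn_cayley (hσ : ‖σ‖ = 1) : DifferentiableOn ℂ (cayley σ) disk :=
  DifferentiableOn.div (by fun_prop) (by fun_prop) fun _ hz ↦ sub_ne_zero_of_norm_eq_one hσ hz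

lemma cayley_re (hσ : ‖σ‖ = 1) (z : ℂ) : (cayley σ z).re = (1 - ‖z‖ ^ 2) / ‖σ - z‖ ^ 2 := by
  have hpoisson := congrFun (poissonKernel_eq_re_herglotzRieszKernel (c := 0) (w := z)) σ
  simpa [cayley, herglotzRieszKernel, poissonKernel, hσ] using hpoisson.symm

lemma cayley_re_pos (hσ : ‖σ‖ = 1) (hz : z ∈ disk) : 0 < (cayley σ z).re := by
  rw [cayley_re hσ]
  have := norm_pos_iff.2 (sub_ne_zero_of_norm_eq_one hσ hz)
  exact div_pos (one_sub_norm_sq_pos hz) (by positivity)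

lemma norm_ofReal_mul (hσ : ‖σ‖ = 1) {ρ : ℝ} (hρ : 0 ≤ ρ) : ‖(ρ : ℂ) * σ‖ = ρ := by
  rw [norm_mul, hσ, mul_one, Complex.norm_of_nonneg hρ]

lemma ofReal_mul_mem_disk (hσ : ‖σ‖ = 1) {ρ : ℝ} (hρ : ρ ∈ Ioo (0 : ℝ) 1) :
    (ρ : ℂ) * σ ∈ disk := by
  rw [mem_disk, norm_ofReal_mul hσ hρ.1.le]
  exact hρ.2

lemma tendsto_ofReal_mul (σ : ℂ) : Tendsto (fun ρ : ℝ ↦ (ρ : ℂ) * σ) (𝓝[<] 1) (𝓝 σ) :=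
  tendsto_nhdsWithin_of_tendsto_nhds <|
    Continuous.tendsto' (by fun_prop) _ _ (by rw [ofReal_one, one_mul])

/-- `h` has the point mass `α` at the boundary point `σ`. The factor `2` is chosen so that the mass
of a function of the Carathéodory class is the mass of `σ` in its Herglotz measure; in particular
`cayley σ` has mass `1`. -/
def HasPointMass (h : ℂ → ℂ) (σ : ℂ) (α : ℝ) : Prop :=
  Tendsto (fun ρ : ℝ ↦ (1 - ρ) * (h (ρ * σ)).re) (𝓝[<] 1) (𝓝 (2 * α))

lemma HasPointMass.sub {g : ℂ → ℂ} {α β : ℝ} (hh : HasPointMass h σ α) (hg : HasPointMass g σ β) :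
    HasPointMass (fun z ↦ h z - g z) σ (α - β) := by
  simpa only [HasPointMass, sub_re, mul_sub] using Tendsto.sub hh hg

lemma hasPointMass_zero_of_continuousAt (hh : ContinuousAt h σ) : HasPointMass h σ 0 := by
  have hre : Tendsto (fun ρ : ℝ ↦ (h (ρ * σ)).re) (𝓝[<] 1) (𝓝 (h σ).re) :=
    (continuous_re.continuousAt.comp hh).tendsto.comp (tendsto_ofReal_mul σ)
  have hρ : Tendsto (fun ρ : ℝ ↦ 1 - ρ) (𝓝[<] 1) (𝓝 0) :=
    tendsto_nhdsWithin_of_tendsto_nhds (Continuous.tendsto' (by fun_prop) _ _ (sub_self 1))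
  simpa only [HasPointMass, mul_zero, zero_mul] using hρ.mul hre

lemma continuousAt_cayley {s : ℂ} (hne : σ ≠ s) : ContinuousAt (cayley σ) s :=
  ContinuousAt.div (by fun_prop) (by fun_prop) (sub_ne_zero.2 hne)

lemma IsCaratheodory.mul_cayley_re_le_of_hasPointMass (hh : IsCaratheodory h) (hσ : ‖σ‖ = 1) {α : ℝ}
    (hα : HasPointMass h σ α) (hz : z ∈ disk) : α * (cayley σ z).re ≤ (h z).re := by
  have hharnack : ∀ᶠ ρ : ℝ in 𝓝[<] 1,
      (1 - ‖z‖ ^ 2) * ((1 + ρ) * ((1 - ρ) * (h (ρ * σ)).re)) ≤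
        4 * ‖1 - conj (ρ * σ) * z‖ ^ 2 * (h z).re := by
    filter_upwards [Ioo_mem_nhdsLT zero_lt_one] with ρ hρ
    have hle := hh.harnack hz (ofReal_mul_mem_disk hσ hρ)
    rw [norm_ofReal_mul hσ hρ.1.le] at hle
    linarith
  have hleft : Tendsto (fun ρ : ℝ ↦ (1 - ‖z‖ ^ 2) * ((1 + ρ) * ((1 - ρ) * (h (ρ * σ)).re))) (𝓝[<] 1)
      (𝓝 ((1 - ‖z‖ ^ 2) * ((1 + 1) * (2 * α)))) :=
    (Tendsto.mul (tendsto_nhdsWithin_of_tendsto_nhds (Continuous.tendsto (by fun_prop) _))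
      hα).const_mul _
  have hright : Tendsto (fun ρ : ℝ ↦ 4 * ‖1 - conj (ρ * σ) * z‖ ^ 2 * (h z).re) (𝓝[<] 1)
      (𝓝 (4 * ‖1 - conj σ * z‖ ^ 2 * (h z).re)) :=
    (Continuous.tendsto (f := fun w : ℂ ↦ 4 * ‖1 - conj w * z‖ ^ 2 * (h z).re)
      (by fun_prop) σ).comp (tendsto_ofReal_mul σ)
  have hle := le_of_tendsto_of_tendsto hleft hright hharnack
  rw [norm_one_sub_conj_mul_sq, hσ, norm_sub_rev] at hle
  have hpos := norm_pos_iff.2 (sub_ne_zero_of_norm_eq_one hσ hz)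
  rw [cayley_re hσ, mul_div_assoc', div_le_iff₀ (by positivity)]
  linarith

/-- Each mass is split off in turn: by Julia's lemma what remains after subtracting
`α k * cayley (σ k)` is again of the Carathéodory class, with unchanged masses elsewhere. -/
lemma IsCaratheodory.sum_mul_cayley_re_le {ι : Type*} (hh : IsCaratheodory h) {σ : ι → ℂ}
    (hσ : ∀ k, ‖σ k‖ = 1) (hinj : Function.Injective σ) {α : ι → ℝ} (s : Finset ι)
    (hα : ∀ k ∈ s, HasPointMass h (σ k) (α k)) (hz : z ∈ disk) :
    ∑ k ∈ s, α k * (cayley (σ k) z).re ≤ (h z).re := by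
  classical
  induction s using Finset.induction_on generalizing z with
  | empty => simpa using hh.re_nonneg z hz
  | insert j s hj ih =>
    set p : ℂ → ℂ := fun z ↦ ∑ k ∈ s, (α k : ℂ) * cayley (σ k) z with hp
    have hpre : ∀ z, (p z).re = ∑ k ∈ s, α k * (cayley (σ k) z).re := fun z ↦ by simp [hp]
    have hrest : IsCaratheodory fun z ↦ h z - p z := by
      refine ⟨hh.holo.sub (DifferentiableOn.fun_sum fun k _ ↦
        (differentiableOn_cayley (hσ k)).const_mul _), fun z hz ↦ ?_⟩
      rw [sub_re, hpre, sub_nonneg]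
      exact ih (fun k hk ↦ hα k (Finset.mem_insert_of_mem hk)) hz
    have hcont : ContinuousAt p (σ j) :=
      tendsto_finsetSum _ fun k hk ↦ ContinuousAt.const_mul
        (continuousAt_cayley fun heq ↦ hj (by rwa [← hinj heq])) _
    have hmass := (hα j (Finset.mem_insert_self j s)).sub (hasPointMass_zero_of_continuousAt hcont)
    rw [sub_zero] at hmass
    have hle := hrest.mul_cayley_re_le_of_hasPointMass (hσ j) hmass hz
    rw [sub_re, hpre] at hle
    rw [Finset.sum_insert hj]
    linarith

end PointMass

section Trajectories

open scoped NNReal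

variable {G : ℂ → ℂ} {γ γ₁ γ₂ : ℝ → ℂ} {C T S t : ℝ}

lemma exists_lipschitzWith_bounded_eqOn_closedBall (hG : DifferentiableOn ℂ G disk) {R : ℝ}
    (hR : R < 1) : ∃ g : ℂ → ℂ, EqOn g G (Metric.closedBall 0 R) ∧ (∃ K : ℝ≥0, LipschitzWith K g) ∧
      ∃ L : ℝ≥0, ∀ x, ‖g x‖ ≤ L := by
  have hmax : max R (1 / 2) < 1 := max_lt hR one_half_lt_one
  let χ : ContDiffBump (0 : ℂ) :=
    ⟨max R (1 / 2), (max R (1 / 2) + 1) / 2, lt_max_of_lt_right one_half_pos, by linarith⟩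
  have hχ : tsupport χ ⊆ disk := by
    rw [χ.tsupport_eq]
    exact Metric.closedBall_subset_ball (by change (max R (1 / 2) + 1) / 2 < 1; linarith)
  have hsupp : HasCompactSupport fun z ↦ χ z • G z := χ.hasCompactSupport.smul_right
  have hsmooth : ContDiff ℝ 1 fun z ↦ χ z • G z := by
    refine contDiff_iff_contDiffAt.2 fun z ↦ ?_
    by_cases hz : z ∈ disk
    · exact χ.contDiffAt.smul
        (((hG.contDiffOn isOpen_disk).restrict_scalars ℝ).contDiffAt (disk_mem_nhds hz))
    · have hzero : (fun z ↦ χ z • G z) =ᶠ[𝓝 z] 0 := notMem_tsupport_iff_eventuallyEq.1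
        fun hsupp ↦ hz (hχ (tsupport_smul_subset_left _ _ hsupp))
      exact contDiffAt_const.congr_of_eventuallyEq hzero
  obtain ⟨B, hB⟩ := hsmooth.continuous.bounded_above_of_compact_support hsupp
  refine ⟨_, fun z hz ↦ ?_, hsmooth.lipschitzWith_of_hasCompactSupport hsupp one_ne_zero,
    B.toNNReal, fun x ↦ (hB x).trans B.le_coe_toNNReal⟩
  have hone : χ z = 1 :=
    χ.one_of_mem_closedBall (Metric.closedBall_subset_closedBall (le_max_left _ _) hz)
  simp only [hone, one_smul]

/-- `γ` is a solution of `γ' = G(γ)` on the interval `[0, T]` that stays in the disk. -/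
def IsTrajOn (G : ℂ → ℂ) (γ : ℝ → ℂ) (T : ℝ) : Prop :=
  ∀ t ∈ Icc 0 T, γ t ∈ disk ∧ HasDerivWithinAt γ (G (γ t)) (Icc 0 T) t

/-- `γ` is a solution of `γ' = G(γ)` on the half-line `[0, ∞)` that stays in the disk. -/
def IsTraj (G : ℂ → ℂ) (γ : ℝ → ℂ) : Prop :=
  ∀ t, 0 ≤ t → γ t ∈ disk ∧ HasDerivWithinAt γ (G (γ t)) (Ici 0) t

lemma IsTraj.isTrajOn (h : IsTraj G γ) (T : ℝ) : IsTrajOn G γ T :=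
  fun t ht ↦ ⟨(h t ht.1).1, (h t ht.1).2.mono Icc_subset_Ici_self⟩

lemma IsTrajOn.mono (h : IsTrajOn G γ T) (hS : S ≤ T) : IsTrajOn G γ S :=
  fun t ht ↦ ⟨(h t ⟨ht.1, ht.2.trans hS⟩).1,
    (h t ⟨ht.1, ht.2.trans hS⟩).2.mono (Icc_subset_Icc_right hS)⟩

lemma IsTrajOn.continuousOn (h : IsTrajOn G γ T) : ContinuousOn γ (Icc 0 T) :=
  fun t ht ↦ (h t ht).2.continuousWithinAt

lemma hasDerivWithinAt_Ici_of_Icc {γ' : ℂ} (ht : t ∈ Ico 0 T)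
    (h : HasDerivWithinAt γ γ' (Icc 0 T) t) : HasDerivWithinAt γ γ' (Ici t) t :=
  h.mono_of_mem_nhdsWithin (Icc_mem_nhdsGE_of_mem ht)

lemma IsTrajOn.exists_closedBall (h : IsTrajOn G γ T) :
    ∃ R < 1, ∀ t ∈ Icc 0 T, γ t ∈ Metric.closedBall (0 : ℂ) R := by
  rcases (Icc 0 T).eq_empty_or_nonempty with hempty | hne
  · exact ⟨0, zero_lt_one, by simp [hempty]⟩
  · obtain ⟨s, hs, hmax⟩ := isCompact_Icc.exists_isMaxOn hne h.continuousOn.norm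
    exact ⟨‖γ s‖, mem_disk.1 (h s hs).1, fun t ht ↦ mem_closedBall_zero_iff.2 (hmax ht)⟩

lemma IsTrajOn.eqOn (hG : DifferentiableOn ℂ G disk) (h₁ : IsTrajOn G γ₁ T)
    (h₂ : IsTrajOn G γ₂ T) (h0 : γ₁ 0 = γ₂ 0) : EqOn γ₁ γ₂ (Icc 0 T) := by
  obtain ⟨R₁, hR₁, hmem₁⟩ := h₁.exists_closedBall
  obtain ⟨R₂, hR₂, hmem₂⟩ := h₂.exists_closedBall
  obtain ⟨g, hgG, ⟨K, hK⟩, -⟩ := exists_lipschitzWith_bounded_eqOn_closedBall hG (max_lt hR₁ hR₂)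
  have hderiv : ∀ {γ R}, IsTrajOn G γ T → R ≤ max R₁ R₂ →
      (∀ t ∈ Icc 0 T, γ t ∈ Metric.closedBall (0 : ℂ) R) →
      ∀ t ∈ Ico 0 T, HasDerivWithinAt γ (g (γ t)) (Ici t) t := fun h hR hmem t ht ↦ by
    rw [hgG (Metric.closedBall_subset_closedBall hR (hmem t (Ico_subset_Icc_self ht)))]
    exact hasDerivWithinAt_Ici_of_Icc ht (h t (Ico_subset_Icc_self ht)).2
  exact ODE_solution_unique (v := fun _ ↦ g) (fun _ ↦ hK) h₁.continuousOn
    (hderiv h₁ (le_max_left _ _) hmem₁) h₂.continuousOn (hderiv h₂ (le_max_right _ _) hmem₂) h0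

lemma IsTraj.eq (hG : DifferentiableOn ℂ G disk) (h₁ : IsTraj G γ₁) (h₂ : IsTraj G γ₂)
    (h0 : γ₁ 0 = γ₂ 0) (ht : 0 ≤ t) : γ₁ t = γ₂ t :=
  (h₁.isTrajOn t).eqOn hG (h₂.isTrajOn t) h0 ⟨ht, le_rfl⟩

lemma hasDerivAt_const_mul_exp (a c t : ℝ) :
    HasDerivAt (fun t ↦ a * Real.exp (c * t)) (c * (a * Real.exp (c * t))) t := by
  have hlin : HasDerivAt (fun t : ℝ ↦ c * t) c t := by
    simpa using (hasDerivAt_id t).const_mul c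
  exact (hlin.exp.const_mul a).congr_deriv (by ring)

lemma mul_exp_le_one_sub_norm_sq {γ' : ℝ → ℂ} {c : ℝ}
    (hγ : ∀ t ∈ Icc 0 T, HasDerivWithinAt γ (γ' t) (Icc 0 T) t)
    (hslow : ∀ t ∈ Icc 0 T, 1 - ‖γ t‖ ^ 2 = (1 - ‖γ 0‖ ^ 2) * Real.exp (-c * t) →
      2 * (conj (γ t) * γ' t).re < c * (1 - ‖γ t‖ ^ 2)) (ht : t ∈ Icc 0 T) :
    (1 - ‖γ 0‖ ^ 2) * Real.exp (-c * t) ≤ 1 - ‖γ t‖ ^ 2 := by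
  have hcont : ContinuousOn γ (Icc 0 T) := fun t ht ↦ (hγ t ht).continuousWithinAt
  suffices h : ‖γ t‖ ^ 2 ≤ 1 - (1 - ‖γ 0‖ ^ 2) * Real.exp (-c * t) by linarith
  refine image_le_of_deriv_right_lt_deriv_boundary (f := fun t ↦ ‖γ t‖ ^ 2)
    (f' := fun t ↦ 2 * inner ℝ (γ t) (γ' t)) (hcont.norm.pow 2)
    (fun t ht ↦ (hasDerivWithinAt_Ici_of_Icc ht (hγ t (Ico_subset_Icc_self ht))).norm_sq)
    (by simp) (fun t ↦ (hasDerivAt_const_mul_exp _ _ t).const_sub 1) (fun t ht heq ↦ ?_) ht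
  have hgap : 1 - ‖γ t‖ ^ 2 = (1 - ‖γ 0‖ ^ 2) * Real.exp (-c * t) := by rw [heq]; ring
  have hlt := hslow t (Ico_subset_Icc_self ht) hgap
  rw [Complex.inner, mul_comm (γ' t), ← hgap]
  linarith

lemma exists_forall_hasDerivWithinAt_of_lipschitzWith {g : ℂ → ℂ} {K L : ℝ≥0}
    (hK : LipschitzWith K g) (hL : ∀ x, ‖g x‖ ≤ L) (z : ℂ) (hT : 0 ≤ T) :
    ∃ γ : ℝ → ℂ, γ 0 = z ∧ ∀ t ∈ Icc 0 T, HasDerivWithinAt γ (g (γ t)) (Icc 0 T) t := by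
  have hPL : IsPicardLindelof (fun _ : ℝ ↦ g) (⟨0, le_rfl, hT⟩ : Icc (0 : ℝ) T) z
      (L * ⟨T, hT⟩) 0 L K := by
    refine ⟨fun _ _ ↦ hK.lipschitzOnWith, fun _ _ ↦ continuousOn_const, fun _ _ x _ ↦ hL x, ?_⟩
    simp only [sub_zero, sub_self, NNReal.coe_zero, max_eq_left hT]
    exact le_rfl
  exact hPL.exists_eq_forall_mem_Icc_hasDerivWithinAt₀

lemma exists_isTrajOn (hG : DifferentiableOn ℂ G disk)
    (hC : ∀ z ∈ disk, (conj z * G z).re ≤ C * (1 - ‖z‖ ^ 2)) (hz : z ∈ disk) (hT : 0 ≤ T) :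
    ∃ γ : ℝ → ℂ, γ 0 = z ∧ IsTrajOn G γ T := by
  have hgap := one_sub_norm_sq_pos hz
  set c : ℝ := 2 * (|C| + 1)
  set R : ℝ := √(1 - (1 - ‖z‖ ^ 2) * Real.exp (-c * T))
  have hR1 : R < 1 := by
    rw [Real.sqrt_lt' one_pos, one_pow]
    exact sub_lt_self 1 (by positivity)
  obtain ⟨g, hgG, ⟨K, hK⟩, L, hL⟩ := exists_lipschitzWith_bounded_eqOn_closedBall hG hR1
  obtain ⟨γ, rfl, hγ⟩ := exists_forall_hasDerivWithinAt_of_lipschitzWith hK hL z hT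
  have hball : ∀ t ∈ Icc 0 T, (1 - ‖γ 0‖ ^ 2) * Real.exp (-c * t) ≤ 1 - ‖γ t‖ ^ 2 →
      γ t ∈ Metric.closedBall (0 : ℂ) R := fun t ht hle ↦ by
    have hexp : (1 - ‖γ 0‖ ^ 2) * Real.exp (-c * T) ≤ (1 - ‖γ 0‖ ^ 2) * Real.exp (-c * t) := by
      gcongr ?_ * Real.exp ?_
      nlinarith [abs_nonneg C, ht.2]
    exact mem_closedBall_zero_iff.2 (Real.le_sqrt_of_sq_le (by linarith))
  have hmem : ∀ t ∈ Icc 0 T, γ t ∈ Metric.closedBall (0 : ℂ) R := fun t ht ↦ by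
    refine hball t ht (mul_exp_le_one_sub_norm_sq hγ (fun t ht heq ↦ ?_) ht)
    have hmemR := hball t ht heq.ge
    have hle := hC _ (Metric.closedBall_subset_ball hR1 hmemR)
    have hpos : 0 < 1 - ‖γ t‖ ^ 2 := heq ▸ by positivity
    rw [hgG hmemR]
    nlinarith [le_abs_self C]
  refine ⟨γ, rfl, fun t ht ↦ ⟨Metric.closedBall_subset_ball hR1 (hmem t ht), ?_⟩⟩
  rw [← hgG (hmem t ht)]
  exact hγ t ht

end Trajectories

section Flows

variable {G : ℂ → ℂ} {φ ψ : ℝ → ℂ → ℂ} {C T t : ℝ}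

/-- `φ t z` is the value at time `t ≥ 0` of the solution of `γ' = G(γ)` that starts at the point `z`
of the disk. In contrast to `Generates G φ`, neither the holomorphy of `φ t` nor the semigroup law
is required. -/
def IsFlow (G : ℂ → ℂ) (φ : ℝ → ℂ → ℂ) : Prop :=
  ∀ z ∈ disk, φ 0 z = z ∧ IsTraj G fun t ↦ φ t z

lemma exists_isTraj (hG : DifferentiableOn ℂ G disk)
    (hC : ∀ z ∈ disk, (conj z * G z).re ≤ C * (1 - ‖z‖ ^ 2)) (hz : z ∈ disk) :
    ∃ γ : ℝ → ℂ, γ 0 = z ∧ IsTraj G γ := by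
  have hex : ∀ T : ℝ, ∃ γ : ℝ → ℂ, 0 ≤ T → γ 0 = z ∧ IsTrajOn G γ T := fun T ↦ by
    by_cases hT : 0 ≤ T
    · exact (exists_isTrajOn hG hC hz hT).imp fun _ hγ _ ↦ hγ
    · exact ⟨0, fun h ↦ absurd h hT⟩
  choose γ hγ using hex
  refine ⟨fun t ↦ γ (t + 1) t, (hγ _ (by norm_num)).1, fun t ht ↦ ?_⟩
  obtain ⟨hγ0, hγt⟩ := hγ (t + 1) (by linarith)
  have heq : ∀ s ∈ Icc 0 (t + 1), γ (s + 1) s = γ (t + 1) s := fun s hs ↦ by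
    obtain ⟨hs0, hs1⟩ := hγ (s + 1) (by linarith [hs.1])
    exact (hs1.mono (le_add_of_nonneg_right zero_le_one)).eqOn hG (hγt.mono hs.2)
      (hs0.trans hγ0.symm) ⟨hs.1, le_rfl⟩
  have htmem : t ∈ Icc 0 (t + 1) := ⟨ht, by linarith⟩
  refine ⟨(hγt t htmem).1, ((hγt t htmem).2.congr heq (heq t htmem)).mono_of_mem_nhdsWithin ?_⟩
  rw [← Ici_inter_Iic]
  exact inter_mem_nhdsWithin _ (Iic_mem_nhds (lt_add_one t))

lemma exists_isFlow (hG : DifferentiableOn ℂ G disk)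
    (hC : ∀ z ∈ disk, (conj z * G z).re ≤ C * (1 - ‖z‖ ^ 2)) : ∃ φ, IsFlow G φ := by
  have hex : ∀ z : ℂ, ∃ γ : ℝ → ℂ, z ∈ disk → γ 0 = z ∧ IsTraj G γ := fun z ↦ by
    by_cases hz : z ∈ disk
    · exact (exists_isTraj hG hC hz).imp fun _ hγ _ ↦ hγ
    · exact ⟨0, fun h ↦ absurd h hz⟩
  choose γ hγ using hex
  exact ⟨fun t z ↦ γ z t, hγ⟩

lemma norm_le_mul_exp_of_norm_deriv_lt {d d' : ℝ → ℂ} {M δ : ℝ} (hM : 0 ≤ M)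
    (hd : ∀ t ∈ Icc 0 T, HasDerivWithinAt d (d' t) (Icc 0 T) t)
    (hd' : ∀ t ∈ Icc 0 T, d t ≠ 0 → ‖d t‖ < δ → ‖d' t‖ < M * ‖d t‖) (h0 : d 0 ≠ 0)
    (hδ : ‖d 0‖ * Real.exp (M * T) < δ) (ht : t ∈ Icc 0 T) :
    ‖d t‖ ≤ ‖d 0‖ * Real.exp (M * T) := by
  have hgrow : ∀ t ∈ Icc 0 T, ‖d 0‖ * Real.exp (M * t) ≤ ‖d 0‖ * Real.exp (M * T) := by
    intro t ht
    gcongr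
    exact ht.2
  refine le_trans ?_ (hgrow t ht)
  refine image_norm_le_of_norm_deriv_right_lt_deriv_boundary
    (fun t ht ↦ (hd t ht).continuousWithinAt)
    (fun t ht ↦ hasDerivWithinAt_Ici_of_Icc ht (hd t (Ico_subset_Icc_self ht))) (by simp)
    (hasDerivAt_const_mul_exp _ M) (fun t ht heq ↦ ?_) ht
  have hle := hgrow t (Ico_subset_Icc_self ht)
  rw [← heq] at hle ⊢
  exact hd' t (Ico_subset_Icc_self ht) (norm_pos_iff.1 (by rw [heq]; positivity)) (hle.trans_lt hδ)

lemma norm_sub_exp_mul_le {d d' κ I : ℝ → ℂ} {B e : ℝ} (hT : 0 ≤ T)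
    (hd : ∀ t ∈ Icc 0 T, HasDerivWithinAt d (d' t) (Icc 0 T) t)
    (hI : ∀ t, HasDerivAt I (κ t) t) (hI0 : I 0 = 0)
    (hB : ∀ t ∈ Icc 0 T, ‖Complex.exp (-I t)‖ ≤ B)
    (he : ∀ t ∈ Icc 0 T, ‖d' t - κ t * d t‖ ≤ e) :
    ‖d T - Complex.exp (I T) * d 0‖ ≤ ‖Complex.exp (I T)‖ * (e * B * T) := by
  have hderiv : ∀ t ∈ Icc 0 T, HasDerivWithinAt (fun t ↦ d t * Complex.exp (-I t))
      ((d' t - κ t * d t) * Complex.exp (-I t)) (Icc 0 T) t := fun t ht ↦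
    ((hd t ht).mul (hI t).neg.cexp.hasDerivWithinAt).congr_deriv (by rw [Pi.neg_apply]; ring)
  have hmv := norm_image_sub_le_of_norm_deriv_le_segment' (C := e * B) hderiv (fun t ht ↦ by
    have ht' := Ico_subset_Icc_self ht
    rw [norm_mul]
    exact mul_le_mul (he t ht') (hB t ht') (norm_nonneg _) ((norm_nonneg _).trans (he t ht')))
    T ⟨hT, le_rfl⟩
  have hinv : Complex.exp (I T) * Complex.exp (-I T) = 1 := by
    rw [← Complex.exp_add, add_neg_cancel, Complex.exp_zero]
  calc ‖d T - Complex.exp (I T) * d 0‖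
      = ‖Complex.exp (I T) * (d T * Complex.exp (-I T) - d 0 * Complex.exp (-I 0))‖ := by
        rw [hI0, neg_zero, Complex.exp_zero]
        congr 1
        linear_combination -d T * hinv
    _ ≤ ‖Complex.exp (I T)‖ * (e * B * T) := by
        rw [norm_mul]
        gcongr
        simpa using hmv

/-- Along the curve `p` the vector field `G` has the expansion `p' t + κ t * (z - p t)` to first
order at `p t`, uniformly in `t ∈ [0, T]`. The curve may lie on the boundary of the disk. -/
def HasExpansionAlong (G : ℂ → ℂ) (p p' κ : ℝ → ℂ) (T : ℝ) : Prop :=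
  ∀ ε > 0, ∃ δ > 0, ∀ t ∈ Icc 0 T, ∀ z ∈ disk, ‖z - p t‖ < δ →
    ‖G z - p' t - κ t * (z - p t)‖ ≤ ε * ‖z - p t‖

lemma IsFlow.exists_norm_sub_exp_mul_le (hφ : IsFlow G φ) (hT : 0 ≤ T) {p p' κ I : ℝ → ℂ}
    (hp : ∀ t ∈ Icc 0 T, HasDerivWithinAt p (p' t) (Icc 0 T) t) (hκ : Continuous κ)
    (hI : ∀ t, HasDerivAt I (κ t) t) (hI0 : I 0 = 0) (hG : HasExpansionAlong G p p' κ T) :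
    ∃ D ≥ 0, ∀ ε ∈ Ioc (0 : ℝ) 1, ∃ η > 0, ∀ z ∈ disk \ {p 0}, ‖z - p 0‖ < η →
      ‖φ T z - p T - Complex.exp (I T) * (z - p 0)‖ ≤ D * ε * ‖z - p 0‖ := by
  have hIcont : Continuous I := continuous_iff_continuousAt.2 fun t ↦ (hI t).continuousAt
  obtain ⟨A, hA⟩ := isCompact_Icc.exists_bound_of_continuousOn (s := Icc 0 T) hκ.continuousOn
  obtain ⟨B, hB⟩ := isCompact_Icc.exists_bound_of_continuousOn (s := Icc 0 T)
    (f := fun t ↦ Complex.exp (-I t)) (by fun_prop)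
  have hA0 : 0 ≤ A := (norm_nonneg _).trans (hA 0 ⟨le_rfl, hT⟩)
  have hB0 : 0 ≤ B := (norm_nonneg _).trans (hB 0 ⟨le_rfl, hT⟩)
  set E : ℝ := Real.exp ((A + 2) * T)
  refine ⟨‖Complex.exp (I T)‖ * (E * B * T), by positivity, fun ε hε ↦ ?_⟩
  obtain ⟨δ, hδ, hGδ⟩ := hG ε hε.1
  refine ⟨δ / E, by positivity, fun z hz hη ↦ ?_⟩
  rw [lt_div_iff₀ (Real.exp_pos _)] at hη
  set d : ℝ → ℂ := fun t ↦ φ t z - p t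
  have htraj := (hφ z hz.1).2.isTrajOn T
  have hd0 : d 0 = z - p 0 := congrArg (· - p 0) (hφ z hz.1).1
  have hderiv : ∀ t ∈ Icc 0 T, HasDerivWithinAt d (G (φ t z) - p' t) (Icc 0 T) t :=
    fun t ht ↦ (htraj t ht).2.sub (hp t ht)
  have hexpand : ∀ t ∈ Icc 0 T, ‖d t‖ < δ → ‖G (φ t z) - p' t - κ t * d t‖ ≤ ε * ‖d t‖ :=
    fun t ht hlt ↦ hGδ t ht _ (htraj t ht).1 hlt
  have hgrowth : ∀ t ∈ Icc 0 T, d t ≠ 0 → ‖d t‖ < δ → ‖G (φ t z) - p' t‖ < (A + 2) * ‖d t‖ :=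
    fun t ht hne hlt ↦ calc
      ‖G (φ t z) - p' t‖ ≤ ‖G (φ t z) - p' t - κ t * d t‖ + ‖κ t * d t‖ := by
        simpa using norm_add_le (G (φ t z) - p' t - κ t * d t) (κ t * d t)
      _ ≤ 1 * ‖d t‖ + A * ‖d t‖ := by
        rw [norm_mul]
        gcongr
        exacts [(hexpand t ht hlt).trans (by gcongr; exact hε.2), hA t ht]
      _ < (A + 2) * ‖d t‖ := by linarith [norm_pos_iff.2 hne]
  rw [← hd0] at hη ⊢
  have hsmall : ∀ t ∈ Icc 0 T, ‖d t‖ ≤ ‖d 0‖ * E := fun t ht ↦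
    norm_le_mul_exp_of_norm_deriv_lt (by positivity) hderiv hgrowth
      (hd0 ▸ sub_ne_zero.2 hz.2) hη ht
  refine (norm_sub_exp_mul_le (e := ε * (‖d 0‖ * E)) hT hderiv hI hI0 hB fun t ht ↦ ?_).trans_eq
    (by ring)
  exact (hexpand t ht ((hsmall t ht).trans_lt hη)).trans
    (mul_le_mul_of_nonneg_left (hsmall t ht) hε.1.le)

lemma IsFlow.tendsto_div (hφ : IsFlow G φ) (hT : 0 ≤ T) {p p' κ : ℝ → ℂ}
    (hp : ∀ t ∈ Icc 0 T, HasDerivWithinAt p (p' t) (Icc 0 T) t) (hκ : Continuous κ)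
    (hG : HasExpansionAlong G p p' κ T) :
    Tendsto (fun z ↦ (φ T z - p T) / (z - p 0)) (𝓝[disk \ {p 0}] (p 0))
      (𝓝 (Complex.exp (∫ s in (0 : ℝ)..T, κ s))) := by
  obtain ⟨D, hD, hest⟩ := hφ.exists_norm_sub_exp_mul_le (I := fun t ↦ ∫ s in (0 : ℝ)..t, κ s) hT hp
    hκ (fun t ↦ intervalIntegral.integral_hasDerivAt_right (hκ.intervalIntegrable _ _)
      (hκ.stronglyMeasurableAtFilter _ _) hκ.continuousAt) intervalIntegral.integral_same hG
  rw [Metric.tendsto_nhdsWithin_nhds]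
  intro ε hε
  obtain ⟨η, hη, hle⟩ := hest (min 1 (ε / (D + 1))) ⟨by positivity, min_le_left _ _⟩
  refine ⟨η, hη, fun z hz hdist ↦ ?_⟩
  have hne : z - p 0 ≠ 0 := sub_ne_zero.2 hz.2
  have hpos := norm_pos_iff.2 hne
  rw [dist_eq_norm] at hdist ⊢
  rw [div_sub' hne, norm_div, div_lt_iff₀ hpos, mul_comm (z - p 0)]
  refine (hle z hz hdist).trans_lt (mul_lt_mul_of_pos_right ?_ hpos)
  calc D * min 1 (ε / (D + 1)) ≤ D * (ε / (D + 1)) := by gcongr; exact min_le_right _ _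
    _ < (D + 1) * (ε / (D + 1)) := by gcongr; exact lt_add_one D
    _ = ε := by field_simp

lemma IsFlow.tendsto_div_of_tendsto (hφ : IsFlow G φ) {p κ : ℂ} (hp : p ∈ disk → G p = 0)
    (hG : Tendsto (fun z ↦ G z / (z - p)) (𝓝[disk \ {p}] p) (𝓝 κ)) (hT : 0 ≤ T) :
    Tendsto (fun z ↦ (φ T z - p) / (z - p)) (𝓝[disk \ {p}] p) (𝓝 (Complex.exp (κ * T))) := by
  have hexpand : HasExpansionAlong G (fun _ ↦ p) (fun _ ↦ 0) (fun _ ↦ κ) T := fun ε hε ↦ by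
    rw [Metric.tendsto_nhdsWithin_nhds] at hG
    obtain ⟨δ, hδ, hclose⟩ := hG ε hε
    refine ⟨δ, hδ, fun t _ z hz hzδ ↦ ?_⟩
    rcases eq_or_ne z p with rfl | hne
    · simp [hp hz]
    · have hlt := hclose ⟨hz, hne⟩ (by rwa [dist_eq_norm])
      have hsub : z - p ≠ 0 := sub_ne_zero.2 hne
      rw [dist_eq_norm, div_sub' hsub, norm_div, div_lt_iff₀ (norm_pos_iff.2 hsub)] at hlt
      rw [sub_zero, mul_comm κ]
      exact hlt.le
  simpa [mul_comm κ] using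
    hφ.tendsto_div hT (fun t _ ↦ hasDerivWithinAt_const _ _ _) continuous_const hexpand

lemma exists_forall_norm_sub_sub_deriv_mul_le (hG : DifferentiableOn ℂ G disk) {R ε : ℝ}
    (hR : R < 1) (hε : 0 < ε) : ∃ δ > 0, ∀ w ∈ Metric.closedBall (0 : ℂ) R, ∀ z,
      ‖z - w‖ < δ → ‖G z - G w - deriv G w * (z - w)‖ ≤ ε * ‖z - w‖ := by
  have hsub : Metric.closedBall (0 : ℂ) ((R + 1) / 2) ⊆ disk :=
    Metric.closedBall_subset_ball (by linarith)
  obtain ⟨δ, hδ, hclose⟩ := Metric.uniformContinuousOn_iff.1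
    ((isCompact_closedBall (0 : ℂ) ((R + 1) / 2)).uniformContinuousOn_of_continuous
      ((hG.deriv isOpen_disk).continuousOn.mono hsub)) ε hε
  have hmin : 0 < min δ ((1 - R) / 2) := lt_min hδ (by linarith)
  refine ⟨min δ ((1 - R) / 2), hmin, fun w hw z hz ↦ ?_⟩
  have hball : Metric.ball w (min δ ((1 - R) / 2)) ⊆ Metric.closedBall 0 ((R + 1) / 2) := by
    refine Metric.ball_subset_closedBall.trans (Metric.closedBall_subset_closedBall' ?_)
    linarith [min_le_right δ ((1 - R) / 2), Metric.mem_closedBall.1 hw]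
  have hw' := Metric.mem_ball_self (x := w) hmin
  have hmv := (convex_ball w _).norm_image_sub_le_of_norm_hasDerivWithin_le
    (f := fun x ↦ G x - deriv G w * x) (f' := fun x ↦ deriv G x - deriv G w) (C := ε)
    (fun x hx ↦ ?_) (fun x hx ↦ ?_) hw' (mem_ball_iff_norm.2 hz)
  · refine le_of_eq_of_le (congrArg norm ?_) hmv
    ring
  · have hder := (hG.differentiableAt (disk_mem_nhds (hsub (hball hx)))).hasDerivAt
    exact (hder.sub ((hasDerivAt_id x).const_mul _)).hasDerivWithinAt.congr_deriv (by simp)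
  · rw [← dist_eq_norm]
    exact (hclose x (hball hx) w (hball hw')
      ((Metric.mem_ball.1 hx).trans_le (min_le_left _ _))).le

lemma IsFlow.differentiableOn (hG : DifferentiableOn ℂ G disk) (hφ : IsFlow G φ) (hT : 0 ≤ T) :
    DifferentiableOn ℂ (φ T) disk := by
  intro w hw
  obtain ⟨h0, htraj⟩ := hφ w hw
  obtain ⟨R, hR, hmem⟩ := (htraj.isTrajOn T).exists_closedBall
  have hφw : Continuous fun t : ℝ ↦ φ (max t 0) w :=
    ContinuousOn.comp_continuous (s := Ici 0) (fun t ht ↦ (htraj t ht).2.continuousWithinAt)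
      (by fun_prop) fun t ↦ le_max_right t 0
  have hκ : Continuous fun t : ℝ ↦ deriv G (φ (max t 0) w) :=
    (hG.deriv isOpen_disk).continuousOn.comp_continuous hφw
      fun t ↦ (htraj _ (le_max_right _ _)).1
  have hexpand : HasExpansionAlong G (fun t ↦ φ t w) (fun t ↦ G (φ t w))
      (fun t ↦ deriv G (φ (max t 0) w)) T := fun ε hε ↦ by
    obtain ⟨δ, hδ, hle⟩ := exists_forall_norm_sub_sub_deriv_mul_le hG hR hε
    refine ⟨δ, hδ, fun t ht z _ hz ↦ ?_⟩
    simp only [max_eq_left ht.1]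
    exact hle _ (hmem t ht) z hz
  have hlim := hφ.tendsto_div hT (fun t ht ↦ (htraj.isTrajOn T t ht).2) hκ hexpand
  simp only [h0] at hlim
  refine (hasDerivWithinAt_iff_tendsto_slope.2 (hlim.congr fun z ↦ ?_)).differentiableWithinAt
  rw [slope_def_field]

lemma IsTraj.comp_add_const (hγ : IsTraj G fun t ↦ φ t z) (ht : 0 ≤ t) :
    IsTraj G fun s ↦ φ (s + t) z := fun s hs ↦ by
  obtain ⟨hmem, hder⟩ := hγ (s + t) (add_nonneg hs ht)
  have hshift : HasDerivWithinAt (fun s : ℝ ↦ s + t) 1 (Ici 0) s :=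
    ((hasDerivAt_id s).add_const t).hasDerivWithinAt
  refine ⟨hmem, ?_⟩
  simpa using! hder.scomp s hshift fun x hx ↦ add_nonneg (mem_Ici.1 hx) ht

lemma IsFlow.isSemigroup (hG : DifferentiableOn ℂ G disk) (hφ : IsFlow G φ) : IsSemigroup φ where
  holo t ht := hφ.differentiableOn hG ht
  mapsTo t ht z hz := ((hφ z hz).2 t ht).1
  zero z hz := (hφ z hz).1
  add s t hs ht z hz := by
    have hw := hφ _ ((hφ z hz).2 t ht).1
    exact ((hφ z hz).2.comp_add_const ht).eq hG hw.2 (by rw [zero_add, hw.1]) hs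
  cont z hz := by
    have hlim := ((hφ z hz).2 0 le_rfl).2.continuousWithinAt.tendsto
    simp only [(hφ z hz).1] at hlim
    exact hlim.mono_left (nhdsWithin_mono _ Ioi_subset_Ici_self)

lemma IsFlow.generates (hG : DifferentiableOn ℂ G disk) (hφ : IsFlow G φ) : Generates G φ where
  semigroup := hφ.isSemigroup hG
  holo := hG
  flow z hz t ht := ((hφ z hz).2 t ht).2

end Flows

section BerksonPorta

variable {G : ℂ → ℂ} {φ ψ : ℝ → ℂ → ℂ} {t : ℝ}

lemma Generates.isFlow (h : Generates G φ) : IsFlow G φ :=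
  fun z hz ↦ ⟨h.semigroup.zero z hz, fun t ht ↦ ⟨h.semigroup.mapsTo t ht hz, h.flow z hz t ht⟩⟩

lemma Generates.eqOn (hφ : Generates G φ) (hψ : Generates G ψ) (ht : 0 ≤ t) :
    EqOn (φ t) (ψ t) disk := fun z hz ↦
  (hφ.isFlow z hz).2.eq hφ.holo (hψ.isFlow z hz).2
    ((hφ.isFlow z hz).1.trans (hψ.isFlow z hz).1.symm) ht

lemma Generates.apply_eq_self (hφ : Generates G φ) (hz : z ∈ disk) (h0 : G z = 0) (ht : 0 ≤ t) :
    φ t z = z := by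
  refine (hφ.isFlow z hz).2.eq hφ.holo (γ₂ := fun _ ↦ z) (fun s _ ↦ ⟨hz, ?_⟩)
    (hφ.isFlow z hz).1 ht
  rw [h0]
  exact hasDerivWithinAt_const _ _ _

lemma Generates.eq_zero (hφ : Generates G φ) (hz : z ∈ disk) (h : ∀ t, 0 ≤ t → φ t z = z) :
    G z = 0 := by
  have hconst : HasDerivWithinAt (fun t ↦ φ t z) 0 (Ici 0) 0 :=
    (hasDerivWithinAt_const (0 : ℝ) (Ici 0) z).congr (fun t ht ↦ h t ht) (h 0 le_rfl)
  rw [← h 0 le_rfl]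
  exact (uniqueDiffOn_Ici (0 : ℝ) 0 self_mem_Ici).eq_deriv _ (hφ.flow z hz 0 le_rfl) hconst

/-- The Berkson–Porta factor `(τ - z) (1 - τ̄ z)`, whose products with functions of the Carathéodory
class are the generators with Denjoy–Wolff point `τ`. -/
noncomputable def bpFactor (τ z : ℂ) : ℂ := (τ - z) * (1 - conj τ * z)

lemma differentiable_bpFactor (τ : ℂ) : Differentiable ℂ (bpFactor τ) := by
  unfold bpFactor
  fun_prop

lemma bpFactor_self (τ : ℂ) : bpFactor τ τ = 0 := by rw [bpFactor, sub_self, zero_mul]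

lemma bpFactor_ne_zero (hτ : ‖τ‖ ≤ 1) (hz : z ∈ disk) (hne : z ≠ τ) : bpFactor τ z ≠ 0 :=
  mul_ne_zero (sub_ne_zero.2 hne.symm) (one_sub_conj_mul_ne_zero hτ hz)

lemma re_conj_mul_bpFactor_mul (τ z q : ℂ) :
    (conj z * (bpFactor τ z * q)).re =
      ((1 - ‖z‖ ^ 2) * (‖τ‖ ^ 2 - (conj τ * z).re) - ‖z - τ‖ ^ 2) * q.re +
        (1 - ‖z‖ ^ 2) * (conj τ * z).im * q.im := by
  simp only [bpFactor, Complex.sq_norm, normSq_apply, sub_re, sub_im, mul_re, mul_im, conj_re,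
    conj_im, one_re, one_im]
  ring

lemma abs_im_conj_mul_le (hτ : ‖τ‖ ≤ 1) (z : ℂ) : |(conj τ * z).im| ≤ ‖z - τ‖ := by
  have him : (conj τ * z).im = (conj τ * (z - τ)).im := by
    simp only [mul_im, sub_re, sub_im, conj_re, conj_im]
    ring
  rw [him]
  refine (abs_im_le_norm _).trans ?_
  rw [norm_mul, RCLike.norm_conj]
  exact mul_le_of_le_one_left (norm_nonneg _) hτ

lemma IsCaratheodory.im_sub_sq_le (hh : IsCaratheodory h) (hz : z ∈ disk) :
    (1 - ‖z‖ ^ 2) * ((h z).im - (h 0).im) ^ 2 ≤ 4 * (h z).re * (h 0).re := by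
  have hpick := hh.norm_add_conj_sq_le hz zero_mem_disk
  have him : ((h z).im - (h 0).im) ^ 2 ≤ ‖h z + conj (h 0)‖ ^ 2 := by
    rw [sq_le_sq, abs_norm]
    simpa [sub_eq_add_neg] using abs_im_le_norm (h z + conj (h 0))
  refine (mul_le_mul_of_nonneg_left him (one_sub_norm_sq_pos hz).le).trans ?_
  simpa using hpick

lemma IsCaratheodory.im_term_le (hh : IsCaratheodory h) (hτ : ‖τ‖ ≤ 1) (hz : z ∈ disk) :
    (1 - ‖z‖ ^ 2) * (conj τ * z).im * ((h z).im - (h 0).im) ≤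
      ‖z - τ‖ ^ 2 * (h z).re / 2 + 2 * (1 - ‖z‖ ^ 2) * (h 0).re := by
  have hgap := one_sub_norm_sq_pos hz
  have hre := hh.re_nonneg z hz
  have hre0 := hh.re_nonneg 0 zero_mem_disk
  have him : (conj τ * z).im ^ 2 ≤ ‖z - τ‖ ^ 2 := by
    rw [sq_le_sq, abs_norm]
    exact abs_im_conj_mul_le hτ z
  refine le_of_abs_le (abs_le_of_sq_le_sq ?_ (by positivity))
  calc ((1 - ‖z‖ ^ 2) * (conj τ * z).im * ((h z).im - (h 0).im)) ^ 2
      = ((1 - ‖z‖ ^ 2) * (conj τ * z).im ^ 2) *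
          ((1 - ‖z‖ ^ 2) * ((h z).im - (h 0).im) ^ 2) := by ring
    _ ≤ ((1 - ‖z‖ ^ 2) * ‖z - τ‖ ^ 2) * (4 * (h z).re * (h 0).re) := by
        exact mul_le_mul (mul_le_mul_of_nonneg_left him hgap.le) (hh.im_sub_sq_le hz)
          (by positivity) (by positivity)
    _ ≤ (‖z - τ‖ ^ 2 * (h z).re / 2 + 2 * (1 - ‖z‖ ^ 2) * (h 0).re) ^ 2 := by
        linarith [sq_nonneg (‖z - τ‖ ^ 2 * (h z).re / 2 - 2 * (1 - ‖z‖ ^ 2) * (h 0).re)]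

lemma IsCaratheodory.re_conj_mul_bpFactor_mul_le (hh : IsCaratheodory h) (hτ : ‖τ‖ ≤ 1)
    (hz : z ∈ disk) : (conj z * (bpFactor τ z * h z)).re ≤
      (4 * (h 0).re + |(h 0).im|) * (1 - ‖z‖ ^ 2) := by
  have hgap := one_sub_norm_sq_pos hz
  have hre := hh.re_nonneg z hz
  have hharnack : (1 - ‖z‖ ^ 2) * (h z).re ≤ 4 * (h 0).re := by
    simpa using hh.harnack zero_mem_disk hz
  have hτz : ‖τ‖ ^ 2 - (conj τ * z).re ≤ (1 - ‖z‖ ^ 2 + ‖z - τ‖ ^ 2) / 2 := by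
    have hexpand : ‖z - τ‖ ^ 2 = ‖z‖ ^ 2 + ‖τ‖ ^ 2 - 2 * (conj τ * z).re := by
      simp only [Complex.sq_norm, normSq_apply, sub_re, sub_im, mul_re, conj_re, conj_im]
      ring
    linarith [pow_le_one₀ (n := 2) (norm_nonneg τ) hτ]
  have him : (conj τ * z).im * (h 0).im ≤ |(h 0).im| := by
    have hle : |(conj τ * z).im| ≤ 1 := (abs_im_le_norm _).trans <| by
      rw [norm_mul, RCLike.norm_conj]
      exact mul_le_one₀ hτ (norm_nonneg z) (mem_disk.1 hz).le
    refine (le_abs_self _).trans ?_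
    rw [abs_mul]
    exact mul_le_of_le_one_left (abs_nonneg _) hle
  have hsq : (1 - ‖z‖ ^ 2) * (‖z - τ‖ ^ 2 * (h z).re) ≤ ‖z - τ‖ ^ 2 * (h z).re :=
    mul_le_of_le_one_left (by positivity) (by linarith [sq_nonneg ‖z‖])
  rw [re_conj_mul_bpFactor_mul]
  linarith [hh.im_term_le hτ hz, mul_le_mul_of_nonneg_left him hgap.le,
    mul_le_mul_of_nonneg_left hharnack hgap.le,
    mul_le_mul_of_nonneg_left (mul_le_mul_of_nonneg_right hτz hre) hgap.le]

theorem IsCaratheodory.exists_generates (hh : IsCaratheodory h) (hτ : ‖τ‖ ≤ 1) :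
    ∃ φ, Generates (fun z ↦ bpFactor τ z * h z) φ :=
  have hholo := (differentiable_bpFactor τ).differentiableOn.mul hh.holo
  (exists_isFlow hholo fun _ hz ↦ hh.re_conj_mul_bpFactor_mul_le hτ hz).imp
    fun _ hφ ↦ hφ.generates hholo

end BerksonPorta

section RadialLimit

variable {L d : ℂ}

lemma mul_conj_of_norm_eq_one (hσ : ‖σ‖ = 1) : σ * conj σ = 1 := by
  rw [Complex.mul_conj', hσ, ofReal_one, one_pow]

lemma ofReal_mul_mem_stolz (hσ : ‖σ‖ = 1) {ρ : ℝ} (hρ : ρ ∈ Ioo (0 : ℝ) 1) :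
    (ρ : ℂ) * σ ∈ stolz σ 1 := by
  refine ⟨ofReal_mul_mem_disk hσ hρ, ?_⟩
  have hsub : σ - (ρ : ℂ) * σ = ((1 - ρ : ℝ) : ℂ) * σ := by push_cast; ring
  rw [norm_ofReal_mul hσ hρ.1.le, norm_sub_rev, hsub, one_mul,
    norm_ofReal_mul hσ (sub_nonneg.2 hρ.2.le)]

lemma HasAngularLimit.tendsto_radial (hf : HasAngularLimit f σ L) (hσ : ‖σ‖ = 1) :
    Tendsto (fun ρ : ℝ ↦ f (ρ * σ)) (𝓝[<] 1) (𝓝 L) := by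
  refine (hf 1).comp (tendsto_nhdsWithin_iff.2 ⟨tendsto_ofReal_mul σ, ?_⟩)
  filter_upwards [Ioo_mem_nhdsLT zero_lt_one] with ρ hρ using ofReal_mul_mem_stolz hσ hρ

lemma HasAngularLimit.of_tendsto (hf : Tendsto f (𝓝[disk] σ) (𝓝 L)) : HasAngularLimit f σ L :=
  fun _ ↦ hf.mono_left (nhdsWithin_mono _ fun _ hz ↦ hz.1)

lemma HasMultiplier.isBRFPWith (hf : HasMultiplier f σ d) (hσ : ‖σ‖ = 1) : IsBRFPWith f σ d :=
  hf.resolve_left fun hin ↦ (mem_disk.1 hin.1).ne hσ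

lemma eventually_one_sub_ne_zero : ∀ᶠ ρ : ℝ in 𝓝[<] 1, ((1 - ρ : ℝ) : ℂ) ≠ 0 := by
  filter_upwards [self_mem_nhdsWithin] with ρ hρ
  exact ofReal_ne_zero.2 (sub_pos.2 hρ).ne'

lemma IsBRFPWith.tendsto_sub_div (hf : IsBRFPWith f σ d) :
    Tendsto (fun ρ : ℝ ↦ (σ - f (ρ * σ)) / (1 - ρ : ℝ)) (𝓝[<] 1) (𝓝 (σ * d)) := by
  have hσ0 : σ ≠ 0 := ne_zero_of_norm_ne_zero (hf.norm_eq_one ▸ one_ne_zero)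
  refine ((hf.angular_deriv.tendsto_radial hf.norm_eq_one).const_mul σ).congr' ?_
  filter_upwards [eventually_one_sub_ne_zero] with ρ hρ
  rw [show (ρ : ℂ) * σ - σ = -((1 - ρ : ℝ) * σ) by push_cast; ring]
  field_simp
  ring

/-- A Carathéodory function grows at most like `1 / (1 - ρ)` along the ray to `σ`, which excludes
`c = 0`. -/
lemma IsCaratheodory.hasPointMass_of_tendsto (hh : IsCaratheodory h) (hσ : ‖σ‖ = 1) {Q : ℝ → ℂ}
    {b c : ℝ} (hQ : Tendsto (fun ρ : ℝ ↦ Q ρ / (1 - ρ : ℝ)) (𝓝[<] 1) (𝓝 (σ * c)))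
    (hhQ : Tendsto (fun ρ : ℝ ↦ h (ρ * σ) * Q ρ) (𝓝[<] 1) (𝓝 (2 * σ * b))) (hb : b ≠ 0) :
    c ≠ 0 ∧ HasPointMass h σ (b / c) := by
  have hσ0 : σ ≠ 0 := ne_zero_of_norm_ne_zero (hσ ▸ one_ne_zero)
  have hc : c ≠ 0 := by
    rintro rfl
    have hbound : ∀ᶠ ρ : ℝ in 𝓝[<] 1,
        ‖h (ρ * σ) * Q ρ‖ ≤ 2 * ‖h 0‖ * ‖Q ρ / (1 - ρ : ℝ)‖ := by
      filter_upwards [Ioo_mem_nhdsLT zero_lt_one] with ρ hρ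
      have hgrowth := hh.one_sub_norm_mul_norm_le (ofReal_mul_mem_disk hσ hρ)
      have hpos : 0 < 1 - ρ := sub_pos.2 hρ.2
      rw [norm_ofReal_mul hσ hρ.1.le] at hgrowth
      rw [norm_mul, norm_div, Complex.norm_of_nonneg hpos.le, mul_div_assoc', le_div_iff₀ hpos]
      linarith [mul_le_mul_of_nonneg_right hgrowth (norm_nonneg (Q ρ))]
    have hle := le_of_tendsto_of_tendsto hhQ.norm (hQ.norm.const_mul _) hbound
    have hbpos := abs_pos.2 hb
    simp [hσ] at hle
    linarith
  have hσc : σ * c ≠ 0 := mul_ne_zero hσ0 (ofReal_ne_zero.2 hc)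
  have hlim : 2 * σ * b / (σ * c) = ((2 * (b / c) : ℝ) : ℂ) := by push_cast; field_simp
  have hdiv := (continuous_re.tendsto _).comp (hlim ▸ hhQ.div hQ hσc)
  rw [ofReal_re] at hdiv
  refine ⟨hc, hdiv.congr' ?_⟩
  filter_upwards [eventually_one_sub_ne_zero, hQ.eventually_ne hσc] with ρ hρ hQρ
  have hQ0 : Q ρ ≠ 0 := fun hzero ↦ hQρ (by rw [hzero, zero_div])
  rw [Function.comp_apply, Pi.div_apply, ← re_ofReal_mul]
  congr 1
  field_simp

lemma IsCaratheodory.nonneg_of_hasPointMass (hh : IsCaratheodory h) (hσ : ‖σ‖ = 1) {α : ℝ}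
    (hα : HasPointMass h σ α) : 0 ≤ α := by
  have hlim : 0 ≤ 2 * α := ge_of_tendsto hα <| by
    filter_upwards [Ioo_mem_nhdsLT zero_lt_one] with ρ hρ
    exact mul_nonneg (sub_nonneg.2 hρ.2.le) (hh.re_nonneg _ (ofReal_mul_mem_disk hσ hρ))
  linarith

lemma isCaratheodory_cayley_comp (hσ : ‖σ‖ = 1) (hf : DifferentiableOn ℂ f disk)
    (hmaps : MapsTo f disk disk) : IsCaratheodory fun z ↦ cayley σ (f z) :=
  ⟨(differentiableOn_cayley hσ).comp hf hmaps, fun _ hz ↦ (cayley_re_pos hσ (hmaps hz)).le⟩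

/-- Julia's lemma: at a boundary regular fixed point with derivative `d`, the function
`cayley σ ∘ f` has point mass `1 / d`. -/
lemma IsBRFPWith.julia (hf : DifferentiableOn ℂ f disk) (hmaps : MapsTo f disk disk) {d : ℝ}
    (hfix : IsBRFPWith f σ d) :
    0 < d ∧ ∀ z ∈ disk, (cayley σ z).re ≤ d * (cayley σ (f z)).re := by
  have hσ := hfix.norm_eq_one
  have hh := isCaratheodory_cayley_comp hσ hf hmaps
  have hnum : Tendsto (fun ρ : ℝ ↦ cayley σ (f (ρ * σ)) * (σ - f (ρ * σ))) (𝓝[<] 1)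
      (𝓝 (2 * σ * (1 : ℝ))) := by
    rw [ofReal_one, mul_one, two_mul]
    refine ((hfix.fixed.tendsto_radial hσ).const_add σ).congr' ?_
    filter_upwards [Ioo_mem_nhdsLT zero_lt_one] with ρ hρ
    exact (div_mul_cancel₀ _
      (sub_ne_zero_of_norm_eq_one hσ (hmaps (ofReal_mul_mem_disk hσ hρ)))).symm
  obtain ⟨hd, hmass⟩ := hh.hasPointMass_of_tendsto hσ hfix.tendsto_sub_div hnum one_ne_zero
  have hdpos : 0 < d := (one_div_nonneg.1 (hh.nonneg_of_hasPointMass hσ hmass)).lt_of_ne' hd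
  refine ⟨hdpos, fun z hz ↦ ?_⟩
  have hle := hh.mul_cayley_re_le_of_hasPointMass hσ hmass hz
  rwa [one_div, inv_mul_le_iff₀ hdpos] at hle

end RadialLimit

section HalfPlaneFunction

/-- `H = ((z - τ) (1 - τ̄ f) + (f - τ) (1 - τ̄ z)) / (z - f)` belongs to the Carathéodory class;
such an `H` exists for every self-map `f` of the disk with Denjoy–Wolff point `τ`. The defining
equation is multiplied out because `z - f z` vanishes at `z = τ` if `τ` is in the disk. -/
structure IsHalfPlaneFunction (f : ℂ → ℂ) (τ : ℂ) (H : ℂ → ℂ) : Prop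
    extends IsCaratheodory H where
  mul_sub_eq : ∀ z ∈ disk, H z * (z - f z) =
    (z - τ) * (1 - conj τ * f z) + (f z - τ) * (1 - conj τ * z)

variable {H : ℂ → ℂ}

lemma le_of_forall_ne_le {u v : ℂ → ℝ} (hu : ContinuousOn u disk) (hv : ContinuousOn v disk)
    (huv : ∀ x ∈ disk, x ≠ τ → u x ≤ v x) (hz : z ∈ disk) : u z ≤ v z := by
  obtain rfl | hne := eq_or_ne z τ
  · have hnhds := disk_mem_nhds hz
    refine le_of_tendsto_of_tendsto (b := 𝓝[≠] z) (hu.continuousAt hnhds).continuousWithinAt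
      (hv.continuousAt hnhds).continuousWithinAt ?_
    filter_upwards [self_mem_nhdsWithin, nhdsWithin_le_nhds hnhds] with x hne hx
      using huv x hx hne
  · exact huv z hz hne

lemma norm_dslope_mul_le (hf : DifferentiableOn ℂ f disk) (hmaps : MapsTo f disk disk)
    (hτ : τ ∈ disk) (hfix : f τ = τ) (hz : z ∈ disk) :
    ‖dslope f τ z * (1 - conj τ * z)‖ ≤ ‖1 - conj τ * f z‖ := by
  have hoff : ∀ x ∈ disk, x ≠ τ → ‖dslope f τ x * (1 - conj τ * x)‖ ≤ ‖1 - conj τ * f x‖ := by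
    intro x hx hne
    have hslope : (x - τ) * dslope f τ x = f x - τ := by simpa [hfix] using sub_smul_dslope f τ x
    have hpick := norm_blaschke_comp_le hf hmaps hτ hx
    rw [hfix] at hpick
    refine le_of_mul_le_mul_left ?_ (norm_pos_iff.2 (sub_ne_zero.2 hne))
    calc ‖x - τ‖ * ‖dslope f τ x * (1 - conj τ * x)‖
        = ‖f x - τ‖ * ‖1 - conj τ * x‖ := by rw [← norm_mul, ← mul_assoc, hslope, norm_mul]
      _ = ‖blaschke τ (f x)‖ * ‖1 - conj τ * f x‖ * ‖1 - conj τ * x‖ := by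
          rw [norm_blaschke_mul hτ (hmaps hx)]
      _ ≤ ‖blaschke τ x‖ * ‖1 - conj τ * f x‖ * ‖1 - conj τ * x‖ := by gcongr
      _ = ‖x - τ‖ * ‖1 - conj τ * f x‖ := by rw [← norm_blaschke_mul hτ hx]; ring
  have hslope := ((Complex.differentiableOn_dslope (disk_mem_nhds hτ)).2 hf).continuousOn
  have hcont := hf.continuousOn
  exact le_of_forall_ne_le (by fun_prop) (by fun_prop) hoff hz

lemma dslope_ne_one (hf : DifferentiableOn ℂ f disk) (hmaps : MapsTo f disk disk)
    (hτ : τ ∈ disk) (hfix : f τ = τ) (hid : ¬ EqOn f id disk) (hz : z ∈ disk) :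
    dslope f τ z ≠ 1 := by
  intro hone
  refine hid fun x hx ↦ ?_
  have hslope : ∀ y, (y - τ) * dslope f τ y = f y - τ := fun y ↦ by
    simpa [hfix] using sub_smul_dslope f τ y
  have hden : ∀ y ∈ disk, 1 - conj τ * f y ≠ 0 := fun y hy ↦
    one_sub_conj_mul_ne_zero (mem_disk.1 hτ).le (hmaps hy)
  set g : ℂ → ℂ := fun y ↦ 1 - dslope f τ y * (1 - conj τ * y) / (1 - conj τ * f y) with hg
  have hgeq : ∀ y ∈ disk, g y * (1 - conj τ * f y) = (1 - dslope f τ y) * (1 - conj τ * τ) := by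
    intro y hy
    rw [hg, sub_mul, div_mul_cancel₀ _ (hden y hy)]
    linear_combination conj τ * hslope y
  have hgC : IsCaratheodory g := by
    refine ⟨?_, fun y hy ↦ ?_⟩
    · have hD := (Complex.differentiableOn_dslope (disk_mem_nhds hτ)).2 hf
      exact (DifferentiableOn.div (by fun_prop) (by fun_prop) hden).const_sub 1
    · have hle := (re_le_norm _).trans ((norm_div _ _).trans_le
        (div_le_one_of_le₀ (norm_dslope_mul_le hf hmaps hτ hfix hy) (norm_nonneg _)))
      rw [hg, sub_re, one_re]
      linarith
  have hgz : g z = 0 := by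
    refine (mul_eq_zero.1 ?_).resolve_right (hden z hz)
    rw [hgeq z hz, hone, sub_self, zero_mul]
  have hgx : g x = 0 := (hgC.eqOn_const_of_re_eq_zero hz (by rw [hgz, zero_re]) hx).trans hgz
  have hxone : 1 - dslope f τ x = 0 := by
    refine (mul_eq_zero.1 ?_).resolve_right (one_sub_conj_mul_ne_zero (mem_disk.1 hτ).le hτ)
    rw [← hgeq x hx, hgx, zero_mul]
  rw [id_eq]
  linear_combination -hslope x - (x - τ) * hxone

lemma re_add_div_sub_nonneg (hle : ‖w‖ ≤ ‖z‖) : 0 ≤ ((z + w) / (z - w)).re := by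
  have hre : ((z + w) * conj (z - w)).re = ‖z‖ ^ 2 - ‖w‖ ^ 2 := by
    simp only [Complex.sq_norm, normSq_apply, mul_re, add_re, add_im, conj_re, conj_im, sub_re,
      sub_im]
    ring
  rw [div_eq_mul_inv, inv_def, ← mul_assoc, re_mul_ofReal, hre]
  have := pow_le_pow_left₀ (norm_nonneg w) hle 2
  exact mul_nonneg (by linarith) (inv_nonneg.2 (normSq_nonneg _))

lemma exists_isHalfPlaneFunction_of_fixed (hf : DifferentiableOn ℂ f disk)
    (hmaps : MapsTo f disk disk) (hτ : τ ∈ disk) (hfix : f τ = τ) (hid : ¬ EqOn f id disk) :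
    ∃ H, IsHalfPlaneFunction f τ H := by
  have hslope : ∀ z, (z - τ) * dslope f τ z = f z - τ := fun z ↦ by
    simpa [hfix] using sub_smul_dslope f τ z
  have hD := (Complex.differentiableOn_dslope (disk_mem_nhds hτ)).2 hf
  have hdiff : ∀ z, 1 - conj τ * f z - dslope f τ z * (1 - conj τ * z) =
      (1 - dslope f τ z) * (1 - conj τ * τ) := fun z ↦ by
    linear_combination conj τ * hslope z
  have hne : ∀ z ∈ disk, 1 - conj τ * f z - dslope f τ z * (1 - conj τ * z) ≠ 0 := fun z hz ↦ by
    rw [hdiff z]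
    exact mul_ne_zero (sub_ne_zero.2 (dslope_ne_one hf hmaps hτ hfix hid hz).symm)
      (one_sub_conj_mul_ne_zero (mem_disk.1 hτ).le hτ)
  refine ⟨fun z ↦ ((1 - ‖τ‖ ^ 2 : ℝ) : ℂ) *
    ((1 - conj τ * f z + dslope f τ z * (1 - conj τ * z)) /
      (1 - conj τ * f z - dslope f τ z * (1 - conj τ * z))),
    ⟨(DifferentiableOn.div (by fun_prop) (by fun_prop) hne).const_mul _, fun z hz ↦ ?_⟩,
    fun z hz ↦ ?_⟩
  · rw [re_ofReal_mul]
    exact mul_nonneg (one_sub_norm_sq_pos hτ).le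
      (re_add_div_sub_nonneg (norm_dslope_mul_le hf hmaps hτ hfix hz))
  · have hτ2 : ((1 - ‖τ‖ ^ 2 : ℝ) : ℂ) = 1 - conj τ * τ := by
      rw [Complex.conj_mul']; push_cast; rfl
    have hzf : z - f z = (z - τ) * (1 - dslope f τ z) := by linear_combination hslope z
    rw [hτ2, mul_div_assoc', div_mul_eq_mul_div, div_eq_iff (hne z hz), hdiff z, hzf]
    linear_combination (1 - conj τ * τ) * (1 - conj τ * z) * (1 - dslope f τ z) * hslope z

/-- Multiplied by `1 - |τ|²`, the right-hand side becomes
`|z - τ|² |1 - τ̄ w|² - |w - τ|² |1 - τ̄ z|²`, but this form also makes sense for `|τ| = 1`. -/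
lemma re_mul_conj_sub_eq : (((z - τ) * (1 - conj τ * w) + (w - τ) * (1 - conj τ * z)) *
      conj (z - w)).re = ‖z - τ‖ ^ 2 * (1 - ‖w‖ ^ 2) - ‖w - τ‖ ^ 2 * (1 - ‖z‖ ^ 2) := by
  simp only [Complex.sq_norm, normSq_apply, mul_re, mul_im, add_re, add_im, conj_re, conj_im,
    sub_re, sub_im, one_re, one_im]
  ring

lemma exists_isHalfPlaneFunction_of_boundary (hf : DifferentiableOn ℂ f disk)
    (hmaps : MapsTo f disk disk) (hne : ∀ z ∈ disk, f z ≠ z) {d : ℝ} (hd : d ≤ 1)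
    (hfix : IsBRFPWith f τ d) : ∃ H, IsHalfPlaneFunction f τ H := by
  have hτ := hfix.norm_eq_one
  have hzf : ∀ z ∈ disk, z - f z ≠ 0 := fun z hz ↦ sub_ne_zero.2 (hne z hz).symm
  refine ⟨fun z ↦ ((z - τ) * (1 - conj τ * f z) + (f z - τ) * (1 - conj τ * z)) / (z - f z),
    ⟨DifferentiableOn.div (by fun_prop) (by fun_prop) hzf, fun z hz ↦ ?_⟩,
    fun z hz ↦ div_mul_cancel₀ _ (hzf z hz)⟩
  have hcay := cayley_re_pos hτ (hmaps hz)
  have hjulia : (cayley τ z).re ≤ (cayley τ (f z)).re :=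
    ((hfix.julia hf hmaps).2 z hz).trans (mul_le_of_le_one_left hcay.le hd)
  have hτz := norm_pos_iff.2 (sub_ne_zero_of_norm_eq_one hτ hz)
  have hτf := norm_pos_iff.2 (sub_ne_zero_of_norm_eq_one hτ (hmaps hz))
  rw [cayley_re hτ, cayley_re hτ, div_le_div_iff₀ (by positivity) (by positivity),
    norm_sub_rev τ z, norm_sub_rev τ (f z)] at hjulia
  rw [div_eq_mul_inv, inv_def, ← mul_assoc, re_mul_ofReal, re_mul_conj_sub_eq]
  exact mul_nonneg (by linarith) (inv_nonneg.2 (normSq_nonneg _))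

lemma IsDWPoint.exists_isHalfPlaneFunction (hf : DifferentiableOn ℂ f disk)
    (hmaps : MapsTo f disk disk) (hτ : IsDWPoint f τ) : ∃ H, IsHalfPlaneFunction f τ H := by
  obtain ⟨hid, ⟨hin, hfix⟩ | ⟨hne, d, hd, hfix⟩⟩ := hτ
  · exact exists_isHalfPlaneFunction_of_fixed hf hmaps hin hfix hid
  · exact exists_isHalfPlaneFunction_of_boundary hf hmaps hne hd hfix

lemma sub_mul_one_sub_conj_mul (hσ : ‖σ‖ = 1) (τ : ℂ) :
    (σ - τ) * (1 - conj τ * σ) = σ * ((‖σ - τ‖ ^ 2 : ℝ) : ℂ) := by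
  rw [ofReal_pow, ← Complex.mul_conj', map_sub]
  linear_combination -(σ - τ) * mul_conj_of_norm_eq_one hσ

lemma IsHalfPlaneFunction.hasPointMass (hH : IsHalfPlaneFunction f τ H) (hne : σ ≠ τ) {d : ℝ}
    (hfix : IsBRFPWith f σ d) : d ≠ 1 ∧ HasPointMass H σ (‖σ - τ‖ ^ 2 / (d - 1)) := by
  have hσ := hfix.norm_eq_one
  have hz := tendsto_ofReal_mul σ
  have hf := hfix.fixed.tendsto_radial hσ
  have hnum : Tendsto (fun ρ : ℝ ↦ H (ρ * σ) * (ρ * σ - f (ρ * σ))) (𝓝[<] 1)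
      (𝓝 (2 * σ * ((‖σ - τ‖ ^ 2 : ℝ) : ℂ))) := by
    rw [mul_assoc, ← sub_mul_one_sub_conj_mul hσ, two_mul]
    refine (((hz.sub_const τ).mul ((hf.const_mul (conj τ)).const_sub 1)).add
      ((hf.sub_const τ).mul ((hz.const_mul (conj τ)).const_sub 1))).congr' ?_
    filter_upwards [Ioo_mem_nhdsLT zero_lt_one] with ρ hρ
    exact (hH.mul_sub_eq _ (ofReal_mul_mem_disk hσ hρ)).symm
  have hden : Tendsto (fun ρ : ℝ ↦ (ρ * σ - f (ρ * σ)) / (1 - ρ : ℝ)) (𝓝[<] 1)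
      (𝓝 (σ * (d - 1 : ℝ))) := by
    rw [ofReal_sub, ofReal_one, mul_sub_one]
    refine (hfix.tendsto_sub_div.sub_const σ).congr' ?_
    filter_upwards [eventually_one_sub_ne_zero] with ρ hρ
    field_simp
    push_cast
    ring
  have hpos : ‖σ - τ‖ ^ 2 ≠ 0 := pow_ne_zero 2 (norm_ne_zero_iff.2 (sub_ne_zero.2 hne))
  exact (hH.toIsCaratheodory.hasPointMass_of_tendsto hσ hden hnum hpos).imp_left sub_ne_zero.1

end HalfPlaneFunction

section SpectralInequality

variable {G : ℂ → ℂ} {φ : ℝ → ℂ → ℂ} {ι : Type*} [Fintype ι] {s : ι → ℂ}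

lemma IsDWPoint.sum_mul_cayley_re_le (hτ : IsDWPoint f τ) (hf : DifferentiableOn ℂ f disk)
    (hmaps : MapsTo f disk disk) (hinj : Function.Injective s) (hne : ∀ k, s k ≠ τ) {d : ι → ℝ}
    (hs : ∀ k, IsBRFPWith f (s k) (d k)) (hz : z ∈ disk) (hfz : f z ≠ z) :
    ∑ k, ‖s k - τ‖ ^ 2 / (d k - 1) * (cayley (s k) z).re ≤
      (((z - τ) * (1 - conj τ * f z) + (f z - τ) * (1 - conj τ * z)) / (z - f z)).re := by
  obtain ⟨H, hH⟩ := hτ.exists_isHalfPlaneFunction hf hmaps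
  rw [← hH.mul_sub_eq z hz, mul_div_cancel_right₀ _ (sub_ne_zero.2 hfz.symm)]
  exact hH.toIsCaratheodory.sum_mul_cayley_re_le (fun k ↦ (hs k).norm_eq_one) hinj Finset.univ
    (fun k _ ↦ (hH.hasPointMass (hne k) (hs k)).2) hz

lemma Generates.tendsto_slope (hφ : Generates G φ) (hz : z ∈ disk) :
    Tendsto (fun t : ℝ ↦ (φ t z - z) / t) (𝓝[>] 0) (𝓝 (G z)) := by
  have hderiv := (hφ.flow z hz 0 le_rfl).mono Ioi_subset_Ici_self
  rw [hasDerivWithinAt_iff_tendsto_slope' self_notMem_Ioi, hφ.semigroup.zero z hz] at hderiv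
  refine hderiv.congr fun t ↦ ?_
  rw [slope_def_module, sub_zero, hφ.semigroup.zero z hz, real_smul, ofReal_inv, div_eq_inv_mul]

lemma Generates.eventually_apply_ne (hφ : Generates G φ) (hz : z ∈ disk) (hGz : G z ≠ 0) :
    ∀ᶠ t : ℝ in 𝓝[>] 0, 0 < t ∧ φ t z ≠ z := by
  filter_upwards [self_mem_nhdsWithin, (hφ.tendsto_slope hz).eventually_ne hGz] with t ht hslope
  exact ⟨ht, fun heq ↦ hslope (by rw [heq, sub_self, zero_div])⟩

lemma IsDWPointOf.isDWPoint (hτ : IsDWPointOf φ τ) (hz : z ∈ disk) {t : ℝ} (ht : 0 ≤ t)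
    (hne : φ t z ≠ z) : IsDWPoint (φ t) τ :=
  hτ.2 t ht fun hid ↦ hne (hid hz)

lemma HasSpectralValue.isBRFPWith {l : ℝ} (hs : HasSpectralValue φ σ l) (hσ : ‖σ‖ = 1) {t : ℝ}
    (ht : 0 ≤ t) : IsBRFPWith (φ t) σ (Real.exp (-l * t) : ℝ) := by
  push_cast
  exact (hs t ht).isBRFPWith hσ

lemma tendsto_exp_mul_sub_one_div (c : ℝ) :
    Tendsto (fun t : ℝ ↦ (Real.exp (c * t) - 1) / t) (𝓝[>] 0) (𝓝 c) := by
  have hderiv := (hasDerivAt_const_mul_exp 1 c 0).hasDerivWithinAt (s := Ioi 0)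
  simp only [one_mul, mul_zero, Real.exp_zero, mul_one] at hderiv
  rw [hasDerivWithinAt_iff_tendsto_slope' self_notMem_Ioi] at hderiv
  refine hderiv.congr fun t ↦ ?_
  rw [slope_def_field, mul_zero, Real.exp_zero, sub_zero]

lemma Generates.tendsto_mul_halfPlane (hφ : Generates G φ) (τ : ℂ) (hz : z ∈ disk) (hGz : G z ≠ 0) :
    Tendsto (fun t : ℝ ↦ (t : ℂ) * (((z - τ) * (1 - conj τ * φ t z) +
      (φ t z - τ) * (1 - conj τ * z)) / (z - φ t z))) (𝓝[>] 0) (𝓝 (2 * (bpFactor τ z / G z))) := by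
  have hφz : Tendsto (fun t : ℝ ↦ φ t z) (𝓝[>] 0) (𝓝 z) := hφ.semigroup.cont z hz
  have hnum := (((hφz.const_mul (conj τ)).const_sub 1).const_mul (z - τ)).add
    ((hφz.sub_const τ).mul_const (1 - conj τ * z))
  have hlim := hnum.div (hφ.tendsto_slope hz).neg (neg_ne_zero.2 hGz)
  have hval : ((z - τ) * (1 - conj τ * z) + (z - τ) * (1 - conj τ * z)) / -G z =
      2 * (bpFactor τ z / G z) := by
    rw [bpFactor]
    field_simp
    ring
  rw [hval] at hlim
  refine hlim.congr fun t ↦ ?_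
  rw [Pi.div_apply, ← neg_div, neg_sub, div_div_eq_mul_div, mul_comm, mul_div_assoc]

lemma IsDWPointOf.spectralValue_ne_zero (hτ : IsDWPointOf φ τ) (hφ : Generates G φ)
    (hz : z ∈ disk) (hGz : G z ≠ 0) (hσ : ‖σ‖ = 1) (hne : σ ≠ τ) {l : ℝ}
    (hs : HasSpectralValue φ σ l) : l ≠ 0 := by
  rintro rfl
  obtain ⟨t, ht, hφt⟩ := (hφ.eventually_apply_ne hz hGz).exists
  obtain ⟨H, hH⟩ := (hτ.isDWPoint hz ht.le hφt).exists_isHalfPlaneFunction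
    (hφ.semigroup.holo t ht.le) (hφ.semigroup.mapsTo t ht.le)
  exact (hH.hasPointMass hne (hs.isBRFPWith hσ ht.le)).1 (by simp)

/-- This is `IsDWPoint.sum_mul_cayley_re_le` for `φ t`, multiplied by `t`, in the limit `t → 0`. -/
lemma IsDWPointOf.sum_mul_cayley_re_le (hτ : IsDWPointOf φ τ) (hφ : Generates G φ)
    (hnorm : ∀ k, ‖s k‖ = 1) (hinj : Function.Injective s) (hne : ∀ k, s k ≠ τ) {l : ι → ℝ}
    (hs : ∀ k, HasSpectralValue φ (s k) (l k)) (hz : z ∈ disk) (hGz : G z ≠ 0) :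
    ∑ k, ‖s k - τ‖ ^ 2 / -l k * (cayley (s k) z).re ≤ 2 * (bpFactor τ z / G z).re := by
  have hleft : Tendsto (fun t : ℝ ↦ ∑ k, ‖s k - τ‖ ^ 2 / ((Real.exp (-l k * t) - 1) / t) *
      (cayley (s k) z).re) (𝓝[>] 0) (𝓝 (∑ k, ‖s k - τ‖ ^ 2 / -l k * (cayley (s k) z).re)) := by
    refine tendsto_finsetSum _ fun k _ ↦ Tendsto.mul_const _ ?_
    have hl := hτ.spectralValue_ne_zero hφ hz hGz (hnorm k) (hne k) (hs k)
    exact tendsto_const_nhds.div (tendsto_exp_mul_sub_one_div _) (neg_ne_zero.2 hl)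
  have hright := (continuous_re.tendsto _).comp (hφ.tendsto_mul_halfPlane τ hz hGz)
  rw [show (2 : ℂ) = (2 : ℝ) by norm_num, re_ofReal_mul] at hright
  refine le_of_tendsto_of_tendsto hleft hright ?_
  filter_upwards [hφ.eventually_apply_ne hz hGz] with t ⟨ht, hφt⟩
  have hle := (hτ.isDWPoint hz ht.le hφt).sum_mul_cayley_re_le (hφ.semigroup.holo t ht.le)
    (hφ.semigroup.mapsTo t ht.le) hinj hne (fun k ↦ (hs k).isBRFPWith (hnorm k) ht.le) hz hφt
  rw [Function.comp_apply, re_ofReal_mul]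
  refine le_trans (le_of_eq ?_) (mul_le_mul_of_nonneg_left hle ht.le)
  rw [Finset.mul_sum]
  refine Finset.sum_congr rfl fun k _ ↦ ?_
  rw [div_div_eq_mul_div]
  ring

end SpectralInequality

section Representation

variable {G : ℂ → ℂ} {φ : ℝ → ℂ → ℂ} {n : ℕ} {σ : Fin n → ℂ} {lam : Fin n → ℝ}

lemma pZero_re (τ : ℂ) (σ : Fin n → ℂ) (lam : Fin n → ℝ) (z : ℂ) :
    (pZero τ σ lam z).re = ∑ k, alpha τ σ lam k * (cayley (σ k) z).re := by
  simp only [pZero, cayley, re_sum, re_ofReal_mul]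

lemma differentiableOn_pZero (hσ : ∀ k, ‖σ k‖ = 1) : DifferentiableOn ℂ (pZero τ σ lam) disk :=
  DifferentiableOn.fun_sum fun k _ ↦ (differentiableOn_cayley (hσ k)).const_mul _

lemma alpha_nonneg (τ : ℂ) (σ : Fin n → ℂ) (lam : Fin n → ℝ) (k : Fin n) :
    0 ≤ alpha τ σ lam k := by
  rw [alpha]
  positivity

lemma isCaratheodory_pZero (hσ : ∀ k, ‖σ k‖ = 1) : IsCaratheodory (pZero τ σ lam) := by
  refine ⟨differentiableOn_pZero hσ, fun z hz ↦ ?_⟩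
  rw [pZero_re]
  exact Finset.sum_nonneg fun k _ ↦ mul_nonneg (alpha_nonneg τ σ lam k) (cayley_re_pos (hσ k) hz).le

lemma pZero_re_le_of_mem_Gen (hinj : Function.Injective σ) (hne : ∀ k, τ ≠ σ k)
    (hG : G ∈ Gen τ σ lam) (hz : z ∈ disk) (hGz : G z ≠ 0) :
    (pZero τ σ lam z).re ≤ (bpFactor τ z / G z).re := by
  obtain ⟨φ, hφ, hzero | hτ, hk⟩ := hG
  · exact absurd (hzero hz) hGz
  choose hσ l hlam hl0 hs using hk
  suffices hsum : 2 * (pZero τ σ lam z).re ≤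
      ∑ k, ‖σ k - τ‖ ^ 2 / -l k * (cayley (σ k) z).re by
    linarith [hτ.sum_mul_cayley_re_le hφ hσ hinj (fun k ↦ (hne k).symm) hs hz hGz]
  rw [pZero_re, Finset.mul_sum]
  refine Finset.sum_le_sum fun k _ ↦ ?_
  have hlne := hτ.spectralValue_ne_zero hφ hz hGz (hσ k) (hne k).symm (hs k)
  have hlpos : 0 < -l k := neg_pos.2 ((hl0 k).lt_of_ne hlne)
  rw [← mul_assoc, alpha, norm_sub_rev, ← mul_div_assoc, mul_div_mul_left _ _ two_ne_zero,
    abs_of_nonpos ((hlam k).trans (hl0 k))]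
  gcongr
  · exact (cayley_re_pos (hσ k) hz).le
  · exact hlam k

lemma apply_eq_zero_of_mem_Gen (hG : G ∈ Gen τ σ lam) (hτ : τ ∈ disk) : G τ = 0 := by
  obtain ⟨φ, hφ, hzero | hdw, -⟩ := hG
  · exact hzero hτ
  · refine hφ.eq_zero hτ fun t ht ↦ ?_
    by_cases hid : EqOn (φ t) id disk
    · exact hid hτ
    · obtain ⟨-, ⟨-, hfix⟩ | ⟨-, d, -, hd⟩⟩ := hdw.2 t ht hid
      · exact hfix
      · exact absurd hd.norm_eq_one (mem_disk.1 hτ).ne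

lemma exists_eq_bpFactor_mul (hG : DifferentiableOn ℂ G disk) (hτ : ‖τ‖ ≤ 1)
    (h0 : τ ∈ disk → G τ = 0) :
    ∃ q, DifferentiableOn ℂ q disk ∧ ∀ z ∈ disk, G z = bpFactor τ z * q z := by
  by_cases hτd : τ ∈ disk
  · have hD := (Complex.differentiableOn_dslope (disk_mem_nhds hτd)).2 hG
    have hden : ∀ z ∈ disk, 1 - conj τ * z ≠ 0 := fun z hz ↦ one_sub_conj_mul_ne_zero hτ hz
    refine ⟨fun z ↦ -dslope G τ z / (1 - conj τ * z), hD.neg.div (by fun_prop) hden,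
      fun z hz ↦ ?_⟩
    have hslope : (z - τ) * dslope G τ z = G z := by simpa [h0 hτd] using sub_smul_dslope G τ z
    rw [bpFactor, mul_assoc, mul_div_cancel₀ _ (hden z hz), ← hslope]
    ring
  · have hne : ∀ z ∈ disk, bpFactor τ z ≠ 0 := fun z hz ↦
      bpFactor_ne_zero hτ hz (ne_of_mem_of_not_mem hz hτd)
    exact ⟨fun z ↦ G z / bpFactor τ z, hG.div (differentiable_bpFactor τ).differentiableOn hne,
      fun z hz ↦ (mul_div_cancel₀ _ (hne z hz)).symm⟩

/-- The function `z ↦ (τ - z) (1 - τ̄ z) / (a + p₀(z))`. For imaginary `a` these are the extremal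
generators; with `a` replaced by a function of the Carathéodory class one obtains every element of
`Gen τ σ lam` other than `0`. -/
noncomputable def genWith (τ : ℂ) (σ : Fin n → ℂ) (lam : Fin n → ℝ) (a z : ℂ) : ℂ :=
  bpFactor τ z / (a + pZero τ σ lam z)

lemma pZero_re_mul_norm_sq_le_of_mem_Gen (hσ : ∀ k, ‖σ k‖ = 1) (hinj : Function.Injective σ)
    (hne : ∀ k, τ ≠ σ k) (hτ : ‖τ‖ ≤ 1) (hG : G ∈ Gen τ σ lam) {q : ℂ → ℂ}
    (hq : DifferentiableOn ℂ q disk) (hGq : ∀ z ∈ disk, G z = bpFactor τ z * q z) (hz : z ∈ disk) :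
    (pZero τ σ lam z).re * ‖q z‖ ^ 2 ≤ (q z).re := by
  have hp := (differentiableOn_pZero (τ := τ) (lam := lam) hσ).continuousOn
  have hqc := hq.continuousOn
  refine le_of_forall_ne_le (τ := τ) (u := fun z ↦ (pZero τ σ lam z).re * ‖q z‖ ^ 2)
    (v := fun z ↦ (q z).re) ((continuous_re.comp_continuousOn hp).mul (hqc.norm.pow 2))
    (continuous_re.comp_continuousOn hqc) (fun x hx hxτ ↦ ?_) hz
  obtain hqx | hqx := eq_or_ne (q x) 0
  · simp [hqx]
  have hfactor := bpFactor_ne_zero hτ hx hxτ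
  have hle := pZero_re_le_of_mem_Gen hinj hne hG hx (hGq x hx ▸ mul_ne_zero hfactor hqx)
  rwa [hGq x hx, div_mul_cancel_left₀ hfactor, inv_re, normSq_eq_norm_sq,
    le_div_iff₀ (by positivity)] at hle

theorem exists_isCaratheodory_of_mem_Gen (hσ : ∀ k, ‖σ k‖ = 1) (hinj : Function.Injective σ)
    (hne : ∀ k, τ ≠ σ k) (hτ : ‖τ‖ ≤ 1) (hG : G ∈ Gen τ σ lam) :
    EqOn G 0 disk ∨ ∃ h, IsCaratheodory h ∧ EqOn G (fun z ↦ genWith τ σ lam (h z) z) disk := by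
  obtain ⟨q, hq, hGq⟩ := exists_eq_bpFactor_mul (hG.elim fun φ hφ ↦ hφ.1.holo) hτ
    (apply_eq_zero_of_mem_Gen hG)
  have hle : ∀ z ∈ disk, (pZero τ σ lam z).re * ‖q z‖ ^ 2 ≤ (q z).re := fun z hz ↦
    pZero_re_mul_norm_sq_le_of_mem_Gen hσ hinj hne hτ hG hq hGq hz
  have hp := isCaratheodory_pZero (τ := τ) (lam := lam) hσ
  have hqC : IsCaratheodory q :=
    ⟨hq, fun z hz ↦ (mul_nonneg (hp.re_nonneg z hz) (sq_nonneg _)).trans (hle z hz)⟩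
  by_cases hzero : ∃ w ∈ disk, q w = 0
  · obtain ⟨w, hw, hqw⟩ := hzero
    refine Or.inl fun z hz ↦ ?_
    rw [hGq z hz, hqC.eqOn_const_of_re_eq_zero hw (by rw [hqw, zero_re]) hz, hqw, mul_zero,
      Pi.zero_apply]
  · push Not at hzero
    refine Or.inr ⟨fun z ↦ (q z)⁻¹ - pZero τ σ lam z,
      ⟨(hq.inv hzero).sub hp.holo, fun z hz ↦ ?_⟩, fun z hz ↦ ?_⟩
    · have hpos := norm_pos_iff.2 (hzero z hz)
      rw [sub_re, inv_re, normSq_eq_norm_sq, sub_nonneg, le_div_iff₀ (by positivity)]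
      exact hle z hz
    · simp only [genWith, sub_add_cancel, div_inv_eq_mul, hGq z hz]

end Representation

section InteriorSpectralValue

variable {G : ℂ → ℂ} {φ : ℝ → ℂ → ℂ} {n : ℕ} {σ : Fin n → ℂ} {lam : Fin n → ℝ} {a d d' ω ω' : ℂ}
  {r : ℝ}

lemma HasMultiplier.unique (hfh : EqOn f h disk) (hd : HasMultiplier f τ d)
    (hd' : HasMultiplier h τ d') : d = d' := by
  obtain ⟨hτ, -, hd⟩ | hd := hd <;> obtain ⟨hτ', -, hd'⟩ | hd' := hd'
  · exact hd.unique (hd'.congr_of_eventuallyEq (hfh.eventuallyEq_of_mem (disk_mem_nhds hτ)))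
  · exact absurd hd'.norm_eq_one (mem_disk.1 hτ).ne
  · exact absurd hd.norm_eq_one (mem_disk.1 hτ').ne
  · have hτ := hd.norm_eq_one
    refine tendsto_nhds_unique (hd.angular_deriv.tendsto_radial hτ)
      ((hd'.angular_deriv.tendsto_radial hτ).congr' ?_)
    filter_upwards [Ioo_mem_nhdsLT zero_lt_one] with ρ hρ
    rw [hfh (ofReal_mul_mem_disk hτ hρ)]

lemma IsSpectralValue.unique (hω : IsSpectralValue G τ ω) (hω' : IsSpectralValue G τ ω') :
    ω = ω' := by
  obtain ⟨φ, hφ, hs⟩ := hω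
  obtain ⟨ψ, hψ, hs'⟩ := hω'
  have hexp : EqOn (fun t : ℝ ↦ exp (-ω * t)) (fun t : ℝ ↦ exp (-ω' * t)) (Ici 0) :=
    fun t ht ↦ (hs t ht).unique (hφ.eqOn hψ ht) (hs' t ht)
  have hderiv (c : ℂ) : HasDerivWithinAt (fun t : ℝ ↦ exp (-c * t)) (-c) (Ici 0) 0 := by
    simpa using ((hasDerivAt_id (0 : ℝ)).ofReal_comp.const_mul (-c)).cexp.hasDerivWithinAt
  exact neg_injective ((uniqueDiffOn_Ici (0 : ℝ) 0 self_mem_Ici).eq_deriv _ (hderiv ω)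
    ((hderiv ω').congr hexp (hexp self_mem_Ici)))

lemma Generates.hasSpectralValue_of_hasDerivAt (hφ : Generates G φ) (hτ : τ ∈ disk)
    (h0 : G τ = 0) (hd : HasDerivAt G d τ) : HasSpectralValue φ τ (-d) := by
  intro t ht
  have hfix := hφ.apply_eq_self hτ h0 ht
  refine Or.inl ⟨hτ, hfix, ?_⟩
  have hG : Tendsto (fun z ↦ G z / (z - τ)) (𝓝[disk \ {τ}] τ) (𝓝 d) := by
    refine ((hasDerivAt_iff_tendsto_slope.1 hd).mono_left
      (nhdsWithin_mono _ fun z hz ↦ hz.2)).congr fun z ↦ ?_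
    rw [slope_def_field, h0, sub_zero]
  have hφt : HasDerivWithinAt (φ t) (exp (d * t)) disk τ := by
    rw [hasDerivWithinAt_iff_tendsto_slope]
    refine (hφ.isFlow.tendsto_div_of_tendsto (fun _ ↦ h0) hG ht).congr fun z ↦ ?_
    rw [slope_def_field, hfix]
  rw [neg_neg]
  exact hφt.hasDerivAt (disk_mem_nhds hτ)

lemma hasDerivAt_bpFactor (τ : ℂ) : HasDerivAt (bpFactor τ) (-(1 - ‖τ‖ ^ 2 : ℝ)) τ := by
  have hleft : HasDerivAt (fun z ↦ τ - z) (-1) τ := (hasDerivAt_id τ).const_sub τ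
  have hright : HasDerivAt (fun z ↦ 1 - conj τ * z) (-(conj τ * 1)) τ :=
    ((hasDerivAt_id τ).const_mul (conj τ)).const_sub 1
  refine (hleft.mul hright).congr_deriv ?_
  rw [conj_mul']
  push_cast
  ring

lemma Generates.hasSpectralValue_of_eqOn_bpFactor_mul (hφ : Generates G φ) (hτ : τ ∈ disk)
    (hh : DifferentiableOn ℂ h disk) (hG : EqOn G (fun z ↦ bpFactor τ z * h z) disk) :
    HasSpectralValue φ τ ((1 - ‖τ‖ ^ 2 : ℝ) * h τ) := by
  have hnhds := disk_mem_nhds hτ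
  have hderiv := ((hasDerivAt_bpFactor τ).mul (hh.differentiableAt hnhds).hasDerivAt
    ).congr_of_eventuallyEq (hG.eventuallyEq_of_mem hnhds)
  have h0 : G τ = 0 := by simp only [hG hτ, bpFactor_self, zero_mul]
  convert hφ.hasSpectralValue_of_hasDerivAt hτ h0 hderiv using 1
  rw [bpFactor_self]
  ring

theorem existsUnique_isSpectralValue_of_mem_Gen (hτ : τ ∈ disk) (hG : G ∈ Gen τ σ lam) :
    ∃! ω, IsSpectralValue G τ ω := by
  have h0 := apply_eq_zero_of_mem_Gen hG hτ
  obtain ⟨φ, hφ, -⟩ := hG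
  have hd := (hφ.holo.differentiableAt (disk_mem_nhds hτ)).hasDerivAt
  exact existsUnique_of_exists_of_unique
    ⟨_, φ, hφ, hφ.hasSpectralValue_of_hasDerivAt hτ h0 hd⟩ fun _ _ ↦ IsSpectralValue.unique

lemma ne_of_mem_disk (hσ : ∀ k, ‖σ k‖ = 1) (hτ : τ ∈ disk) (k : Fin n) : τ ≠ σ k :=
  fun hk ↦ (mem_disk.1 hτ).ne (hk ▸ hσ k)

lemma alpha_pos (hlam : ∀ k, lam k < 0) (hne : ∀ k, τ ≠ σ k) (k : Fin n) :
    0 < alpha τ σ lam k := by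
  have hdist := norm_pos_iff.2 (sub_ne_zero.2 (hne k))
  have habs := abs_pos.2 (hlam k).ne
  rw [alpha]
  positivity

lemma pZero_re_pos [NeZero n] (hσ : ∀ k, ‖σ k‖ = 1) (hlam : ∀ k, lam k < 0)
    (hne : ∀ k, τ ≠ σ k) (hz : z ∈ disk) : 0 < (pZero τ σ lam z).re := by
  rw [pZero_re]
  exact Finset.sum_pos (fun k _ ↦ mul_pos (alpha_pos hlam hne k) (cayley_re_pos (hσ k) hz))
    Finset.univ_nonempty

lemma add_pZero_ne_zero [NeZero n] (hσ : ∀ k, ‖σ k‖ = 1) (hlam : ∀ k, lam k < 0)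
    (hne : ∀ k, τ ≠ σ k) (ha : 0 ≤ a.re) (hz : z ∈ disk) : a + pZero τ σ lam z ≠ 0 := by
  intro hzero
  have hre := congrArg re hzero
  rw [add_re, zero_re] at hre
  exact (add_pos_of_nonneg_of_pos ha (pZero_re_pos hσ hlam hne hz)).ne' hre

lemma radius_pos [NeZero n] (hlam : ∀ k, lam k < 0) : 0 < radius lam :=
  inv_pos.2 (Finset.sum_pos (fun k _ ↦ inv_pos.2 (abs_pos.2 (hlam k).ne)) Finset.univ_nonempty)

lemma norm_sub_sq_mul_cayley {s : ℂ} (hs : ‖s‖ = 1) (hne : τ ≠ s) :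
    (‖τ - s‖ : ℂ) ^ 2 * cayley s τ = (1 - ‖τ‖ ^ 2 : ℝ) + (2 * (conj s * τ).im : ℝ) * I := by
  have hsub : s - τ ≠ 0 := sub_ne_zero.2 hne.symm
  rw [← sub_conj, norm_sub_rev, ← mul_conj', cayley, mul_comm (s - τ), mul_assoc,
    mul_div_cancel₀ _ hsub]
  push_cast
  rw [← mul_conj', map_sub, map_mul, conj_conj]
  linear_combination mul_conj_of_norm_eq_one hs

lemma pZero_self (hσ : ∀ k, ‖σ k‖ = 1) (hne : ∀ k, τ ≠ σ k) :
    pZero τ σ lam τ = ((1 - ‖τ‖ ^ 2) / (2 * radius lam) : ℝ) +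
      I * (∑ k, |lam k|⁻¹ * (conj (σ k) * τ).im : ℝ) := by
  have hterm (k : Fin n) : (alpha τ σ lam k : ℂ) * ((σ k + τ) / (σ k - τ)) =
      ((1 - ‖τ‖ ^ 2) / 2 * |lam k|⁻¹ : ℝ) + I * (|lam k|⁻¹ * (conj (σ k) * τ).im : ℝ) := by
    have hcayley := norm_sub_sq_mul_cayley (hσ k) (hne k)
    rw [cayley] at hcayley
    rw [alpha]
    push_cast at hcayley ⊢
    linear_combination (2 : ℂ)⁻¹ * (|lam k| : ℝ)⁻¹ * hcayley
  rw [pZero, Finset.sum_congr rfl fun k _ ↦ hterm k, Finset.sum_add_distrib, ← Finset.mul_sum,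
    ← ofReal_sum, ← ofReal_sum, ← Finset.mul_sum, ← div_div, radius, div_inv_eq_mul]

lemma sq_sub_norm_sub_sq (hω : ω ≠ 0) (r : ℝ) :
    r ^ 2 - ‖ω - r‖ ^ 2 = ‖ω‖ ^ 2 * (2 * r * (ω⁻¹).re - 1) := by
  have hnormSq : normSq ω ≠ 0 := normSq_eq_zero.not.2 hω
  rw [inv_re, mul_sub, ← normSq_eq_norm_sq ω, mul_div_assoc', mul_div_cancel₀ _ hnormSq]
  simp only [Complex.sq_norm, normSq_apply, sub_re, sub_im, ofReal_re, ofReal_im]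
  ring

lemma norm_sub_le_iff_one_le (hr : 0 ≤ r) (hω : ω ≠ 0) :
    ‖ω - r‖ ≤ r ↔ 1 ≤ 2 * r * (ω⁻¹).re := by
  rw [← sq_le_sq₀ (norm_nonneg _) hr, ← sub_nonneg, sq_sub_norm_sub_sq hω,
    mul_nonneg_iff_of_pos_left (by positivity), sub_nonneg]

lemma norm_sub_eq_iff_eq_one (hr : 0 ≤ r) (hω : ω ≠ 0) :
    ‖ω - r‖ = r ↔ 2 * r * (ω⁻¹).re = 1 := by
  rw [← sq_eq_sq₀ (norm_nonneg _) hr, eq_comm, ← sub_eq_zero, sq_sub_norm_sub_sq hω,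
    mul_eq_zero_iff_left (by positivity), sub_eq_zero]

/-- The spectral value at `τ ∈ 𝔻` of the generator `genWith τ σ lam a`. -/
noncomputable def spectralValueWith (τ : ℂ) (σ : Fin n → ℂ) (lam : Fin n → ℝ) (a : ℂ) : ℂ :=
  (1 - ‖τ‖ ^ 2 : ℝ) / (a + pZero τ σ lam τ)

lemma spectralValueWith_ne_zero [NeZero n] (hσ : ∀ k, ‖σ k‖ = 1) (hlam : ∀ k, lam k < 0)
    (hτ : τ ∈ disk) (ha : 0 ≤ a.re) : spectralValueWith τ σ lam a ≠ 0 :=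
  div_ne_zero (ofReal_ne_zero.2 (one_sub_norm_sq_pos hτ).ne')
    (add_pZero_ne_zero hσ hlam (ne_of_mem_disk hσ hτ) ha hτ)

lemma spectralValueWith_div_sub (hτ : τ ∈ disk) (ω : ℂ) :
    spectralValueWith τ σ lam ((1 - ‖τ‖ ^ 2 : ℝ) / ω - pZero τ σ lam τ) = ω := by
  rw [spectralValueWith, sub_add_cancel,
    div_div_cancel₀ (ofReal_ne_zero.2 (one_sub_norm_sq_pos hτ).ne')]

lemma two_mul_radius_mul_inv_spectralValueWith_re [NeZero n] (hσ : ∀ k, ‖σ k‖ = 1)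
    (hlam : ∀ k, lam k < 0) (hτ : τ ∈ disk) (a : ℂ) :
    2 * radius lam * ((spectralValueWith τ σ lam a)⁻¹).re =
      2 * radius lam * a.re / (1 - ‖τ‖ ^ 2) + 1 := by
  have hr := (radius_pos hlam).ne'
  have hd := (one_sub_norm_sq_pos hτ).ne'
  rw [spectralValueWith, inv_div, div_ofReal_re, pZero_self hσ (ne_of_mem_disk hσ hτ)]
  simp only [add_re, ofReal_re, mul_re, I_re, ofReal_im, mul_zero, zero_mul, sub_zero, add_zero]
  field_simp

end InteriorSpectralValue

section Generators

variable {G : ℂ → ℂ} {φ : ℝ → ℂ → ℂ} {n : ℕ} {σ : Fin n → ℂ} {lam : Fin n → ℝ} {a ω s : ℂ}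

lemma IsBRFPWith.of_tendsto {d : ℂ} (hs : ‖s‖ = 1)
    (hd : Tendsto (fun z ↦ (f z - s) / (z - s)) (𝓝[disk] s) (𝓝 d)) : IsBRFPWith f s d := by
  refine ⟨hs, HasAngularLimit.of_tendsto ?_, HasAngularLimit.of_tendsto hd⟩
  have hsub : Tendsto (fun z ↦ z - s) (𝓝[disk] s) (𝓝 (s - s)) :=
    (Continuous.tendsto (by fun_prop) _).mono_left nhdsWithin_le_nhds
  have hlim := (hd.mul hsub).const_add s
  rw [sub_self, mul_zero, add_zero] at hlim
  refine hlim.congr' ?_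
  filter_upwards [self_mem_nhdsWithin] with z hz
  rw [div_mul_cancel₀ _ (sub_ne_zero.2 (sub_ne_zero.1 (sub_ne_zero_of_norm_eq_one hs hz)).symm),
    add_sub_cancel]

lemma notMem_disk_of_norm_eq_one (hs : ‖s‖ = 1) : s ∉ disk := fun hmem ↦ (mem_disk.1 hmem).ne hs

lemma Generates.hasSpectralValue_of_tendsto (hφ : Generates G φ) (hs : ‖s‖ = 1)
    (hG : Tendsto (fun z ↦ G z / (z - s)) (𝓝[disk] s) (𝓝 (-ω))) : HasSpectralValue φ s ω := by
  intro t ht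
  have hsd := notMem_disk_of_norm_eq_one hs
  have hsdiff : disk \ {s} = disk := sdiff_singleton_eq_self hsd
  have hlim := hφ.isFlow.tendsto_div_of_tendsto (p := s) (fun hmem ↦ absurd hmem hsd)
    (by rwa [hsdiff]) ht
  rw [hsdiff] at hlim
  exact Or.inr (IsBRFPWith.of_tendsto hs hlim)

lemma Generates.exists_not_eqOn_id (hφ : Generates G φ) (hz : z ∈ disk) (hGz : G z ≠ 0) :
    ∃ t, 0 ≤ t ∧ ¬ EqOn (φ t) id disk := by
  by_contra! hid
  exact hGz (hφ.eq_zero hz fun t ht ↦ hid t ht hz)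

lemma exists_generates_zero : ∃ φ, Generates 0 φ := by
  have hzero : IsCaratheodory 0 := ⟨differentiableOn_const 0, fun _ _ ↦ le_rfl⟩
  obtain ⟨φ, hφ⟩ := hzero.exists_generates (τ := 0) (by simp)
  refine ⟨φ, ?_⟩
  convert hφ using 1
  ext z
  simp

lemma zero_mem_Gen (hσ : ∀ k, ‖σ k‖ = 1) (hlam : ∀ k, lam k < 0) (τ : ℂ) :
    0 ∈ Gen τ σ lam := by
  obtain ⟨φ, hφ⟩ := exists_generates_zero
  refine ⟨φ, hφ, Or.inl fun _ _ ↦ rfl, fun k ↦ ⟨hσ k, 0, (hlam k).le, le_rfl, ?_⟩⟩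
  exact hφ.hasSpectralValue_of_tendsto (hσ k) (by simpa using tendsto_const_nhds)

lemma isSpectralValue_zero (hτ : τ ∈ disk) : IsSpectralValue 0 τ 0 := by
  obtain ⟨φ, hφ⟩ := exists_generates_zero
  have hs := hφ.hasSpectralValue_of_hasDerivAt hτ rfl (hasDerivAt_const τ 0)
  rw [neg_zero] at hs
  exact ⟨φ, hφ, hs⟩

lemma IsCaratheodory.inv (hh : IsCaratheodory h) (h0 : ∀ z ∈ disk, h z ≠ 0) :
    IsCaratheodory h⁻¹ := by
  refine ⟨hh.holo.inv h0, fun z hz ↦ ?_⟩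
  rw [Pi.inv_apply, inv_re]
  exact div_nonneg (hh.re_nonneg z hz) (normSq_nonneg _)

lemma isCaratheodory_inv_add_pZero [NeZero n] (hσ : ∀ k, ‖σ k‖ = 1) (hlam : ∀ k, lam k < 0)
    (hne : ∀ k, τ ≠ σ k) (ha : 0 ≤ a.re) :
    IsCaratheodory (fun z ↦ (a + pZero τ σ lam z)⁻¹) := by
  refine IsCaratheodory.inv (h := fun z ↦ a + pZero τ σ lam z)
    ⟨(differentiableOn_pZero hσ).const_add a, fun z hz ↦ ?_⟩
    fun z hz ↦ add_pZero_ne_zero hσ hlam hne ha hz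
  rw [add_re]
  exact add_nonneg ha (pZero_re_pos hσ hlam hne hz).le

lemma exists_generates_genWith [NeZero n] (hσ : ∀ k, ‖σ k‖ = 1) (hlam : ∀ k, lam k < 0)
    (hτ : ‖τ‖ ≤ 1) (hne : ∀ k, τ ≠ σ k) (ha : 0 ≤ a.re) :
    ∃ φ, Generates (genWith τ σ lam a) φ :=
  (isCaratheodory_inv_add_pZero hσ hlam hne ha).exists_generates hτ

lemma tendsto_sub_mul_cayley (s u : ℂ) :
    Tendsto (fun z ↦ (z - s) * cayley u z) (𝓝[disk \ {s}] s)
      (𝓝 (if u = s then -(2 * s) else 0)) := by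
  obtain rfl | hne := eq_or_ne u s
  · have hlim : Tendsto (fun z ↦ -(u + z)) (𝓝[disk \ {u}] u) (𝓝 (-(u + u))) :=
      (Continuous.tendsto (by fun_prop) _).mono_left nhdsWithin_le_nhds
    rw [if_pos rfl, two_mul]
    refine hlim.congr' ?_
    filter_upwards [self_mem_nhdsWithin] with z hz
    rw [cayley, ← neg_sub u z, neg_mul, mul_div_cancel₀ _ (sub_ne_zero.2 (Ne.symm hz.2))]
  · have hcont : ContinuousAt (fun z ↦ (z - s) * cayley u z) s :=
      (continuousAt_id.sub continuousAt_const).mul (continuousAt_cayley hne)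
    have hlim := hcont.tendsto
    rw [sub_self, zero_mul] at hlim
    rw [if_neg hne]
    exact hlim.mono_left nhdsWithin_le_nhds

lemma tendsto_sub_mul_add_pZero (hσ : ∀ k, ‖σ k‖ = 1) (hinj : Function.Injective σ)
    (τ : ℂ) (lam : Fin n → ℝ) (a : ℂ) (k : Fin n) :
    Tendsto (fun z ↦ (z - σ k) * (a + pZero τ σ lam z)) (𝓝[disk] σ k)
      (𝓝 (alpha τ σ lam k * -(2 * σ k))) := by
  have hsdiff : disk \ {σ k} = disk := sdiff_singleton_eq_self (notMem_disk_of_norm_eq_one (hσ k))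
  have hsub : Tendsto (fun z ↦ (z - σ k) * a) (𝓝[disk] σ k) (𝓝 ((σ k - σ k) * a)) :=
    (Continuous.tendsto (by fun_prop) _).mono_left nhdsWithin_le_nhds
  have hsum := tendsto_finsetSum Finset.univ fun j _ ↦
    (tendsto_sub_mul_cayley (σ k) (σ j)).const_mul (alpha τ σ lam j : ℂ)
  simp only [hinj.eq_iff, mul_ite, mul_zero, Finset.sum_ite_eq', Finset.mem_univ, if_true,
    hsdiff] at hsum
  have hlim := hsub.add hsum
  rw [sub_self, zero_mul, zero_add] at hlim
  refine hlim.congr fun z ↦ ?_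
  rw [mul_add, pZero, Finset.mul_sum]
  simp only [cayley, mul_left_comm]

lemma tendsto_genWith_div (hσ : ∀ k, ‖σ k‖ = 1) (hinj : Function.Injective σ)
    (hlam : ∀ k, lam k < 0) (hne : ∀ k, τ ≠ σ k) (a : ℂ) (k : Fin n) :
    Tendsto (fun z ↦ genWith τ σ lam a z / (z - σ k)) (𝓝[disk] σ k) (𝓝 (-(lam k : ℂ))) := by
  have hα : (alpha τ σ lam k : ℂ) ≠ 0 := ofReal_ne_zero.2 (alpha_pos hlam hne k).ne'
  have hσ0 : σ k ≠ 0 := norm_ne_zero_iff.1 (by rw [hσ k]; exact one_ne_zero)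
  have hfactor := ((differentiable_bpFactor τ).continuous.tendsto (σ k)).mono_left
    (nhdsWithin_le_nhds (s := disk))
  have hlim := hfactor.div (tendsto_sub_mul_add_pZero hσ hinj τ lam a k)
    (mul_ne_zero hα (neg_ne_zero.2 (mul_ne_zero two_ne_zero hσ0)))
  have hval : bpFactor τ (σ k) / (alpha τ σ lam k * -(2 * σ k)) = -(lam k : ℂ) := by
    have hdist : ((‖σ k - τ‖ ^ 2 : ℝ) : ℂ) = alpha τ σ lam k * (2 * -lam k) := by
      have hlam0 := (hlam k).ne
      rw [alpha, abs_of_neg (hlam k), norm_sub_rev]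
      norm_cast
      field_simp
    rw [div_eq_iff (mul_ne_zero hα (neg_ne_zero.2 (mul_ne_zero two_ne_zero hσ0))), bpFactor]
    linear_combination -sub_mul_one_sub_conj_mul (hσ k) τ - σ k * hdist
  rw [hval] at hlim
  refine hlim.congr fun z ↦ ?_
  rw [Pi.div_apply, genWith, div_div, mul_comm (z - σ k)]

lemma genWith_mem_Gen (hσ : ∀ k, ‖σ k‖ = 1) (hinj : Function.Injective σ)
    (hlam : ∀ k, lam k < 0) (hne : ∀ k, τ ≠ σ k) (hφ : Generates (genWith τ σ lam a) φ)
    (hτ : IsDWPointOf φ τ) : genWith τ σ lam a ∈ Gen τ σ lam :=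
  ⟨φ, hφ, Or.inr hτ, fun k ↦ ⟨hσ k, lam k, le_rfl, (hlam k).le,
    hφ.hasSpectralValue_of_tendsto (hσ k) (tendsto_genWith_div hσ hinj hlam hne a k)⟩⟩

lemma exists_mem_disk_ne (τ : ℂ) : ∃ z ∈ disk, z ≠ τ := by
  obtain hτ | hτ := eq_or_ne τ 0
  · exact ⟨1 / 2, by rw [mem_disk]; norm_num, by rw [hτ]; norm_num⟩
  · exact ⟨0, zero_mem_disk, hτ.symm⟩

lemma Generates.exists_genWith_not_eqOn_id [NeZero n] (hσ : ∀ k, ‖σ k‖ = 1)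
    (hlam : ∀ k, lam k < 0) (hτ : ‖τ‖ ≤ 1) (hne : ∀ k, τ ≠ σ k) (ha : 0 ≤ a.re)
    (hφ : Generates (genWith τ σ lam a) φ) : ∃ t, 0 ≤ t ∧ ¬ EqOn (φ t) id disk := by
  obtain ⟨z, hz, hzτ⟩ := exists_mem_disk_ne τ
  exact hφ.exists_not_eqOn_id hz
    (div_ne_zero (bpFactor_ne_zero hτ hz hzτ) (add_pZero_ne_zero hσ hlam hne ha hz))

theorem genWith_mem_Gen_of_mem_disk [NeZero n] (hσ : ∀ k, ‖σ k‖ = 1) (hinj : Function.Injective σ)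
    (hlam : ∀ k, lam k < 0) (hτ : τ ∈ disk) (ha : 0 ≤ a.re) : genWith τ σ lam a ∈ Gen τ σ lam := by
  have hne := ne_of_mem_disk hσ hτ
  have hτ' := (mem_disk.1 hτ).le
  obtain ⟨φ, hφ⟩ := exists_generates_genWith hσ hlam hτ' hne ha
  have h0 : genWith τ σ lam a τ = 0 := by rw [genWith, bpFactor_self, zero_div]
  exact genWith_mem_Gen hσ hinj hlam hne hφ
    ⟨hφ.exists_genWith_not_eqOn_id hσ hlam hτ' hne ha,
      fun t ht hid ↦ ⟨hid, Or.inl ⟨hτ, hφ.apply_eq_self hτ h0 ht⟩⟩⟩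

theorem isSpectralValue_genWith [NeZero n] (hσ : ∀ k, ‖σ k‖ = 1) (hlam : ∀ k, lam k < 0)
    (hτ : τ ∈ disk) (ha : 0 ≤ a.re) :
    IsSpectralValue (genWith τ σ lam a) τ (spectralValueWith τ σ lam a) := by
  have hne := ne_of_mem_disk hσ hτ
  obtain ⟨φ, hφ⟩ := exists_generates_genWith hσ hlam (mem_disk.1 hτ).le hne ha
  have hs := hφ.hasSpectralValue_of_eqOn_bpFactor_mul hτ
    (isCaratheodory_inv_add_pZero hσ hlam hne ha).holo fun _ _ ↦ div_eq_mul_inv _ _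
  rw [← div_eq_mul_inv] at hs
  exact ⟨φ, hφ, hs⟩

end Generators

section InteriorRange

variable {G : ℂ → ℂ} {n : ℕ} {σ : Fin n → ℂ} {lam : Fin n → ℝ} {a ζ ω : ℂ} {r : ℝ}

lemma norm_spectralValueWith_sub_le_iff [NeZero n] (hσ : ∀ k, ‖σ k‖ = 1) (hlam : ∀ k, lam k < 0)
    (hτ : τ ∈ disk) (h0 : spectralValueWith τ σ lam a ≠ 0) :
    ‖spectralValueWith τ σ lam a - radius lam‖ ≤ radius lam ↔ 0 ≤ a.re := by
  have hr := radius_pos hlam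
  rw [norm_sub_le_iff_one_le hr.le h0,
    two_mul_radius_mul_inv_spectralValueWith_re hσ hlam hτ, le_add_iff_nonneg_left,
    le_div_iff₀ (one_sub_norm_sq_pos hτ), zero_mul, mul_nonneg_iff_of_pos_left (by positivity)]

lemma norm_spectralValueWith_sub_eq_iff [NeZero n] (hσ : ∀ k, ‖σ k‖ = 1) (hlam : ∀ k, lam k < 0)
    (hτ : τ ∈ disk) (h0 : spectralValueWith τ σ lam a ≠ 0) :
    ‖spectralValueWith τ σ lam a - radius lam‖ = radius lam ↔ a.re = 0 := by
  have hr := radius_pos hlam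
  rw [norm_sub_eq_iff_eq_one hr.le h0, two_mul_radius_mul_inv_spectralValueWith_re hσ hlam hτ,
    add_eq_right, div_eq_zero_iff, or_iff_left (one_sub_norm_sq_pos hτ).ne',
    mul_eq_zero_iff_left (by positivity)]

lemma div_spectralValueWith_sub (hτ : τ ∈ disk) (a : ℂ) :
    (1 - ‖τ‖ ^ 2 : ℝ) / spectralValueWith τ σ lam a - pZero τ σ lam τ = a := by
  rw [spectralValueWith, div_div_cancel₀ (ofReal_ne_zero.2 (one_sub_norm_sq_pos hτ).ne'),
    add_sub_cancel_right]

open Classical in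
/-- The element of `Gen τ σ lam`, `τ ∈ 𝔻`, with spectral value `ω` at `τ` which is used to realize
the points `ω` of the disk `|ω - r| ≤ r`. For `ω ≠ 0` the parameter of `genWith` is the solution `a`
of `spectralValueWith τ σ lam a = ω`. -/
noncomputable def genOfSpectralValue (τ : ℂ) (σ : Fin n → ℂ) (lam : Fin n → ℝ) (ω : ℂ) : ℂ → ℂ :=
  if ω = 0 then 0 else genWith τ σ lam ((1 - ‖τ‖ ^ 2 : ℝ) / ω - pZero τ σ lam τ)

lemma genOfSpectralValue_zero : genOfSpectralValue τ σ lam 0 = 0 := if_pos rfl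

lemma genOfSpectralValue_spectralValueWith [NeZero n] (hσ : ∀ k, ‖σ k‖ = 1)
    (hlam : ∀ k, lam k < 0) (hτ : τ ∈ disk) (ha : 0 ≤ a.re) :
    genOfSpectralValue τ σ lam (spectralValueWith τ σ lam a) = genWith τ σ lam a := by
  rw [genOfSpectralValue, if_neg (spectralValueWith_ne_zero hσ hlam hτ ha),
    div_spectralValueWith_sub hτ]

lemma genOfSpectralValue_mem_Gen [NeZero n] (hσ : ∀ k, ‖σ k‖ = 1) (hinj : Function.Injective σ)
    (hlam : ∀ k, lam k < 0) (hτ : τ ∈ disk) (hω : ‖ω - radius lam‖ ≤ radius lam) :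
    genOfSpectralValue τ σ lam ω ∈ Gen τ σ lam ∧
      IsSpectralValue (genOfSpectralValue τ σ lam ω) τ ω := by
  obtain rfl | hω0 := eq_or_ne ω 0
  · rw [genOfSpectralValue_zero]
    exact ⟨zero_mem_Gen hσ hlam τ, isSpectralValue_zero hτ⟩
  obtain ⟨a, rfl⟩ : ∃ a, spectralValueWith τ σ lam a = ω := ⟨_, spectralValueWith_div_sub hτ ω⟩
  have ha := (norm_spectralValueWith_sub_le_iff hσ hlam hτ hω0).1 hω
  rw [genOfSpectralValue_spectralValueWith hσ hlam hτ ha]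
  exact ⟨genWith_mem_Gen_of_mem_disk hσ hinj hlam hτ ha, isSpectralValue_genWith hσ hlam hτ ha⟩

lemma IsSpectralValue.eq_of_eqOn_bpFactor_mul (hs : IsSpectralValue G τ ω) (hτ : τ ∈ disk)
    (hh : DifferentiableOn ℂ h disk) (hG : EqOn G (fun z ↦ bpFactor τ z * h z) disk) :
    ω = (1 - ‖τ‖ ^ 2 : ℝ) * h τ := by
  have ⟨φ, hφ, _⟩ := hs
  exact hs.unique ⟨φ, hφ, hφ.hasSpectralValue_of_eqOn_bpFactor_mul hτ hh hG⟩

lemma eqOn_zero_or_exists_of_isSpectralValue [NeZero n] (hσ : ∀ k, ‖σ k‖ = 1)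
    (hinj : Function.Injective σ) (hlam : ∀ k, lam k < 0) (hτ : τ ∈ disk)
    (hG : G ∈ Gen τ σ lam) (hs : IsSpectralValue G τ ω) :
    ω = 0 ∧ EqOn G 0 disk ∨ ∃ h, IsCaratheodory h ∧
      EqOn G (fun z ↦ genWith τ σ lam (h z) z) disk ∧ ω = spectralValueWith τ σ lam (h τ) := by
  have hne := ne_of_mem_disk hσ hτ
  obtain hzero | ⟨h, hh, hGh⟩ :=
    exists_isCaratheodory_of_mem_Gen hσ hinj hne (mem_disk.1 hτ).le hG
  · have hω := hs.eq_of_eqOn_bpFactor_mul (h := 0) hτ (differentiableOn_const 0)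
      (by simpa [EqOn] using hzero)
    exact Or.inl ⟨by simpa using hω, hzero⟩
  · have hinv : DifferentiableOn ℂ (fun z ↦ (h z + pZero τ σ lam z)⁻¹) disk :=
      (hh.holo.add (differentiableOn_pZero hσ)).inv fun z hz ↦
        add_pZero_ne_zero hσ hlam hne (hh.re_nonneg z hz) hz
    refine Or.inr ⟨h, hh, hGh, ?_⟩
    rw [spectralValueWith, div_eq_mul_inv]
    exact hs.eq_of_eqOn_bpFactor_mul hτ hinv fun z hz ↦
      (hGh hz).trans (div_eq_mul_inv _ _)

lemma norm_zero_sub_radius [NeZero n] (hlam : ∀ k, lam k < 0) :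
    ‖(0 : ℂ) - radius lam‖ = radius lam := by
  rw [zero_sub, norm_neg, Complex.norm_of_nonneg (radius_pos hlam).le]

theorem norm_sub_radius_le_of_isSpectralValue [NeZero n] (hσ : ∀ k, ‖σ k‖ = 1)
    (hinj : Function.Injective σ) (hlam : ∀ k, lam k < 0) (hτ : τ ∈ disk)
    (hG : G ∈ Gen τ σ lam) (hs : IsSpectralValue G τ ω) : ‖ω - radius lam‖ ≤ radius lam := by
  obtain ⟨rfl, -⟩ | ⟨h, hh, -, rfl⟩ :=
    eqOn_zero_or_exists_of_isSpectralValue hσ hinj hlam hτ hG hs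
  · exact (norm_zero_sub_radius hlam).le
  · have hre := hh.re_nonneg τ hτ
    exact (norm_spectralValueWith_sub_le_iff hσ hlam hτ
      (spectralValueWith_ne_zero hσ hlam hτ hre)).2 hre

theorem eqOn_genOfSpectralValue [NeZero n] (hσ : ∀ k, ‖σ k‖ = 1)
    (hinj : Function.Injective σ) (hlam : ∀ k, lam k < 0) (hτ : τ ∈ disk)
    (hω : ‖ω - radius lam‖ = radius lam) (hG : G ∈ Gen τ σ lam) (hs : IsSpectralValue G τ ω) :
    EqOn G (genOfSpectralValue τ σ lam ω) disk := by
  obtain ⟨rfl, hzero⟩ | ⟨h, hh, hGh, rfl⟩ :=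
    eqOn_zero_or_exists_of_isSpectralValue hσ hinj hlam hτ hG hs
  · rwa [genOfSpectralValue_zero]
  · have hre := hh.re_nonneg τ hτ
    have hre0 := (norm_spectralValueWith_sub_eq_iff hσ hlam hτ
      (spectralValueWith_ne_zero hσ hlam hτ hre)).1 hω
    intro z hz
    rw [genOfSpectralValue_spectralValueWith hσ hlam hτ hre, hGh hz]
    simp only [hh.eqOn_const_of_re_eq_zero hτ hre0 hz]

theorem setOf_isSpectralValue [NeZero n] (hσ : ∀ k, ‖σ k‖ = 1) (hinj : Function.Injective σ)
    (hlam : ∀ k, lam k < 0) (hτ : τ ∈ disk) :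
    {ω : ℂ | ∃ G ∈ Gen τ σ lam, IsSpectralValue G τ ω} =
      {ω : ℂ | ‖ω - (radius lam : ℂ)‖ ≤ radius lam} := by
  ext ω
  refine ⟨?_, fun hω ↦ ⟨_, genOfSpectralValue_mem_Gen hσ hinj hlam hτ hω⟩⟩
  rintro ⟨G, hG, hs⟩
  exact norm_sub_radius_le_of_isSpectralValue hσ hinj hlam hτ hG hs

lemma re_le_two_mul_of_norm_sub_le (hω : ‖ω - r‖ ≤ r) : ω.re ≤ 2 * r := by
  have hre := (re_le_norm _).trans hω
  rw [sub_re, ofReal_re] at hre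
  linarith

lemma eq_two_mul_of_norm_sub_le (hω : ‖ω - r‖ ≤ r) (hre : ω.re = 2 * r) :
    ω = (2 * r : ℝ) := by
  have hsub : (ω - r).re = r := by
    rw [sub_re, ofReal_re, hre]
    ring
  have him : (ω - r).im = 0 :=
    abs_re_eq_norm.1 ((abs_re_le_norm _).antisymm (hω.trans (hsub.ge.trans (le_abs_self _))))
  rw [sub_im, ofReal_im, sub_zero] at him
  exact Complex.ext hre him

lemma norm_two_mul_radius_sub [NeZero n] (hlam : ∀ k, lam k < 0) :
    ‖((2 * radius lam : ℝ) : ℂ) - radius lam‖ = radius lam := by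
  rw [← ofReal_sub, two_mul, add_sub_cancel_right, Complex.norm_of_nonneg (radius_pos hlam).le]

lemma GMax_eq_genWith (hσ : ∀ k, ‖σ k‖ = 1) (hne : ∀ k, τ ≠ σ k) : GMax τ σ lam =
    genWith τ σ lam ((1 - ‖τ‖ ^ 2 : ℝ) / (2 * radius lam : ℝ) - pZero τ σ lam τ) := by
  funext z
  rw [GMax, genWith, bpFactor, pZero_self hσ hne, ofReal_div, sub_add_cancel_left, neg_add_eq_sub]

lemma GMax_eq_genOfSpectralValue [NeZero n] (hσ : ∀ k, ‖σ k‖ = 1) (hlam : ∀ k, lam k < 0)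
    (hne : ∀ k, τ ≠ σ k) :
    GMax τ σ lam = genOfSpectralValue τ σ lam (2 * radius lam : ℝ) := by
  have hr := radius_pos hlam
  rw [genOfSpectralValue, if_neg (ofReal_ne_zero.2 (by positivity)), GMax_eq_genWith hσ hne]

theorem GMax_mem_Gen_of_mem_disk [NeZero n] (hσ : ∀ k, ‖σ k‖ = 1) (hinj : Function.Injective σ)
    (hlam : ∀ k, lam k < 0) (hτ : τ ∈ disk) :
    GMax τ σ lam ∈ Gen τ σ lam ∧ IsSpectralValue (GMax τ σ lam) τ (2 * radius lam : ℝ) := by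
  rw [GMax_eq_genOfSpectralValue hσ hlam (ne_of_mem_disk hσ hτ)]
  exact genOfSpectralValue_mem_Gen hσ hinj hlam hτ (norm_two_mul_radius_sub hlam).le

theorem IsSpectralValue.re_le_two_mul_radius [NeZero n] (hσ : ∀ k, ‖σ k‖ = 1)
    (hinj : Function.Injective σ) (hlam : ∀ k, lam k < 0) (hτ : τ ∈ disk) (hG : G ∈ Gen τ σ lam)
    (hs : IsSpectralValue G τ ω) : ω.re ≤ 2 * radius lam :=
  re_le_two_mul_of_norm_sub_le (norm_sub_radius_le_of_isSpectralValue hσ hinj hlam hτ hG hs)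

theorem IsSpectralValue.eqOn_GMax_of_re_eq [NeZero n] (hσ : ∀ k, ‖σ k‖ = 1)
    (hinj : Function.Injective σ) (hlam : ∀ k, lam k < 0) (hτ : τ ∈ disk) (hG : G ∈ Gen τ σ lam)
    (hs : IsSpectralValue G τ ω) (hre : ω.re = 2 * radius lam) : EqOn G (GMax τ σ lam) disk := by
  have hω := norm_sub_radius_le_of_isSpectralValue hσ hinj hlam hτ hG hs
  rw [eq_two_mul_of_norm_sub_le hω hre] at hs
  rw [GMax_eq_genOfSpectralValue hσ hlam (ne_of_mem_disk hσ hτ)]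
  exact eqOn_genOfSpectralValue hσ hinj hlam hτ (norm_two_mul_radius_sub hlam) hG hs

lemma genOf_im_eq_genWith (ha : a.re = 0) : genOf τ σ lam a.im = genWith τ σ lam a := by
  have haI : I * a.im = a := by
    rw [mul_comm]
    simpa [ha] using re_add_im a
  funext z
  rw [genOf, haI, genWith, bpFactor]

lemma GHat_eq_genOfSpectralValue [NeZero n] (hσ : ∀ k, ‖σ k‖ = 1) (hlam : ∀ k, lam k < 0)
    (hω : ‖ω - radius lam‖ = radius lam) :
    GHat σ lam ω = genOfSpectralValue 0 σ lam ω := by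
  obtain rfl | hω0 := eq_or_ne ω 0
  · rw [genOfSpectralValue_zero, GHat, if_pos rfl]
  obtain ⟨a, rfl⟩ : ∃ a, spectralValueWith 0 σ lam a = ω :=
    ⟨_, spectralValueWith_div_sub zero_mem_disk ω⟩
  have ha := (norm_spectralValueWith_sub_eq_iff hσ hlam zero_mem_disk hω0).1 hω
  have hp : pZero 0 σ lam 0 = (1 / 2 : ℂ) * ∑ k, ((|lam k|⁻¹ : ℝ) : ℂ) := by
    rw [pZero_self hσ (ne_of_mem_disk hσ zero_mem_disk), radius, ← ofReal_sum]
    simp [div_eq_mul_inv, mul_comm]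
  have hdiv := div_spectralValueWith_sub (σ := σ) (lam := lam) zero_mem_disk a
  rw [norm_zero, zero_pow two_ne_zero, sub_zero, ofReal_one, hp] at hdiv
  rw [genOfSpectralValue_spectralValueWith hσ hlam zero_mem_disk ha.ge, ← genOf_im_eq_genWith ha,
    GHat, if_neg hω0, hdiv]
  funext z
  simp only [genOf, zero_sub, map_zero, zero_mul, sub_zero, mul_one]

lemma sum_alpha_pos [NeZero n] (hlam : ∀ k, lam k < 0) (hne : ∀ k, τ ≠ σ k) :
    0 < ∑ k, alpha τ σ lam k :=
  Finset.sum_pos (fun k _ ↦ alpha_pos hlam hne k) Finset.univ_nonempty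

lemma mem_frontier_Z [NeZero n] (hlam : ∀ k, lam k < 0) (hne : ∀ k, τ ≠ σ k) (hτ0 : τ ≠ 0) :
    ζ ∈ frontier (Z τ σ lam) ↔ ‖(2 * τ⁻¹ * ∑ k, (alpha τ σ lam k : ℂ)) * ζ - 1‖ = 1 := by
  have hA := (sum_alpha_pos hlam hne).ne'
  have hc : 2 * τ⁻¹ * ∑ k, (alpha τ σ lam k : ℂ) ≠ 0 := by
    rw [← ofReal_sum]
    exact mul_ne_zero (mul_ne_zero two_ne_zero (inv_ne_zero hτ0)) (ofReal_ne_zero.2 hA)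
  have hZ : Z τ σ lam = Homeomorph.mulLeft₀ _ hc ⁻¹' Metric.closedBall (1 : ℂ) 1 := by
    ext ζ
    simp [Z, dist_eq_norm]
  rw [hZ, ← Homeomorph.preimage_frontier, frontier_closedBall _ one_ne_zero, mem_preimage,
    mem_sphere_iff_norm, Homeomorph.coe_mulLeft₀]

lemma mem_frontier_Z_iff_ell_re [NeZero n] (hlam : ∀ k, lam k < 0) (hne : ∀ k, τ ≠ σ k)
    (hτ0 : τ ≠ 0) (hζ : ζ ≠ 0) : ζ ∈ frontier (Z τ σ lam) ↔ (ell τ σ lam ζ).re = 0 := by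
  have hA := (sum_alpha_pos hlam hne).ne'
  rw [mem_frontier_Z hlam hne hτ0, ell, ← ofReal_sum, sub_re, ofReal_re, sub_eq_zero]
  set A := ∑ k, alpha τ σ lam k
  have hη : 2 * τ⁻¹ * (A : ℂ) * ζ ≠ 0 :=
    mul_ne_zero (mul_ne_zero (mul_ne_zero two_ne_zero (inv_ne_zero hτ0)) (ofReal_ne_zero.2 hA)) hζ
  have hinv : (2 * τ⁻¹ * (A : ℂ) * ζ)⁻¹ = τ / ζ / (2 * A : ℝ) := by
    push_cast
    field_simp
  rw [← ofReal_one, norm_sub_eq_iff_eq_one zero_le_one hη, hinv, div_ofReal_re]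
  field_simp

lemma GZeta_eq_genWith [NeZero n] (hlam : ∀ k, lam k < 0) (hne : ∀ k, τ ≠ σ k)
    (hτ0 : τ ≠ 0) (hζ0 : ζ ≠ 0) (hζ : ζ ∈ frontier (Z τ σ lam)) :
    GZeta τ σ lam ζ = genWith τ σ lam (ell τ σ lam ζ) := by
  rw [GZeta, if_neg hζ0, genOf_im_eq_genWith ((mem_frontier_Z_iff_ell_re hlam hne hτ0 hζ0).1 hζ)]

lemma exists_GZeta_eq_genOfSpectralValue [NeZero n] (hσ : ∀ k, ‖σ k‖ = 1)
    (hlam : ∀ k, lam k < 0) (hτ : τ ∈ disk) (hτ0 : τ ≠ 0) (hω : ‖ω - radius lam‖ = radius lam) :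
    ∃ ζ ∈ frontier (Z τ σ lam), GZeta τ σ lam ζ = genOfSpectralValue τ σ lam ω := by
  have hne := ne_of_mem_disk hσ hτ
  obtain rfl | hω0 := eq_or_ne ω 0
  · refine ⟨0, (mem_frontier_Z hlam hne hτ0).2 ?_, ?_⟩
    · rw [mul_zero, zero_sub, norm_neg, norm_one]
    · rw [genOfSpectralValue_zero, GZeta, if_pos rfl]
  obtain ⟨a, rfl⟩ : ∃ a, spectralValueWith τ σ lam a = ω := ⟨_, spectralValueWith_div_sub hτ ω⟩
  have ha := (norm_spectralValueWith_sub_eq_iff hσ hlam hτ hω0).1 hω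
  set A := ∑ k, (alpha τ σ lam k : ℂ) with hA
  have hdenom : a + A ≠ 0 := by
    intro hzero
    have hre := congrArg re hzero
    rw [add_re, ha, zero_add, hA, ← ofReal_sum, ofReal_re] at hre
    exact (sum_alpha_pos hlam hne).ne' hre
  have hζ0 : τ / (a + A) ≠ 0 := div_ne_zero hτ0 hdenom
  have hell : ell τ σ lam (τ / (a + A)) = a := by
    rw [ell, div_div_cancel₀ hτ0, add_sub_cancel_right]
  have hζ := (mem_frontier_Z_iff_ell_re hlam hne hτ0 hζ0).2 (by rw [hell, ha])
  exact ⟨_, hζ, by rw [GZeta_eq_genWith hlam hne hτ0 hζ0 hζ, hell,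
    genOfSpectralValue_spectralValueWith hσ hlam hτ ha.ge]⟩

lemma exists_genOfSpectralValue_eq_GZeta [NeZero n] (hσ : ∀ k, ‖σ k‖ = 1)
    (hlam : ∀ k, lam k < 0) (hτ : τ ∈ disk) (hτ0 : τ ≠ 0) (hζ : ζ ∈ frontier (Z τ σ lam)) :
    ∃ ω : ℂ, ‖ω - radius lam‖ = radius lam ∧
      genOfSpectralValue τ σ lam ω = GZeta τ σ lam ζ := by
  have hne := ne_of_mem_disk hσ hτ
  obtain rfl | hζ0 := eq_or_ne ζ 0
  · exact ⟨0, norm_zero_sub_radius hlam, by rw [genOfSpectralValue_zero, GZeta, if_pos rfl]⟩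
  have hell := (mem_frontier_Z_iff_ell_re hlam hne hτ0 hζ0).1 hζ
  refine ⟨spectralValueWith τ σ lam (ell τ σ lam ζ), ?_, ?_⟩
  · exact (norm_spectralValueWith_sub_eq_iff hσ hlam hτ
      (spectralValueWith_ne_zero hσ hlam hτ hell.ge)).2 hell
  · rw [genOfSpectralValue_spectralValueWith hσ hlam hτ hell.ge,
      GZeta_eq_genWith hlam hne hτ0 hζ0 hζ]

end InteriorRange

section BoundaryDynamics

variable {G q : ℂ → ℂ} {φ : ℝ → ℂ → ℂ} {t : ℝ}

lemma IsFlow.hasDerivWithinAt_cayley (hφ : IsFlow G φ) (hτ : ‖τ‖ = 1)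
    (hG : ∀ z ∈ disk, G z = bpFactor τ z * q z) (hz : z ∈ disk) (ht : 0 ≤ t) :
    HasDerivWithinAt (fun t ↦ cayley τ (φ t z)) (2 * q (φ t z)) (Ici 0) t := by
  obtain ⟨hmem, hderiv⟩ := (hφ z hz).2 t ht
  have hne := sub_ne_zero_of_norm_eq_one hτ hmem
  refine ((hderiv.const_add τ).div (hderiv.const_sub τ) hne).congr_deriv ?_
  rw [hG _ hmem, bpFactor, div_eq_iff (pow_ne_zero 2 hne)]
  linear_combination -(2 * (τ - φ t z) * q (φ t z) * φ t z) * mul_conj_of_norm_eq_one hτ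

lemma IsFlow.hasDerivWithinAt_cayley_re (hφ : IsFlow G φ) (hτ : ‖τ‖ = 1)
    (hG : ∀ z ∈ disk, G z = bpFactor τ z * q z) (hz : z ∈ disk) (ht : 0 ≤ t) :
    HasDerivWithinAt (fun t ↦ (cayley τ (φ t z)).re) (2 * (q (φ t z)).re) (Ici 0) t := by
  refine (reCLM.hasFDerivAt.comp_hasDerivWithinAt t
    (hφ.hasDerivWithinAt_cayley hτ hG hz ht)).congr_deriv ?_
  simp

lemma IsFlow.apply_ne_self (hφ : IsFlow G φ) (hτ : ‖τ‖ = 1)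
    (hG : ∀ z ∈ disk, G z = bpFactor τ z * q z) (hq : ∀ z ∈ disk, 0 < (q z).re) (hz : z ∈ disk)
    (ht : 0 < t) : φ t z ≠ z := by
  have hmono : StrictMonoOn (fun t ↦ (cayley τ (φ t z)).re) (Ici 0) := by
    refine strictMonoOn_of_hasDerivWithinAt_pos (convex_Ici 0)
      (fun s hs ↦ (hφ.hasDerivWithinAt_cayley_re hτ hG hz hs).continuousWithinAt)
      (fun s hs ↦ (hφ.hasDerivWithinAt_cayley_re hτ hG hz (interior_subset hs)).mono
        interior_subset) fun s hs ↦ ?_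
    exact mul_pos two_pos (hq _ ((hφ z hz).2 s (interior_subset hs)).1)
  have hlt := hmono self_mem_Ici ht.le ht
  simp only [(hφ z hz).1] at hlt
  exact fun hfix ↦ hlt.ne' (by rw [hfix])

/-- The infinitesimal form of Julia's lemma at `τ`. -/
lemma Generates.mul_cayley_re_le (hφ : Generates G φ) (hτ : ‖τ‖ = 1)
    (hG : ∀ z ∈ disk, G z = bpFactor τ z * q z) {l : ℝ} (hl : HasSpectralValue φ τ l)
    (hz : z ∈ disk) : l * (cayley τ z).re ≤ 2 * (q z).re := by
  have hslope := (hφ.isFlow.hasDerivWithinAt_cayley_re hτ hG hz le_rfl).mono Ioi_subset_Ici_self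
  rw [hasDerivWithinAt_iff_tendsto_slope' self_notMem_Ioi] at hslope
  simp only [(hφ.isFlow z hz).1] at hslope
  refine le_of_tendsto_of_tendsto ((tendsto_exp_mul_sub_one_div l).mul_const _) hslope ?_
  filter_upwards [self_mem_nhdsWithin] with t ht
  have hjulia := ((hl.isBRFPWith hτ (mem_Ioi.1 ht).le).julia (hφ.semigroup.holo t (mem_Ioi.1 ht).le)
    (hφ.semigroup.mapsTo t (mem_Ioi.1 ht).le)).2 z hz
  rw [neg_mul, Real.exp_neg, ← div_eq_inv_mul, le_div_iff₀' (Real.exp_pos _)] at hjulia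
  rw [slope_def_field, (hφ.isFlow z hz).1, sub_zero, div_mul_eq_mul_div, sub_mul, one_mul]
  exact div_le_div_of_nonneg_right (sub_le_sub_right hjulia _) (mem_Ioi.1 ht).le

end BoundaryDynamics

section Multiplicativity

variable {g k : ℂ → ℂ} {a b c : ℝ}

lemma cayley_ofReal_mul (hσ : ‖σ‖ = 1) (ρ : ℝ) :
    cayley σ (ρ * σ) = ((1 + ρ) / (1 - ρ) : ℝ) := by
  have hσ0 : σ ≠ 0 := ne_zero_of_norm_ne_zero (hσ ▸ one_ne_zero)
  rw [cayley, ← one_add_mul, ← one_sub_mul, mul_div_mul_right _ _ hσ0]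
  push_cast
  rfl

/-- By Julia's lemma, `f` maps radii into Stolz regions. -/
lemma IsBRFPWith.tendsto_stolz (hf : DifferentiableOn ℂ f disk) (hmaps : MapsTo f disk disk)
    (hfix : IsBRFPWith f τ a) :
    Tendsto (fun ρ : ℝ ↦ f (ρ * τ)) (𝓝[<] 1) (𝓝[stolz τ 4] τ) := by
  have hτ := hfix.norm_eq_one
  obtain ⟨ha, hjulia⟩ := hfix.julia hf hmaps
  refine tendsto_nhdsWithin_iff.2 ⟨hfix.fixed.tendsto_radial hτ, ?_⟩
  have hquot := hfix.tendsto_sub_div.norm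
  rw [norm_mul, hτ, one_mul, Complex.norm_of_nonneg ha.le] at hquot
  filter_upwards [hquot.eventually_const_lt (half_lt_self ha), Ioo_mem_nhdsLT zero_lt_one]
    with ρ hhalf hρ
  have hz := ofReal_mul_mem_disk hτ hρ
  have hρ1 : 0 < 1 - ρ := sub_pos.2 hρ.2
  have hdist := norm_pos_iff.2 (sub_ne_zero_of_norm_eq_one hτ (hmaps hz))
  have hle := hjulia _ hz
  rw [cayley_ofReal_mul hτ, ofReal_re, cayley_re hτ, mul_div_assoc',
    div_le_div_iff₀ hρ1 (by positivity)] at hle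
  rw [norm_div, Complex.norm_of_nonneg hρ1.le, lt_div_iff₀ hρ1] at hhalf
  refine ⟨hmaps hz, ?_⟩
  rw [norm_sub_rev]
  set x := ‖τ - f (ρ * τ)‖
  set y := ‖f (ρ * τ)‖
  have hy : y < 1 := mem_disk.1 (hmaps hz)
  have hy0 : 0 ≤ y := norm_nonneg _
  have hsq : x * x ≤ x * (4 * (1 - y)) := by
    calc x * x ≤ (1 + ρ) * x ^ 2 := by nlinarith [hρ.1, sq_nonneg x]
      _ ≤ a * (1 - ρ) * (1 - y ^ 2) := hle.trans_eq (by ring)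
      _ ≤ 2 * x * (1 - y ^ 2) :=
        mul_le_mul_of_nonneg_right (by linarith) (by nlinarith)
      _ ≤ x * (4 * (1 - y)) := by nlinarith [mul_nonneg hdist.le (sq_nonneg (1 - y))]
  exact le_of_mul_le_mul_left hsq hdist

lemma IsBRFPWith.eq_mul_of_eqOn_comp (hf : IsBRFPWith f τ a) (hg : IsBRFPWith g τ b)
    (hk : IsBRFPWith k τ c) (hdiff : DifferentiableOn ℂ g disk) (hmaps : MapsTo g disk disk)
    (hcomp : EqOn k (f ∘ g) disk) : c = a * b := by
  have hτ := hf.norm_eq_one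
  have hlim := ((hf.angular_deriv 4).comp (hg.tendsto_stolz hdiff hmaps)).mul
    (hg.angular_deriv.tendsto_radial hτ)
  have heq := tendsto_nhds_unique_of_eventuallyEq (hk.angular_deriv.tendsto_radial hτ) hlim <| by
    filter_upwards [Ioo_mem_nhdsLT zero_lt_one] with ρ hρ
    have hz := ofReal_mul_mem_disk hτ hρ
    rw [Function.comp_apply, div_mul_div_cancel₀, hcomp hz, Function.comp_apply]
    exact sub_ne_zero.2 (sub_ne_zero.1 (sub_ne_zero_of_norm_eq_one hτ (hmaps hz))).symm
  exact_mod_cast heq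

end Multiplicativity

section CauchyEquation

variable {g : ℝ → ℝ} {s t : ℝ}

lemma natCast_mul_of_add (hadd : ∀ s t, 0 ≤ s → 0 ≤ t → g (s + t) = g s + g t) (ht : 0 ≤ t)
    (m : ℕ) : g (m * t) = m * g t := by
  induction m with
  | zero => simpa using hadd 0 0 le_rfl le_rfl
  | succ m ih =>
    push_cast
    rw [add_one_mul, hadd _ _ (by positivity) ht, ih, add_one_mul]

lemma mul_le_mul_of_add_of_nonneg (hadd : ∀ s t, 0 ≤ s → 0 ≤ t → g (s + t) = g s + g t)
    (hg : ∀ t, 0 ≤ t → 0 ≤ g t) (hs : 0 ≤ s) (ht : 0 < t) : g s * t ≤ g t * s := by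
  by_contra! hlt
  obtain ⟨m, hm⟩ := exists_nat_gt (g t * t / (g s * t - g t * s))
  rw [div_lt_iff₀ (sub_pos.2 hlt)] at hm
  set j := ⌈m * s / t⌉₊
  have hle : m * s ≤ j * t := (div_le_iff₀ ht).1 (Nat.le_ceil _)
  have hlt' : j * t < m * s + t := by
    have hceil := Nat.ceil_lt_add_one (a := m * s / t) (by positivity)
    rwa [← lt_div_iff₀ ht, add_div, div_self ht.ne']
  have hmono : m * g s ≤ j * g t := by
    have hsplit := hadd (m * s) (j * t - m * s) (by positivity) (sub_nonneg.2 hle)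
    rw [add_sub_cancel, natCast_mul_of_add hadd hs, natCast_mul_of_add hadd ht.le] at hsplit
    linarith [hg _ (sub_nonneg.2 hle)]
  nlinarith [mul_le_mul_of_nonneg_right hmono ht.le, mul_le_mul_of_nonneg_left hlt'.le (hg t ht.le)]

lemma eq_mul_of_add_of_nonneg (hadd : ∀ s t, 0 ≤ s → 0 ≤ t → g (s + t) = g s + g t)
    (hg : ∀ t, 0 ≤ t → 0 ≤ g t) (ht : 0 ≤ t) : g t = g 1 * t := by
  obtain rfl | ht' := ht.eq_or_lt
  · simpa using hadd 0 0 le_rfl le_rfl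
  · refine le_antisymm ?_ ?_
    · simpa using mul_le_mul_of_add_of_nonneg hadd hg ht zero_lt_one
    · simpa using mul_le_mul_of_add_of_nonneg hadd hg zero_le_one ht'

lemma exists_eq_exp_of_mul (hpos : ∀ t, 0 ≤ t → 0 < g t) (hle : ∀ t, 0 ≤ t → g t ≤ 1)
    (hmul : ∀ s t, 0 ≤ s → 0 ≤ t → g (s + t) = g s * g t) :
    ∃ l : ℝ, ∀ t, 0 ≤ t → g t = Real.exp (-l * t) := by
  refine ⟨-Real.log (g 1), fun t ht ↦ ?_⟩
  have hlog : -Real.log (g t) = -Real.log (g 1) * t := by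
    refine eq_mul_of_add_of_nonneg (g := fun t ↦ -Real.log (g t)) (fun s t hs ht ↦ ?_)
      (fun t ht ↦ neg_nonneg.2 (Real.log_nonpos (hpos t ht).le (hle t ht))) ht
    rw [hmul s t hs ht, Real.log_mul (hpos s hs).ne' (hpos t ht).ne', neg_add]
  rw [neg_mul, ← hlog, neg_neg, Real.exp_log (hpos t ht)]

end CauchyEquation

section BoundarySpectralValue

variable {G : ℂ → ℂ} {φ : ℝ → ℂ → ℂ} {n : ℕ} {σ : Fin n → ℂ} {lam : Fin n → ℝ} {t : ℝ}

lemma isBRFPWith_one_of_eqOn_id (hτ : ‖τ‖ = 1) (hf : EqOn f id disk) : IsBRFPWith f τ 1 := by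
  refine IsBRFPWith.of_tendsto hτ (tendsto_const_nhds.congr' ?_)
  filter_upwards [self_mem_nhdsWithin] with z hz
  rw [hf hz, id, div_self]
  exact sub_ne_zero.2 (sub_ne_zero.1 (sub_ne_zero_of_norm_eq_one hτ hz)).symm

lemma IsDWPoint.exists_le_one_isBRFPWith (hf : IsDWPoint f τ) (hτ : ‖τ‖ = 1) :
    ∃ d : ℝ, d ≤ 1 ∧ IsBRFPWith f τ d :=
  (hf.2.resolve_left fun hin ↦ notMem_disk_of_norm_eq_one hτ hin.1).2

lemma Generates.exists_le_one_isBRFPWith (hφ : Generates G φ) (hτ : ‖τ‖ = 1)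
    (hdw : EqOn G 0 disk ∨ IsDWPointOf φ τ) (ht : 0 ≤ t) :
    ∃ d : ℝ, d ≤ 1 ∧ IsBRFPWith (φ t) τ d := by
  by_cases hid : EqOn (φ t) id disk
  · exact ⟨1, le_rfl, by simpa using isBRFPWith_one_of_eqOn_id hτ hid⟩
  · obtain hzero | hdw := hdw
    · exact absurd (fun z hz ↦ hφ.apply_eq_self hz (hzero hz) ht) hid
    · exact (hdw.2 t ht hid).exists_le_one_isBRFPWith hτ

theorem exists_isSpectralValue_ofReal_of_mem_Gen (hτ : ‖τ‖ = 1) (hG : G ∈ Gen τ σ lam) :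
    ∃ l : ℝ, IsSpectralValue G τ l := by
  obtain ⟨φ, hφ, hdw, -⟩ := hG
  choose! d hle hfix using fun t (ht : 0 ≤ t) ↦ hφ.exists_le_one_isBRFPWith hτ hdw ht
  have hholo := hφ.semigroup.holo
  have hmaps := hφ.semigroup.mapsTo
  obtain ⟨l, hl⟩ := exists_eq_exp_of_mul
    (fun t ht ↦ ((hfix t ht).julia (hholo t ht) (hmaps t ht)).1) hle fun s t hs ht ↦
      (hfix s hs).eq_mul_of_eqOn_comp (hfix t ht) (hfix (s + t) (add_nonneg hs ht)) (hholo t ht)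
        (hmaps t ht) (hφ.semigroup.add s t hs ht)
  refine ⟨l, φ, hφ, fun t ht ↦ Or.inr ?_⟩
  have hexp := hfix t ht
  rw [hl t ht] at hexp
  exact_mod_cast hexp

end BoundarySpectralValue

section BoundaryExtremal

variable {n : ℕ} {σ : Fin n → ℂ} {lam : Fin n → ℝ} {G : ℂ → ℂ} {φ : ℝ → ℂ → ℂ} {l : ℝ}

lemma hasDerivAt_cayley_of_norm_eq_one {s : ℂ} (hs : ‖s‖ = 1) (hτ : ‖τ‖ = 1) (hne : τ ≠ s) :
    HasDerivAt (cayley s) (-(2 * conj τ / (‖τ - s‖ : ℂ) ^ 2)) τ := by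
  have hsub : s - τ ≠ 0 := sub_ne_zero.2 hne.symm
  refine (((hasDerivAt_id τ).const_add s).div ((hasDerivAt_id τ).const_sub s) hsub).congr_deriv ?_
  have hconj : conj (s - τ) ≠ 0 := star_ne_zero.2 hsub
  rw [norm_sub_rev, ← mul_conj']
  simp only [id]
  field_simp
  rw [map_sub]
  linear_combination 2 * mul_conj_of_norm_eq_one hs - 2 * mul_conj_of_norm_eq_one hτ

lemma hasDerivAt_pZero_of_norm_eq_one (hσ : ∀ k, ‖σ k‖ = 1) (hτ : ‖τ‖ = 1)
    (hne : ∀ k, τ ≠ σ k) : HasDerivAt (pZero τ σ lam) (-(conj τ / radius lam)) τ := by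
  have hterm (k : Fin n) : (alpha τ σ lam k : ℂ) * -(2 * conj τ / (‖τ - σ k‖ : ℂ) ^ 2) =
      -(conj τ * (|lam k|⁻¹ : ℝ)) := by
    have hdist : (‖τ - σ k‖ : ℂ) ≠ 0 :=
      ofReal_ne_zero.2 (norm_ne_zero_iff.2 (sub_ne_zero.2 (hne k)))
    rw [alpha]
    push_cast
    field_simp
  refine (HasDerivAt.fun_sum fun k _ ↦ (hasDerivAt_cayley_of_norm_eq_one (hσ k) hτ
    (hne k)).const_mul (alpha τ σ lam k : ℂ)).congr_deriv ?_
  rw [Finset.sum_congr rfl fun k _ ↦ hterm k, Finset.sum_neg_distrib, ← Finset.mul_sum,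
    ← ofReal_sum, radius, ofReal_inv, div_inv_eq_mul]

lemma tendsto_slope_pZero (hσ : ∀ k, ‖σ k‖ = 1) (hτ : ‖τ‖ = 1) (hne : ∀ k, τ ≠ σ k) :
    Tendsto (slope (pZero τ σ lam) τ) (𝓝[disk] τ) (𝓝 (-(conj τ / radius lam))) :=
  (hasDerivAt_pZero_of_norm_eq_one hσ hτ hne).tendsto_slope.mono_left <|
    nhdsWithin_mono τ fun _ hz hzτ ↦ notMem_disk_of_norm_eq_one hτ (hzτ ▸ hz)

lemma pZero_re_self (hσ : ∀ k, ‖σ k‖ = 1) (hτ : ‖τ‖ = 1) (hne : ∀ k, τ ≠ σ k) :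
    (pZero τ σ lam τ).re = 0 := by
  simp [pZero_self hσ hne, hτ]

lemma tendsto_cayley_re_mul_pZero_re (hσ : ∀ k, ‖σ k‖ = 1) (hτ : ‖τ‖ = 1)
    (hne : ∀ k, τ ≠ σ k) :
    Tendsto (fun ρ : ℝ ↦ (cayley τ (ρ * τ)).re * (pZero τ σ lam (ρ * τ)).re) (𝓝[<] 1)
      (𝓝 (2 / radius lam)) := by
  have hdisk : Tendsto (fun ρ : ℝ ↦ ρ * τ) (𝓝[<] 1) (𝓝[disk] τ) :=
    tendsto_nhdsWithin_iff.2 ⟨tendsto_ofReal_mul τ, by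
      filter_upwards [Ioo_mem_nhdsLT zero_lt_one] with ρ hρ using ofReal_mul_mem_disk hτ hρ⟩
  have hlim := ((tendsto_ofReal_mul τ).const_add τ).neg.mul
    ((tendsto_slope_pZero (lam := lam) hσ hτ hne).comp hdisk)
  have hvalue : -(τ + τ) * -(conj τ / radius lam) = (2 / radius lam : ℝ) := by
    push_cast
    linear_combination 2 / (radius lam : ℂ) * mul_conj_of_norm_eq_one hτ
  rw [hvalue] at hlim
  refine ((continuous_re.tendsto _).comp hlim).congr' ?_
  filter_upwards with ρ
  have hprod : -(τ + ρ * τ) * slope (pZero τ σ lam) τ (ρ * τ) =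
      cayley τ (ρ * τ) * (pZero τ σ lam (ρ * τ) - pZero τ σ lam τ) := by
    rw [slope_def_field, cayley, ← neg_sub τ, div_neg]
    ring
  rw [Function.comp_apply, Function.comp_apply, hprod, cayley_ofReal_mul hτ, re_ofReal_mul, sub_re,
    pZero_re_self hσ hτ hne, sub_zero, ofReal_re]

lemma GMax_eq_genWith_of_norm_eq_one (hσ : ∀ k, ‖σ k‖ = 1) (hτ : ‖τ‖ = 1)
    (hne : ∀ k, τ ≠ σ k) : GMax τ σ lam = genWith τ σ lam (-pZero τ σ lam τ) := by
  rw [GMax_eq_genWith hσ hne, hτ, one_pow, sub_self, ofReal_zero, zero_div, zero_sub]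

lemma tendsto_GMax_div [NeZero n] (hσ : ∀ k, ‖σ k‖ = 1) (hlam : ∀ k, lam k < 0) (hτ : ‖τ‖ = 1)
    (hne : ∀ k, τ ≠ σ k) :
    Tendsto (fun z ↦ GMax τ σ lam z / (z - τ)) (𝓝[disk] τ) (𝓝 (-(radius lam : ℂ))) := by
  have hr : (radius lam : ℂ) ≠ 0 := ofReal_ne_zero.2 (radius_pos hlam).ne'
  have hτ0 : conj τ ≠ 0 := star_ne_zero.2 (ne_zero_of_norm_ne_zero (hτ ▸ one_ne_zero))
  have hlim := (tendsto_const_nhds (x := conj τ)).div (tendsto_slope_pZero (lam := lam) hσ hτ hne)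
    (neg_ne_zero.2 (div_ne_zero hτ0 hr))
  rw [div_neg, div_div_cancel₀ hτ0] at hlim
  refine hlim.congr' ?_
  filter_upwards [self_mem_nhdsWithin] with z hz
  have hsub := sub_ne_zero_of_norm_eq_one hτ hz
  have hbp : bpFactor τ z = conj τ * (z - τ) * (z - τ) := by
    rw [bpFactor]
    linear_combination (τ - z) * -mul_conj_of_norm_eq_one hτ
  rw [GMax_eq_genWith_of_norm_eq_one hσ hτ hne, genWith, hbp, Pi.div_apply, slope_def_field,
    div_div_eq_mul_div,
    neg_add_eq_sub, div_right_comm, mul_div_cancel_right₀]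
  rwa [← neg_sub, neg_ne_zero]

lemma GMax_isDWPointOf [NeZero n] (hσ : ∀ k, ‖σ k‖ = 1) (hlam : ∀ k, lam k < 0) (hτ : ‖τ‖ = 1)
    (hne : ∀ k, τ ≠ σ k) (hφ : Generates (GMax τ σ lam) φ)
    (hs : HasSpectralValue φ τ (radius lam)) : IsDWPointOf φ τ := by
  have hG := GMax_eq_genWith_of_norm_eq_one (lam := lam) hσ hτ hne
  have hre : (-pZero τ σ lam τ).re = 0 := neg_eq_zero.2 (pZero_re_self hσ hτ hne)
  refine ⟨(hG ▸ hφ).exists_genWith_not_eqOn_id hσ hlam hτ.le hne hre.ge, fun t ht hid ↦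
    ⟨hid, Or.inr ⟨fun z hz ↦ ?_, Real.exp (-radius lam * t), ?_, hs.isBRFPWith hτ ht⟩⟩⟩
  · have ht0 : 0 < t := ht.lt_of_ne fun h0 ↦ hid fun w hw ↦ h0 ▸ hφ.semigroup.zero w hw
    refine hφ.isFlow.apply_ne_self hτ (q := fun z ↦ (-pZero τ σ lam τ + pZero τ σ lam z)⁻¹)
      (fun w _ ↦ by rw [hG, genWith, div_eq_mul_inv]) (fun w hw ↦ ?_) hz ht0
    rw [inv_re, add_re, hre, zero_add]
    exact div_pos (pZero_re_pos hσ hlam hne hw)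
      (normSq_pos.2 (add_pZero_ne_zero hσ hlam hne hre.ge hw))
  · rw [Real.exp_le_one_iff, neg_mul, neg_nonpos]
    exact mul_nonneg (radius_pos hlam).le ht

theorem GMax_mem_Gen_of_norm_eq_one [NeZero n] (hσ : ∀ k, ‖σ k‖ = 1)
    (hinj : Function.Injective σ) (hlam : ∀ k, lam k < 0) (hτ : ‖τ‖ = 1) (hne : ∀ k, τ ≠ σ k) :
    GMax τ σ lam ∈ Gen τ σ lam ∧ IsSpectralValue (GMax τ σ lam) τ (radius lam) := by
  have hG := GMax_eq_genWith_of_norm_eq_one (lam := lam) hσ hτ hne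
  have hre : (-pZero τ σ lam τ).re = 0 := neg_eq_zero.2 (pZero_re_self hσ hτ hne)
  obtain ⟨φ, hφ⟩ := exists_generates_genWith hσ hlam hτ.le hne hre.ge
  have hs := (hG ▸ hφ).hasSpectralValue_of_tendsto hτ (tendsto_GMax_div hσ hlam hτ hne)
  refine ⟨?_, φ, hG ▸ hφ, hs⟩
  rw [hG]
  exact genWith_mem_Gen hσ hinj hlam hne hφ (GMax_isDWPointOf hσ hlam hτ hne (hG ▸ hφ) hs)

lemma IsSpectralValue.nonpos_of_eqOn_zero (hτ : ‖τ‖ = 1) (hl : IsSpectralValue G τ l)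
    (hG : EqOn G 0 disk) : l ≤ 0 := by
  obtain ⟨φ, hφ, hs⟩ := hl
  have hle := hφ.mul_cayley_re_le hτ (q := 0) (fun z hz ↦ by simp [hG hz]) hs zero_mem_disk
  exact nonpos_of_mul_nonpos_left (by simpa using hle) (cayley_re_pos hτ zero_mem_disk)

lemma IsSpectralValue.mul_cayley_re_mul_norm_le (hτ : ‖τ‖ = 1) (hl : IsSpectralValue G τ l)
    (hG : EqOn G (fun z ↦ genWith τ σ lam (h z) z) disk) (hz : z ∈ disk) :
    l * (cayley τ z).re * ‖h z + pZero τ σ lam z‖ ≤ 2 := by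
  obtain ⟨φ, hφ, hs⟩ := hl
  have hle := hφ.mul_cayley_re_le hτ (q := fun z ↦ (h z + pZero τ σ lam z)⁻¹)
    (fun z hz ↦ (hG hz).trans (div_eq_mul_inv _ _)) hs hz
  calc l * (cayley τ z).re * ‖h z + pZero τ σ lam z‖
      ≤ 2 * ‖(h z + pZero τ σ lam z)⁻¹‖ * ‖h z + pZero τ σ lam z‖ :=
        mul_le_mul_of_nonneg_right (hle.trans (mul_le_mul_of_nonneg_left (re_le_norm _)
          zero_le_two)) (norm_nonneg _)
    _ ≤ 2 := by
        rw [norm_inv, mul_assoc]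
        exact mul_le_of_le_one_right zero_le_two inv_mul_le_one

lemma IsSpectralValue.mul_cayley_re_mul_add_re_le (hτ : ‖τ‖ = 1) (hl : IsSpectralValue G τ l)
    (hl0 : 0 ≤ l) (hG : EqOn G (fun z ↦ genWith τ σ lam (h z) z) disk) (hz : z ∈ disk) :
    l * (cayley τ z).re * ((h z).re + (pZero τ σ lam z).re) ≤ 2 :=
  (mul_le_mul_of_nonneg_left (re_le_norm _)
    (mul_nonneg hl0 (cayley_re_pos hτ hz).le)).trans (hl.mul_cayley_re_mul_norm_le hτ hG hz)

theorem IsSpectralValue.le_radius [NeZero n] (hσ : ∀ k, ‖σ k‖ = 1)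
    (hinj : Function.Injective σ) (hlam : ∀ k, lam k < 0) (hτ : ‖τ‖ = 1) (hne : ∀ k, τ ≠ σ k)
    (hG : G ∈ Gen τ σ lam) (hl : IsSpectralValue G τ l) : l ≤ radius lam := by
  have hr := radius_pos hlam
  obtain hl0 | hl0 := le_or_gt l 0
  · exact hl0.trans hr.le
  obtain hG | ⟨h, hh, hG⟩ := exists_isCaratheodory_of_mem_Gen hσ hinj hne hτ.le hG
  · exact (hl.nonpos_of_eqOn_zero hτ hG).trans hr.le
  have hlim := (tendsto_cayley_re_mul_pZero_re (lam := lam) hσ hτ hne).const_mul l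
  have hle : l * (2 / radius lam) ≤ 2 := by
    refine le_of_tendsto hlim ?_
    filter_upwards [Ioo_mem_nhdsLT zero_lt_one] with ρ hρ
    have hz := ofReal_mul_mem_disk hτ hρ
    rw [← mul_assoc]
    exact (mul_le_mul_of_nonneg_left (le_add_of_nonneg_left (hh.re_nonneg _ hz))
      (mul_nonneg hl0.le (cayley_re_pos hτ hz).le)).trans
        (hl.mul_cayley_re_mul_add_re_le hτ hl0.le hG hz)
  rw [mul_div_assoc', div_le_iff₀ hr] at hle
  linarith

lemma IsCaratheodory.re_zero_le_cayley_re_mul (hh : IsCaratheodory h) (hτ : ‖τ‖ = 1) {ρ : ℝ}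
    (hρ : ρ ∈ Ioo (0 : ℝ) 1) : (h 0).re ≤ 4 * ((cayley τ (ρ * τ)).re * (h (ρ * τ)).re) := by
  have hz := ofReal_mul_mem_disk hτ hρ
  have hρ1 : 0 < 1 - ρ := sub_pos.2 hρ.2
  have hharnack := hh.harnack hz zero_mem_disk
  simp only [norm_ofReal_mul hτ hρ.1.le, norm_zero, map_zero, zero_mul, sub_zero, norm_one, ne_eq,
    OfNat.ofNat_ne_zero, not_false_eq_true, zero_pow, mul_one, one_pow] at hharnack
  rw [cayley_ofReal_mul hτ, ofReal_re]
  have h0 := hh.re_nonneg 0 zero_mem_disk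
  calc (h 0).re ≤ (1 + ρ) / (1 - ρ) * ((1 - ρ ^ 2) * (h 0).re) := by
        rw [show (1 + ρ) / (1 - ρ) * ((1 - ρ ^ 2) * (h 0).re) = (1 + ρ) ^ 2 * (h 0).re by
          field_simp; ring]
        nlinarith [hρ.1, mul_nonneg hρ.1.le h0]
    _ ≤ (1 + ρ) / (1 - ρ) * (4 * (h (ρ * τ)).re) :=
        mul_le_mul_of_nonneg_left hharnack (div_nonneg (by linarith [hρ.1]) hρ1.le)
    _ = _ := by ring

lemma re_zero_eq_zero_of_isSpectralValue_radius [NeZero n] (hσ : ∀ k, ‖σ k‖ = 1)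
    (hlam : ∀ k, lam k < 0) (hτ : ‖τ‖ = 1) (hne : ∀ k, τ ≠ σ k) (hh : IsCaratheodory h)
    (hG : EqOn G (fun z ↦ genWith τ σ lam (h z) z) disk)
    (hs : IsSpectralValue G τ (radius lam)) : (h 0).re = 0 := by
  have hr := radius_pos hlam
  have hlim := ((tendsto_cayley_re_mul_pZero_re (lam := lam) hσ hτ hne).const_sub
    (2 / radius lam)).const_mul 4
  rw [sub_self, mul_zero] at hlim
  refine le_antisymm (ge_of_tendsto hlim ?_) (hh.re_nonneg 0 zero_mem_disk)
  filter_upwards [Ioo_mem_nhdsLT zero_lt_one] with ρ hρ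
  have hle := hs.mul_cayley_re_mul_add_re_le hτ hr.le hG (ofReal_mul_mem_disk hτ hρ)
  rw [mul_assoc, ← le_div_iff₀' hr] at hle
  linarith [hh.re_zero_le_cayley_re_mul hτ hρ]

lemma eq_neg_pZero_of_isSpectralValue_radius [NeZero n] (hσ : ∀ k, ‖σ k‖ = 1)
    (hlam : ∀ k, lam k < 0) (hτ : ‖τ‖ = 1) (hne : ∀ k, τ ≠ σ k) {a : ℂ}
    (hG : EqOn G (genWith τ σ lam a) disk) (hs : IsSpectralValue G τ (radius lam)) :
    a = -pZero τ σ lam τ := by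
  have hr := radius_pos hlam
  have hcont := (hasDerivAt_pZero_of_norm_eq_one (lam := lam) hσ hτ hne).continuousAt
  have hnorm := ((hcont.tendsto.comp (tendsto_ofReal_mul τ)).const_add a).norm
  have hbound : Tendsto (fun ρ : ℝ ↦ 2 / radius lam * (1 - ρ)) (𝓝[<] 1)
      (𝓝 (2 / radius lam * (1 - 1))) :=
    (Continuous.tendsto (by fun_prop) 1).mono_left nhdsWithin_le_nhds
  have hle := le_of_tendsto_of_tendsto hnorm hbound <| by
    filter_upwards [Ioo_mem_nhdsLT zero_lt_one] with ρ hρ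
    have hle := hs.mul_cayley_re_mul_norm_le (h := fun _ ↦ a) hτ hG (ofReal_mul_mem_disk hτ hρ)
    have hρ1 : 0 < 1 - ρ := sub_pos.2 hρ.2
    rw [cayley_ofReal_mul hτ, ofReal_re] at hle
    rw [Function.comp_apply, div_mul_eq_mul_div, le_div_iff₀' hr]
    rw [mul_div_assoc', div_mul_eq_mul_div, div_le_iff₀ hρ1] at hle
    refine le_trans ?_ hle
    gcongr
    exact le_mul_of_one_le_right hr.le (by linarith [hρ.1])
  rw [sub_self, mul_zero] at hle
  exact eq_neg_of_add_eq_zero_left (norm_le_zero_iff.1 hle)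

theorem IsSpectralValue.eqOn_GMax [NeZero n] (hσ : ∀ k, ‖σ k‖ = 1)
    (hinj : Function.Injective σ) (hlam : ∀ k, lam k < 0) (hτ : ‖τ‖ = 1) (hne : ∀ k, τ ≠ σ k)
    (hG : G ∈ Gen τ σ lam) (hs : IsSpectralValue G τ (radius lam)) :
    EqOn G (GMax τ σ lam) disk := by
  obtain hG | ⟨h, hh, hG⟩ := exists_isCaratheodory_of_mem_Gen hσ hinj hne hτ.le hG
  · exact absurd (hs.nonpos_of_eqOn_zero hτ hG) (radius_pos hlam).not_ge
  have hconst := hh.eqOn_const_of_re_eq_zero zero_mem_disk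
    (re_zero_eq_zero_of_isSpectralValue_radius hσ hlam hτ hne hh hG hs)
  have hG' : EqOn G (genWith τ σ lam (h 0)) disk := fun z hz ↦ (hG hz).trans <| by
    simp only [hconst hz]
  rwa [GMax_eq_genWith_of_norm_eq_one hσ hτ hne,
    ← eq_neg_pZero_of_isSpectralValue_radius hσ hlam hτ hne hG' hs]

end BoundaryExtremal

end DiskSemigroup

open DiskSemigroup in
theorem mainTheorem7 {n : ℕ} (hn : 0 < n) (σ : Fin n → ℂ) (hσ : ∀ k, ‖σ k‖ = 1)
    (hinj : Function.Injective σ) (lam : Fin n → ℝ) (hlam : ∀ k, lam k < 0) :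
    -- interior Denjoy-Wolff point
    (∀ τ : ℂ, ‖τ‖ < 1 →
      -- the functional is well defined on the class
      (∀ G ∈ DiskSemigroup.Gen τ σ lam, ∃! ω : ℂ, DiskSemigroup.IsSpectralValue G τ ω) ∧
      -- its range
      {ω : ℂ | ∃ G ∈ DiskSemigroup.Gen τ σ lam, DiskSemigroup.IsSpectralValue G τ ω}
        = {ω : ℂ | ‖ω - (DiskSemigroup.radius lam : ℂ)‖ ≤ DiskSemigroup.radius lam} ∧
      -- every boundary point is delivered by exactly one generator
      (∀ ω : ℂ, ‖ω - (DiskSemigroup.radius lam : ℂ)‖ = DiskSemigroup.radius lam →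
        ∃ G ∈ DiskSemigroup.Gen τ σ lam, DiskSemigroup.IsSpectralValue G τ ω ∧
          ∀ G' ∈ DiskSemigroup.Gen τ σ lam, DiskSemigroup.IsSpectralValue G' τ ω →
            EqOn G' G DiskSemigroup.disk) ∧
      -- the family of these generators, for `τ ≠ 0`
      (τ ≠ 0 →
        (∀ G ∈ DiskSemigroup.Gen τ σ lam, ∀ ω : ℂ,
          ‖ω - (DiskSemigroup.radius lam : ℂ)‖ = DiskSemigroup.radius lam →
          DiskSemigroup.IsSpectralValue G τ ω →
            ∃ ζ ∈ frontier (DiskSemigroup.Z τ σ lam),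
              EqOn G (DiskSemigroup.GZeta τ σ lam ζ) DiskSemigroup.disk) ∧
        (∀ ζ ∈ frontier (DiskSemigroup.Z τ σ lam),
          DiskSemigroup.GZeta τ σ lam ζ ∈ DiskSemigroup.Gen τ σ lam ∧
          ∃ ω : ℂ, ‖ω - (DiskSemigroup.radius lam : ℂ)‖ = DiskSemigroup.radius lam ∧
            DiskSemigroup.IsSpectralValue (DiskSemigroup.GZeta τ σ lam ζ) τ ω)) ∧
      -- the family of these generators, for `τ = 0`
      (τ = 0 → ∀ ω : ℂ, ‖ω - (DiskSemigroup.radius lam : ℂ)‖ = DiskSemigroup.radius lam →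
        DiskSemigroup.GHat σ lam ω ∈ DiskSemigroup.Gen τ σ lam ∧
        DiskSemigroup.IsSpectralValue (DiskSemigroup.GHat σ lam ω) τ ω) ∧
      -- the sharp estimate of the real part
      (∀ G ∈ DiskSemigroup.Gen τ σ lam, ∀ ω : ℂ, DiskSemigroup.IsSpectralValue G τ ω →
        ω.re ≤ 2 * DiskSemigroup.radius lam ∧
        (ω.re = 2 * DiskSemigroup.radius lam →
          EqOn G (DiskSemigroup.GMax τ σ lam) DiskSemigroup.disk)) ∧
      DiskSemigroup.GMax τ σ lam ∈ DiskSemigroup.Gen τ σ lam ∧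
      DiskSemigroup.IsSpectralValue (DiskSemigroup.GMax τ σ lam) τ
        ((2 * DiskSemigroup.radius lam : ℝ) : ℂ)) ∧
    -- boundary Denjoy-Wolff point
    (∀ τ : ℂ, ‖τ‖ = 1 → (∀ k, τ ≠ σ k) →
      -- the functional is well defined and real on the class
      (∀ G ∈ DiskSemigroup.Gen τ σ lam,
        (∃! ω : ℂ, DiskSemigroup.IsSpectralValue G τ ω) ∧
        ∃ l : ℝ, DiskSemigroup.IsSpectralValue G τ (l : ℂ) ∧ l ≤ DiskSemigroup.radius lam ∧
          (l = DiskSemigroup.radius lam →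
            EqOn G (DiskSemigroup.GMax τ σ lam) DiskSemigroup.disk)) ∧
      DiskSemigroup.GMax τ σ lam ∈ DiskSemigroup.Gen τ σ lam ∧
      DiskSemigroup.IsSpectralValue (DiskSemigroup.GMax τ σ lam) τ
        (DiskSemigroup.radius lam : ℂ)) := by
  have := NeZero.of_pos hn
  refine ⟨fun τ hτ1 ↦ ?_, fun τ hτ hne ↦ ⟨fun G hG ↦ ?_, ?_⟩⟩
  · have hτ : τ ∈ disk := mem_disk.2 hτ1
    have hmem {ω : ℂ} (hω : ‖ω - radius lam‖ = radius lam) :=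
      genOfSpectralValue_mem_Gen hσ hinj hlam hτ hω.le
    refine ⟨fun _ ↦ existsUnique_isSpectralValue_of_mem_Gen hτ,
      setOf_isSpectralValue hσ hinj hlam hτ, fun ω hω ↦ ⟨_, (hmem hω).1, (hmem hω).2,
        fun _ ↦ eqOn_genOfSpectralValue hσ hinj hlam hτ hω⟩,
      fun hτ0 ↦ ⟨fun G hG ω hω hs ↦ ?_, fun ζ hζ ↦ ?_⟩, ?_,
      fun _ hG _ hs ↦ ⟨hs.re_le_two_mul_radius hσ hinj hlam hτ hG,
        hs.eqOn_GMax_of_re_eq hσ hinj hlam hτ hG⟩, GMax_mem_Gen_of_mem_disk hσ hinj hlam hτ⟩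
    · obtain ⟨ζ, hζ, heq⟩ := exists_GZeta_eq_genOfSpectralValue hσ hlam hτ hτ0 hω
      exact ⟨ζ, hζ, heq ▸ eqOn_genOfSpectralValue hσ hinj hlam hτ hω hG hs⟩
    · obtain ⟨ω, hω, heq⟩ := exists_genOfSpectralValue_eq_GZeta hσ hlam hτ hτ0 hζ
      exact heq ▸ ⟨(hmem hω).1, ω, hω, (hmem hω).2⟩
    · rintro rfl ω hω
      exact GHat_eq_genOfSpectralValue hσ hlam hω ▸ hmem hω
  · obtain ⟨l, hl⟩ := exists_isSpectralValue_ofReal_of_mem_Gen hτ hG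
    exact ⟨⟨l, hl, fun _ hω ↦ hω.unique hl⟩, l, hl, hl.le_radius hσ hinj hlam hτ hne hG,
      fun hr ↦ (hr ▸ hl).eqOn_GMax hσ hinj hlam hτ hne hG⟩
  · exact GMax_mem_Gen_of_norm_eq_one hσ hinj hlam hτ hne
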